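/- Let $N\ge 1$, let $\hbar\neq 0$, and let $\boldsymbol\gamma_N=(\gamma_{N1},\dots,\gamma_{NN})\in\mathbb C^N$ be fixed. Let $M$ be the space of meromorphic functions in the $\tfrac12N(N-1)$ complex variables $\gamma_{nj}$, $1\le j\le n\le N-1$. Consider the operators on $M$ $$E_{nn}=\frac1{i\hbar}\Big(\sum_{j=1}^n\gamma_{nj}-\sum_{j=1}^{n-1}\gamma_{n-1,j}\Big)\quad(1\le n\le N),$$ $$E_{n,n+1}=-\frac1{i\hbar}\sum_{j=1}^n\frac{\prod_{r=1}^{n+1}(\gamma_{nj}-\gamma_{n+1,r}-\frac{i\hbar}2)}{\prod_{s\ne j}(\gamma_{nj}-\gamma_{ns})}\,e^{-i\hbar\partial_{\gamma_{nj}}},\qquad E_{n+1,n}=\frac1{i\hbar}\sum_{j=1}^n\frac{\prod_{r=1}^{n-1}(\gamma_{nj}-\gamma_{n-1,r}+\frac{i\hbar}2)}{\prod_{s\ne j}(\gamma_{nj}-\gamma_{ns})}\,e^{i\hbar\partial_{\gamma_{nj}}}\quad(1\le n\le N-1),$$ where $e^{c\,\partial_{\gamma_{nj}}}$ is the shift $\gamma_{nj}\mapsto\gamma_{nj}+c$.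 They extend to a unique representation of the Lie algebra $\mathfrak{gl}(N)$ over $\mathbb C$ in $M$, with $E_{jk}$ corresponding to the matrix units, and hence to a representation of $\mathcal U(\mathfrak{gl}(N))$. For $1\le n\le N$ and $\lambda\in\mathbb C$ let $$\mathcal A_n(\lambda)=\sum_{p\in P_n}\operatorname{sign}p\,\Big[(\lambda-i\hbar\rho^{(n)}_1)\delta_{p(1),1}-i\hbar E_{p(1),1}\Big]\cdots\Big[(\lambda-i\hbar\rho^{(n)}_n)\delta_{p(n),n}-i\hbar E_{p(n),n}\Big]\in\mathcal U(\mathfrak{gl}(n))\subset\mathcal U(\mathfrak{gl}(N)),$$ where $P_n$ is the group of permutations of $\{1,\dots,n\}$ and $\rho^{(n)}_k=\frac12(n-2k+1)$. Then, in this representation, $\mathcal A_n(\lambda)$ acts on $M$ as multiplication by $$\prod_{j=1}^n(\lambda-\gamma_{nj})\qquad(n=1,\dots,N).$$ -/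

import Mathlib

open scoped Topology
open Filter

attribute [local instance 100] LieRing.ofAssociativeRing

/-! ### Meromorphic functions of several complex variables -/

section Meromorphic

variable {X : Type*} [NormedAddCommGroup X] [NormedSpace ℂ X]

/-- Near `p` the function `f` is a quotient `g / h` of holomorphic functions, where the germ of `h`
at `p` is not zero. The values of `f` on the zero set of `h` are irrelevant. -/
def IsMeroAt (f : X → ℂ) (p : X) : Prop :=
  ∃ g h : X → ℂ, AnalyticAt ℂ g p ∧ AnalyticAt ℂ h p ∧ (∃ᶠ z in 𝓝 p, h z ≠ 0) ∧
    ∀ᶠ z in 𝓝 p, h z ≠ 0 → f z = g z / h z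

/-- The ring of germs of holomorphic functions at a point has no zero divisors. -/
theorem frequently_mul_ne_zero {h₁ h₂ : X → ℂ} {p : X} (a₁ : AnalyticAt ℂ h₁ p)
    (a₂ : AnalyticAt ℂ h₂ p) (f₁ : ∃ᶠ z in 𝓝 p, h₁ z ≠ 0) (f₂ : ∃ᶠ z in 𝓝 p, h₂ z ≠ 0) :
    ∃ᶠ z in 𝓝 p, h₁ z * h₂ z ≠ 0 := by
  intro H
  obtain ⟨r, hr, hB⟩ := Metric.eventually_nhds_iff_ball.1
    ((a₁.eventually_analyticAt.and a₂.eventually_analyticAt).and H)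
  obtain ⟨q, hq, hqB⟩ := (f₁.and_eventually (Metric.ball_mem_nhds p hr)).exists
  have c₁ : ∀ᶠ z in 𝓝 q, h₁ z ≠ 0 :=
    (hB q hqB).1.1.continuousAt.eventually_ne hq
  have z₂ : h₂ =ᶠ[𝓝 q] 0 := by
    filter_upwards [c₁, Metric.isOpen_ball.mem_nhds hqB] with z hz hzB
    have h0 := (hB z hzB).2
    simp only [ne_eq, not_not, mul_eq_zero] at h0
    exact h0.resolve_left hz
  have e₂ : Set.EqOn h₂ 0 (Metric.ball p r) :=
    AnalyticOnNhd.eqOn_zero_of_preconnected_of_eventuallyEq_zero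
      (fun z hz => (hB z hz).1.2) (convex_ball p r).isPreconnected hqB z₂
  obtain ⟨w, hw, hwB⟩ := (f₂.and_eventually (Metric.ball_mem_nhds p hr)).exists
  exact hw (e₂ hwB)

theorem AnalyticAt.isMeroAt {f : X → ℂ} {p : X} (hf : AnalyticAt ℂ f p) : IsMeroAt f p :=
  ⟨f, fun _ => 1, hf, analyticAt_const, Frequently.of_forall fun _ => one_ne_zero,
    Eventually.of_forall fun z _ => by simp⟩

theorem IsMeroAt.mul {f₁ f₂ : X → ℂ} {p : X} (m₁ : IsMeroAt f₁ p) (m₂ : IsMeroAt f₂ p) :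
    IsMeroAt (f₁ * f₂) p := by
  obtain ⟨g₁, h₁, ag₁, ah₁, n₁, e₁⟩ := m₁
  obtain ⟨g₂, h₂, ag₂, ah₂, n₂, e₂⟩ := m₂
  refine ⟨fun z => g₁ z * g₂ z, fun z => h₁ z * h₂ z, ag₁.mul ag₂, ah₁.mul ah₂,
    frequently_mul_ne_zero ah₁ ah₂ n₁ n₂, ?_⟩
  filter_upwards [e₁, e₂] with z k₁ k₂ hz
  rw [Pi.mul_apply, k₁ (left_ne_zero_of_mul hz), k₂ (right_ne_zero_of_mul hz), div_mul_div_comm]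

theorem IsMeroAt.add {f₁ f₂ : X → ℂ} {p : X} (m₁ : IsMeroAt f₁ p) (m₂ : IsMeroAt f₂ p) :
    IsMeroAt (f₁ + f₂) p := by
  obtain ⟨g₁, h₁, ag₁, ah₁, n₁, e₁⟩ := m₁
  obtain ⟨g₂, h₂, ag₂, ah₂, n₂, e₂⟩ := m₂
  refine ⟨fun z => g₁ z * h₂ z + h₁ z * g₂ z, fun z => h₁ z * h₂ z,
    (ag₁.mul ah₂).add (ah₁.mul ag₂), ah₁.mul ah₂, frequently_mul_ne_zero ah₁ ah₂ n₁ n₂, ?_⟩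
  filter_upwards [e₁, e₂] with z k₁ k₂ hz
  rw [Pi.add_apply, k₁ (left_ne_zero_of_mul hz), k₂ (right_ne_zero_of_mul hz),
    div_add_div _ _ (left_ne_zero_of_mul hz) (right_ne_zero_of_mul hz)]

theorem AnalyticAt.isMeroAt_inv {h : X → ℂ} {p : X} (ah : AnalyticAt ℂ h p)
    (n : ∃ᶠ z in 𝓝 p, h z ≠ 0) : IsMeroAt (fun z => (h z)⁻¹) p :=
  ⟨fun _ => 1, h, analyticAt_const, ah, n, Eventually.of_forall fun z _ => by simp⟩

theorem IsMeroAt.comp_add {f : X → ℂ} {p v : X} (m : IsMeroAt f (p + v)) :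
    IsMeroAt (fun z => f (z + v)) p := by
  obtain ⟨g, h, ag, ah, n, e⟩ := m
  have A : AnalyticAt ℂ (fun z : X => z + v) p := analyticAt_id.add analyticAt_const
  have T : map (fun z : X => z + v) (𝓝 p) = 𝓝 (p + v) := (Homeomorph.addRight v).map_nhds_eq p
  rw [← T] at n e
  exact ⟨fun z => g (z + v), fun z => h (z + v), AnalyticAt.comp (f := fun z => z + v) ag A,
    AnalyticAt.comp (f := fun z => z + v) ah A, frequently_map.1 n,
    eventually_map.1 e⟩

variable (X)

/-- The `ℂ`-valued functions on `X` that represent a meromorphic function on `X`. -/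
def meroRep : Subalgebra ℂ (X → ℂ) where
  carrier := {f | ∀ p, IsMeroAt f p}
  mul_mem' ha hb p := (ha p).mul (hb p)
  add_mem' ha hb p := (ha p).add (hb p)
  algebraMap_mem' _ _ := AnalyticAt.isMeroAt analyticAt_const

/-- The representatives of the zero function: those vanishing on a dense open set. -/
def meroNull : Ideal (meroRep X) where
  carrier := {f | Dense (interior {z | (f : X → ℂ) z = 0})}
  zero_mem' := by simp
  add_mem' {a b} ha hb := by
    refine (Dense.inter_of_isOpen_left ha hb isOpen_interior).mono ?_
    rw [← interior_inter]
    refine interior_mono fun z hz => ?_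
    have h1 : (a : X → ℂ) z = 0 := hz.1
    have h2 : (b : X → ℂ) z = 0 := hz.2
    simp [h1, h2]
  smul_mem' c {a} ha := by
    refine Dense.mono (interior_mono fun z hz => ?_) ha
    have h1 : (a : X → ℂ) z = 0 := hz
    simp [h1]

/-- The `ℂ`-algebra of meromorphic functions on `X`: two representatives give the same meromorphic
function when they agree on a dense open set. -/
abbrev MeroFun : Type _ := meroRep X ⧸ meroNull X

variable {X}

/-- The meromorphic function represented by `f`. -/
def toMero (f : X → ℂ) (hf : ∀ p, IsMeroAt f p) : MeroFun X :=
  Ideal.Quotient.mk (meroNull X) ⟨f, hf⟩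

/-- Translation of representatives, `f ↦ f (· + v)`. -/
def meroRepShift (v : X) : meroRep X →ₐ[ℂ] meroRep X where
  toFun f := ⟨fun z => (f : X → ℂ) (z + v), fun p => (f.2 (p + v)).comp_add⟩
  map_one' := rfl
  map_mul' _ _ := rfl
  map_zero' := rfl
  map_add' _ _ := rfl
  commutes' _ := rfl

theorem meroNull_le_comap (v : X) : meroNull X ≤ (meroNull X).comap (meroRepShift v) := by
  intro f hf
  have hf' : Dense (interior {z | (f : X → ℂ) z = 0}) := hf
  change Dense (interior ((Homeomorph.addRight v) ⁻¹' {z | (f : X → ℂ) z = 0}))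
  rw [← Homeomorph.preimage_interior]
  exact hf'.preimage (Homeomorph.addRight v).isOpenMap

/-- Translation of meromorphic functions, `F ↦ F (· + v)`. -/
def meroShift (v : X) : MeroFun X →ₐ[ℂ] MeroFun X :=
  Ideal.quotientMapₐ (meroNull X) (meroRepShift v) (meroNull_le_comap v)

theorem meroShift_toMero (v : X) (f : X → ℂ) (hf : ∀ p, IsMeroAt f p) :
    meroShift v (toMero f hf) = toMero (fun z => f (z + v)) (fun p => (hf (p + v)).comp_add) :=
  rfl

end Meromorphic

/-! ### The Gelfand-Zetlin operators -/

namespace GelfandZetlin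

noncomputable section

/-- Indices of the variables `γ_{n,j}` with `1 ≤ n ≤ N - 1`, `1 ≤ j ≤ n`: the level `n : Fin N` is the
level of the usual notation (level `0` is empty), and `j` is counted from zero. -/
abbrev Var (N : ℕ) : Type := Σ n : Fin N, Fin n.1

/-- The space `M` of meromorphic functions in the variables `γ_1, …, γ_{N-1}`. -/
abbrev M (N : ℕ) : Type := MeroFun (Var N → ℂ)

variable {N : ℕ}

/-- The entry `γ_{n,j}` of the triangular array, `n ≤ N`: a variable for `n < N`, and the `j`-th
entry of the label for `n = N`. -/
def gam (label : Fin N → ℂ) {n : ℕ} (hn : n ≤ N) (j : Fin n) (z : Var N → ℂ) : ℂ :=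
  if h : n < N then z ⟨⟨n, h⟩, j⟩ else label (Fin.castLE hn j)

theorem analyticAt_gam (label : Fin N → ℂ) {n : ℕ} (hn : n ≤ N) (j : Fin n) (p : Var N → ℂ) :
    AnalyticAt ℂ (gam label hn j) p := by
  unfold gam
  split_ifs with h
  · exact (ContinuousLinearMap.proj (R := ℂ) (φ := fun _ : Var N => ℂ) ⟨⟨n, h⟩, j⟩).analyticAt p
  · exact analyticAt_const

/-- `∏_{s ≠ j} (γ_{n,j} - γ_{n,s})`. -/
def den (label : Fin N → ℂ) {n : ℕ} (hn : n ≤ N) (j : Fin n) (z : Var N → ℂ) : ℂ :=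
  ∏ s ∈ Finset.univ.erase j, (gam label hn j z - gam label hn s z)

/-- The coefficient of `exp (-i ħ ∂)` in `E_{n,n+1}`, without the factor `-1/(i ħ)`. -/
def upCoeff (label : Fin N → ℂ) (hbar : ℂ) {n : ℕ} (hn : n < N) (j : Fin n)
    (z : Var N → ℂ) : ℂ :=
  (∏ r : Fin (n + 1),
      (gam label hn.le j z - gam label (Nat.succ_le_of_lt hn) r z - Complex.I * hbar / 2)) /
    den label hn.le j z

/-- The coefficient of `exp (i ħ ∂)` in `E_{n+1,n}`, without the factor `1/(i ħ)`. -/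
def downCoeff (label : Fin N → ℂ) (hbar : ℂ) {n : ℕ} (hn : n < N) (j : Fin n)
    (z : Var N → ℂ) : ℂ :=
  (∏ r : Fin (n - 1),
      (gam label hn.le j z - gam label ((Nat.sub_le n 1).trans hn.le) r z +
        Complex.I * hbar / 2)) /
    den label hn.le j z

theorem frequently_gam_sub_ne_zero (label : Fin N → ℂ) {n : ℕ} (hn : n < N) {j s : Fin n}
    (hjs : s ≠ j) (p : Var N → ℂ) :
    ∃ᶠ z in 𝓝 p, gam label hn.le j z - gam label hn.le s z ≠ 0 := by
  intro H
  have T : Tendsto (fun t : ℂ => p + Pi.single (⟨⟨n, hn⟩, j⟩ : Var N) t) (𝓝 0) (𝓝 p) := by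
    have c : Continuous (fun t : ℂ => p + Pi.single (⟨⟨n, hn⟩, j⟩ : Var N) t) :=
      continuous_const.add (continuous_const.update _ continuous_id)
    simpa using c.tendsto 0
  have hne : (⟨⟨n, hn⟩, s⟩ : Var N) ≠ ⟨⟨n, hn⟩, j⟩ := by
    intro h
    simp only [Sigma.mk.injEq, heq_eq_eq, true_and] at h
    exact hjs h
  have K : ∀ᶠ t : ℂ in 𝓝 0, p ⟨⟨n, hn⟩, j⟩ + t - p ⟨⟨n, hn⟩, s⟩ = 0 := by
    filter_upwards [T.eventually H] with t ht
    simpa [gam, hn, Pi.single_eq_of_ne hne] using ht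
  have h0 := K.self_of_nhds
  obtain ⟨t, ht, ht0⟩ :=
    ((K.filter_mono nhdsWithin_le_nhds).and (self_mem_nhdsWithin (a := (0 : ℂ)) (s := {0}ᶜ))).exists
  apply ht0
  change t = 0
  linear_combination ht - h0

theorem isMeroAt_div_den (label : Fin N → ℂ) {n : ℕ} (hn : n < N) (j : Fin n)
    {g : (Var N → ℂ) → ℂ} (hg : ∀ p, AnalyticAt ℂ g p) (p : Var N → ℂ) :
    IsMeroAt (fun z => g z / den label hn.le j z) p := by
  have hd : (fun z => (den label hn.le j z)⁻¹) ∈ meroRep (Var N → ℂ) := by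
    have e : (fun z => (den label hn.le j z)⁻¹) =
        ∏ s ∈ Finset.univ.erase j, fun z => (gam label hn.le j z - gam label hn.le s z)⁻¹ := by
      funext z
      simp [den, Finset.prod_apply]
    rw [e]
    refine Subalgebra.prod_mem _ fun s hs q => ?_
    exact AnalyticAt.isMeroAt_inv ((analyticAt_gam label hn.le j q).sub
      (analyticAt_gam label hn.le s q))
      (frequently_gam_sub_ne_zero label hn (Finset.ne_of_mem_erase hs) q)
  have e : (fun z => g z / den label hn.le j z) = g * fun z => (den label hn.le j z)⁻¹ := by
    funext z
    simp [div_eq_mul_inv]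
  rw [e]
  exact (hg p).isMeroAt.mul (hd p)

theorem isMeroAt_upCoeff (label : Fin N → ℂ) (hbar : ℂ) {n : ℕ} (hn : n < N) (j : Fin n)
    (p : Var N → ℂ) : IsMeroAt (upCoeff label hbar hn j) p :=
  isMeroAt_div_den label hn j (fun q => Finset.analyticAt_fun_prod _ fun r _ =>
    ((analyticAt_gam label _ j q).sub (analyticAt_gam label _ r q)).sub analyticAt_const) p

theorem isMeroAt_downCoeff (label : Fin N → ℂ) (hbar : ℂ) {n : ℕ} (hn : n < N) (j : Fin n)
    (p : Var N → ℂ) : IsMeroAt (downCoeff label hbar hn j) p :=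
  isMeroAt_div_den label hn j (fun q => Finset.analyticAt_fun_prod _ fun r _ =>
    ((analyticAt_gam label _ j q).sub (analyticAt_gam label _ r q)).add analyticAt_const) p

/-- `γ_{n,j}` as an element of `M`. -/
def gamM (label : Fin N → ℂ) {n : ℕ} (hn : n ≤ N) (j : Fin n) : M N :=
  toMero (gam label hn j) fun p => (analyticAt_gam label hn j p).isMeroAt

/-- The operator `exp (c ∂ / ∂ γ_{n,j})`, i.e. the shift `γ_{n,j} ↦ γ_{n,j} + c`, for `n < N`. -/
def shift {n : ℕ} (hn : n < N) (j : Fin n) (c : ℂ) : M N →ₗ[ℂ] M N :=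
  (meroShift (Pi.single (⟨⟨n, hn⟩, j⟩ : Var N) c)).toLinearMap

/-- Multiplication by a meromorphic function. -/
def mulOp (F : M N) : M N →ₗ[ℂ] M N := LinearMap.mulLeft ℂ F

/-- `E_{nn} = (1/(i ħ)) (∑_{j ≤ n} γ_{n,j} - ∑_{j ≤ n-1} γ_{n-1,j})`, for `1 ≤ n ≤ N`. -/
def opDiag (label : Fin N → ℂ) (hbar : ℂ) {n : ℕ} (hn : n ≤ N) : Module.End ℂ (M N) :=
  (1 / (Complex.I * hbar)) •
    mulOp (∑ j : Fin n, gamM label hn j -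
      ∑ j : Fin (n - 1), gamM label ((Nat.sub_le n 1).trans hn) j)

/-- `E_{n,n+1}`, for `1 ≤ n < N`. -/
def opUp (label : Fin N → ℂ) (hbar : ℂ) {n : ℕ} (hn : n < N) : Module.End ℂ (M N) :=
  (-(1 / (Complex.I * hbar))) •
    ∑ j : Fin n, mulOp (toMero (upCoeff label hbar hn j) (isMeroAt_upCoeff label hbar hn j)) ∘ₗ
      shift hn j (-(Complex.I * hbar))

/-- `E_{n+1,n}`, for `1 ≤ n < N`. -/
def opDown (label : Fin N → ℂ) (hbar : ℂ) {n : ℕ} (hn : n < N) : Module.End ℂ (M N) :=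
  (1 / (Complex.I * hbar)) •
    ∑ j : Fin n, mulOp (toMero (downCoeff label hbar hn j) (isMeroAt_downCoeff label hbar hn j)) ∘ₗ
      shift hn j (Complex.I * hbar)

/-- The Lie algebra `𝔤𝔩(N)` over `ℂ`, with the commutator bracket. -/
abbrev gl (N : ℕ) : Type := Matrix (Fin N) (Fin N) ℂ

/-- The matrix unit `E_{jk}` of `𝔤𝔩(N)` (indices counted from zero). -/
abbrev E (j k : Fin N) : gl N := Matrix.single j k 1

/-- `ρ` is a representation of `𝔤𝔩(N)` in `M` in which the Cartan and simple root generators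
`E_{nn}`, `E_{n,n+1}`, `E_{n+1,n}` act by the Gelfand-Zetlin operators. The row and column `n` of the
usual notation have the index `n - 1`. -/
structure IsGZRep (label : Fin N → ℂ) (hbar : ℂ) (ρ : gl N →ₗ⁅ℂ⁆ Module.End ℂ (M N)) : Prop where
  diag : ∀ (m : ℕ) (hm : m + 1 ≤ N), ρ (E ⟨m, hm⟩ ⟨m, hm⟩) = opDiag label hbar hm
  up : ∀ (m : ℕ) (hm : m + 1 < N),
    ρ (E ⟨m, Nat.lt_of_succ_lt hm⟩ ⟨m + 1, hm⟩) = opUp label hbar hm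
  down : ∀ (m : ℕ) (hm : m + 1 < N),
    ρ (E ⟨m + 1, hm⟩ ⟨m, Nat.lt_of_succ_lt hm⟩) = opDown label hbar hm

/-- The element of `𝒰(𝔤𝔩(n)) ⊆ 𝒰(𝔤𝔩(N))`, for `n ≤ N`, given by
`𝒜_n(t) = ∑_p sign p [(t - i ħ ρ_1) δ_{p(1),1} - i ħ E_{p(1),1}] ⋯
  [(t - i ħ ρ_n) δ_{p(n),n} - i ħ E_{p(n),n}]`, where `ρ_k = (n - 2 k + 1) / 2`. The factors are
multiplied in this order; below `k` is counted from zero. -/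
def casimirGen (hbar : ℂ) {n : ℕ} (hn : n ≤ N) (t : ℂ) : UniversalEnvelopingAlgebra ℂ (gl N) :=
  ∑ p : Equiv.Perm (Fin n), (Equiv.Perm.sign p : ℤ) •
    (List.ofFn fun k : Fin n =>
      algebraMap ℂ (UniversalEnvelopingAlgebra ℂ (gl N))
          (if p k = k then
            t - Complex.I * hbar * (((n : ℂ) - 2 * ((k : ℕ) + 1 : ℂ) + 1) / 2)
          else 0) -
        (Complex.I * hbar) • UniversalEnvelopingAlgebra.ι ℂ
          (E (Fin.castLE hn (p k)) (Fin.castLE hn k))).prod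

end

end GelfandZetlin

/-! There are two things to prove: the given operators generate a representation of `𝔤𝔩(N)`, and the
column determinant acts in it by the stated product. Both are proved over a commutative `ℂ`-algebra
with commuting shifts (`ShiftArray`). It need not be a field, so the inverses of products of
differences are explicit elements and each division is an argument with unique inverses.

The representation (`ShiftArray.exists_isGl`) grows by one row and one column at a time. Under the
matrix units already constructed, the next raising operator is a lowest weight vector of the vector
representation, so its brackets form the new column. The next lowering operator gives the new row,
by the same argument for the dual family. What remains are relations between simple root operators.
The Serre relations follow from an antisymmetry of the products of inverse differences. The bracket
of a raising and a lowering operator of the same level is a sum of residues of a rational function.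

For the determinant, let `γ` be an entry of level `n` and `T` its inverse shift. Then `T` is again a
lowest weight vector of the vector representation, now of `𝔤𝔩(n)`, and generates a vector operator
`φ` with last component `T`. The characteristic identity `iħ ∑ k, E a k * φ k = (γ + iħ (n - 1) / 2)
* φ a` is proved by induction on `n` (`ShiftArray.IsGen.sum_mul_eq`). Since `ρ_n = -(n - 1) / 2`, it
says that the last factor of the column determinant at `λ = γ` kills `φ`. The determinant is
alternating in its columns, hence `𝒜_n(γ) T = 0` (`colDet_mul_eq_zero`), and `𝒜_n(γ) = 0` because
`T` is invertible. For fixed `F`, the polynomial `𝒜_n(λ) F` has degree at most `n`, has `F` as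
coefficient of `λ ^ n`, and vanishes at the `n` entries of level `n`, whose differences are not zero
divisors. So it is `∏ (λ - γ_{nj}) F` (`ShiftArray.IsGen.colDet_apply`).

The entries of level `N` are constants: they cannot be shifted and may coincide. They are therefore
replaced by polynomial variables, for which the argument works, and the result is specialised
(`ShiftArray.IsGen.colDet_apply_last`). -/

/-! ### Families satisfying the commutation relations of the matrix units -/

section MatrixUnits

variable {L : Type*} [LieRing L]

/-- The elements `E a b`, `a, b < n`, satisfy the commutation relations of the matrix units of
`𝔤𝔩(n)`. -/
def IsGl (n : ℕ) (E : ℕ → ℕ → L) : Prop :=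
  ∀ ⦃a b c d : ℕ⦄, a < n → b < n → c < n → d < n →
    ⁅E a b, E c d⁆ = (if b = c then E a d else 0) - (if a = d then E c b else 0)

variable {n m : ℕ} {E : ℕ → ℕ → L}

theorem IsGl.mono (h : IsGl n E) (hm : m ≤ n) : IsGl m E := fun a b c d ha hb hc hd =>
  h (by omega) (by omega) (by omega) (by omega)

/-- Minus the transpose is the passage to the dual representation. It turns results on new columns
into results on new rows. -/
theorem IsGl.dual (h : IsGl n E) : IsGl n (fun a b => -E b a) := by
  intro a b c d ha hb hc hd
  simp only [neg_lie, lie_neg, neg_neg]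
  rw [h hb ha hd hc]
  split_ifs <;> first | omega | abel

theorem IsGl.bracket_same (h : IsGl n E) {a b d : ℕ} (ha : a < n) (hb : b < n) (hd : d < n)
    (had : a ≠ d) : ⁅E a b, E b d⁆ = E a d := by
  rw [h ha hb hb hd]; simp [had]

theorem IsGl.bracket_zero (h : IsGl n E) {a b c d : ℕ} (ha : a < n) (hb : b < n) (hc : c < n)
    (hd : d < n) (hbc : b ≠ c) (had : a ≠ d) : ⁅E a b, E c d⁆ = 0 := by
  rw [h ha hb hc hd]; simp [had, hbc]

/-- A property which is stable under brackets holds for all `E a b` if it holds for the Cartan and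
simple root generators. -/
theorem IsGl.induction (h : IsGl n E) {P : L → Prop} (hP : ∀ x y, P x → P y → P ⁅x, y⁆)
    (hd : ∀ a, a < n → P (E a a)) (hu : ∀ a, a + 1 < n → P (E a (a + 1)))
    (hl : ∀ a, a + 1 < n → P (E (a + 1) a)) {a b : ℕ} (ha : a < n) (hb : b < n) : P (E a b) := by
  have up : ∀ k a, a + k + 1 < n → P (E a (a + k + 1)) := by
    intro k
    induction k with
    | zero => exact fun a ha => hu a ha
    | succ k ih =>
      intro a ha
      rw [← h.bracket_same (b := a + k + 1) (by omega) (by omega) ha (by omega)]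
      exact hP _ _ (ih a (by omega)) (hu _ ha)
  have lo : ∀ k a, a + k + 1 < n → P (E (a + k + 1) a) := by
    intro k
    induction k with
    | zero => exact fun a ha => hl a ha
    | succ k ih =>
      intro a ha
      rw [← h.bracket_same (b := a + k + 1) ha (by omega) (by omega) (by omega)]
      exact hP _ _ (hl _ ha) (ih a (by omega))
  rcases lt_trichotomy a b with hab | rfl | hab
  · obtain ⟨k, rfl⟩ := Nat.exists_eq_add_of_lt hab
    exact up k a hb
  · exact hd a ha
  · obtain ⟨k, rfl⟩ := Nat.exists_eq_add_of_lt hab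
    exact lo k b ha

/-- `φ` transforms under the `E a b`, `a, b ≤ m`, as the standard basis of the vector
representation. -/
def IsVec (m : ℕ) (E : ℕ → ℕ → L) (φ : ℕ → L) : Prop :=
  ∀ ⦃a b c : ℕ⦄, a ≤ m → b ≤ m → c ≤ m → ⁅E a b, φ c⁆ = if b = c then φ a else 0

/-- The hypotheses say that `φ₀` is a lowest weight vector with the weight of the last basis vector.
The Serre-type condition `hs` cuts the module that it generates down to the vector representation.
The other components are the brackets `⁅E c m, φ₀⁆`. -/
theorem IsGl.exists_isVec [LieAlgebra ℂ L] (h : IsGl (m + 1) E) {φ₀ : L}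
    (hd : ∀ k, k < m → ⁅E k k, φ₀⁆ = 0) (hu : ∀ k, k + 1 < m → ⁅E k (k + 1), φ₀⁆ = 0)
    (hl : ∀ k, k + 1 ≤ m → ⁅E (k + 1) k, φ₀⁆ = 0) (hm : ⁅E m m, φ₀⁆ = φ₀)
    (hs : ∀ k, k + 1 = m → ⁅E k m, ⁅E k m, φ₀⁆⁆ = 0) :
    ∃ φ : ℕ → L, φ m = φ₀ ∧ IsVec m E φ := by
  have low : ∀ a b, a < m → b < m → ⁅E a b, φ₀⁆ = 0 := fun a b ha hb =>
    (h.mono (Nat.le_succ m)).induction (P := fun x => ⁅x, φ₀⁆ = 0)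
      (fun x y hx hy => by rw [lie_lie, hx, hy]; simp) hd hu (fun k hk => hl k hk.le) ha hb
  have bot : ∀ b, b < m → ⁅E m b, φ₀⁆ = 0 := by
    intro b hb
    obtain ⟨k, rfl⟩ : ∃ k, m = k + 1 := ⟨m - 1, by omega⟩
    rcases eq_or_ne b k with rfl | hbk
    · exact hl _ le_rfl
    · rw [← h.bracket_same (b := k) (by omega) (by omega) (by omega) (by omega), lie_lie,
        low _ _ (by omega) hb, hl k le_rfl]
      simp
  have sym : ∀ a b, a < m → b < m → ⁅E a m, ⁅E b m, φ₀⁆⁆ = ⁅E b m, ⁅E a m, φ₀⁆⁆ := by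
    intro a b ha hb
    rw [leibniz_lie, h.bracket_zero (by omega) (by omega) (by omega) (by omega) (by omega)
      (by omega)]
    simp
  -- With `k = m - 1`, bracketing `hs` with `E a k` gives twice `⁅E a m, ⁅E k m, φ₀⁆⁆`, so this
  -- vanishes. A second bracket, with `E b k`, turns the remaining index `k` into `b`.
  have top : ∀ a b, a < m → b < m → ⁅E a m, ⁅E b m, φ₀⁆⁆ = 0 := by
    intro a b ha hb
    obtain ⟨k, rfl⟩ : ∃ k, m = k + 1 := ⟨m - 1, by omega⟩
    have s := hs k rfl
    have one : ∀ a, a < k + 1 → ⁅E a (k + 1), ⁅E k (k + 1), φ₀⁆⁆ = 0 := by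
      intro a ha
      rcases eq_or_ne a k with rfl | hak
      · exact s
      · have t : ⁅E a k, ⁅E k (k + 1), ⁅E k (k + 1), φ₀⁆⁆⁆ = 0 := by rw [s, lie_zero]
        rw [leibniz_lie, leibniz_lie (E a k) (E k (k + 1)) φ₀, low a k ha (by omega), lie_zero,
          add_zero, h.bracket_same (by omega) (by omega) (by omega) (by omega),
          sym k a (by omega) ha, ← two_smul ℂ] at t
        exact (smul_eq_zero.1 t).resolve_left two_ne_zero
    rcases eq_or_ne a k with rfl | hak
    · rw [sym a b ha hb]
      exact one b hb
    · rcases eq_or_ne b k with rfl | hbk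
      · exact one a ha
      have t : ⁅E b k, ⁅E a (k + 1), ⁅E k (k + 1), φ₀⁆⁆⁆ = 0 := by rw [one a ha, lie_zero]
      rw [leibniz_lie, h.bracket_zero (by omega) (by omega) (by omega) (by omega) (by omega)
        (by omega), zero_lie, zero_add, leibniz_lie (E b k), low b k hb (by omega), lie_zero,
        add_zero, h.bracket_same (by omega) (by omega) (by omega) (by omega)] at t
      exact t
  refine ⟨fun c => if c = m then φ₀ else ⁅E c m, φ₀⁆, by simp, ?_⟩
  intro a b c ha hb hc
  dsimp only
  rcases eq_or_ne c m with rfl | hcm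
  · rw [if_pos rfl]
    rcases eq_or_ne b c with rfl | hbc
    · rw [if_pos rfl]
      split_ifs with hab
      · rw [hab, hm]
      · rfl
    · rw [if_neg hbc]
      rcases eq_or_ne a c with rfl | hac
      · exact bot b (by omega)
      · exact low a b (by omega) (by omega)
  · rw [if_neg hcm]
    rcases eq_or_ne b m with rfl | hbm
    · rw [if_neg (Ne.symm hcm)]
      rcases eq_or_ne a b with rfl | hab
      · rw [leibniz_lie, hm, h (by omega) (by omega) (by omega) (by omega), if_neg (Ne.symm hcm),
          if_pos rfl, zero_sub, neg_lie, neg_add_cancel]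
      · exact top a c (by omega) (by omega)
    · rw [leibniz_lie]
      have z : ⁅E a b, φ₀⁆ = 0 := by
        rcases eq_or_ne a m with rfl | ham
        · exact bot b (by omega)
        · exact low a b (by omega) (by omega)
      rw [z, lie_zero, add_zero, h (by omega) (by omega) (by omega) (by omega), sub_lie]
      rcases eq_or_ne a m with rfl | ham
      · rw [if_pos rfl, if_pos rfl]
        split_ifs with hbc
        · rw [hm, low c b (by omega) (by omega), sub_zero]
        · rw [low c b (by omega) (by omega), zero_lie, sub_zero]
      · rw [if_neg ham, if_neg ham]
        split_ifs <;> simp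

/-- The components of a vector operator commute as soon as the last two do. -/
theorem IsVec.commute {φ : ℕ → L} (hφ : IsVec m E φ)
    (hm : ∀ k, k + 1 = m → ⁅φ k, φ m⁆ = 0) {a b : ℕ} (ha : a ≤ m) (hb : b ≤ m) :
    ⁅φ a, φ b⁆ = 0 := by
  have last : ∀ a, a ≤ m → ⁅φ a, φ m⁆ = 0 := by
    intro a ha
    rcases eq_or_ne a m with rfl | ham
    · exact lie_self _
    obtain ⟨k, rfl⟩ : ∃ k, m = k + 1 := ⟨m - 1, by omega⟩
    rcases eq_or_ne a k with rfl | hak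
    · exact hm _ rfl
    have t : ⁅E a k, ⁅φ k, φ (k + 1)⁆⁆ = 0 := by rw [hm k rfl, lie_zero]
    rw [leibniz_lie, hφ ha (by omega) (by omega), hφ ha (by omega) (by omega), if_pos rfl,
      if_neg (by omega), lie_zero, add_zero] at t
    exact t
  rcases eq_or_ne a m with rfl | ham
  · rw [← lie_skew, last b hb, neg_zero]
  have t : ⁅E b m, ⁅φ a, φ m⁆⁆ = 0 := by rw [last a ha, lie_zero]
  rw [leibniz_lie, hφ hb le_rfl ha, hφ hb le_rfl le_rfl, if_pos rfl, if_neg (Ne.symm ham),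
    zero_lie, zero_add] at t
  exact t

/-- The family on indices `≤ m + 1` obtained from a family on indices `≤ m` by adding a last column
`v`, a last row `w` and a last diagonal entry `h`. -/
def borderGl (m : ℕ) (E : ℕ → ℕ → L) (v w : ℕ → L) (h : L) (a b : ℕ) : L :=
  if a ≤ m then (if b ≤ m then E a b else v a) else (if b ≤ m then w b else h)

/-- Each missing relation is obtained from one of the listed ones, which concern generators or last
components, by bracketing with the old matrix units: `v` and `w` are a vector and a covector under
them, and `h` commutes with them. -/
theorem IsGl.border (hE : IsGl (m + 1) E) {v w : ℕ → L} {h : L} (hv : IsVec m E v)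
    (hw : IsVec m (fun a b => -E b a) w) (hd : ∀ k, k ≤ m → ⁅h, E k k⁆ = 0)
    (hu : ∀ k, k < m → ⁅h, E k (k + 1)⁆ = 0) (hl : ∀ k, k < m → ⁅h, E (k + 1) k⁆ = 0)
    (hhv : ⁅h, v m⁆ = -v m) (hhw : ⁅h, w m⁆ = w m)
    (hvv : ∀ k, k + 1 = m → ⁅v k, v m⁆ = 0) (hww : ∀ k, k + 1 = m → ⁅w k, w m⁆ = 0)
    (hvw : ⁅v m, w m⁆ = E m m - h) : IsGl (m + 2) (borderGl m E v w h) := by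
  have hh : ∀ a b, a ≤ m → b ≤ m → ⁅h, E a b⁆ = 0 := fun a b ha hb =>
    hE.induction (P := fun x => ⁅h, x⁆ = 0)
      (fun x y hx hy => by rw [leibniz_lie, hx, hy]; simp) (fun k hk => hd k (by omega))
      (fun k hk => hu k (by omega)) (fun k hk => hl k (by omega)) (by omega) (by omega)
  have hw' : ∀ {a b c}, a ≤ m → b ≤ m → c ≤ m → ⁅E a b, w c⁆ = if a = c then -w b else 0 := by
    intro a b c ha hb hc
    have t := hw hb ha hc
    simp only [neg_lie] at t
    rw [← neg_neg ⁅E a b, w c⁆, t]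
    split_ifs <;> simp
  have hh' : ∀ a b, a ≤ m → b ≤ m → ⁅E a b, h⁆ = 0 := fun a b ha hb => by
    rw [← lie_skew, hh a b ha hb, neg_zero]
  have kv : ∀ a, a ≤ m → ⁅h, v a⁆ = -v a := by
    intro a ha
    have e : v a = ⁅E a m, v m⁆ := by rw [hv ha le_rfl le_rfl, if_pos rfl]
    rw [e, leibniz_lie, hh a m ha le_rfl, hhv]
    simp
  have kw : ∀ a, a ≤ m → ⁅h, w a⁆ = w a := by
    intro a ha
    have e : w a = -⁅E m a, w m⁆ := by rw [hw' le_rfl ha le_rfl, if_pos rfl, neg_neg]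
    rw [e, lie_neg, leibniz_lie, hh m a le_rfl ha, hhw]
    simp
  have hvw₁ : ∀ a, a ≤ m → ⁅v a, w m⁆ = E a m - if a = m then h else 0 := by
    intro a ha
    rcases eq_or_ne a m with rfl | ham
    · simpa using hvw
    · have t : ⁅E a m, ⁅v m, w m⁆⁆ = ⁅E a m, E m m - h⁆ := by rw [hvw]
      rw [leibniz_lie, hv ha le_rfl le_rfl, hw' ha le_rfl le_rfl, lie_sub,
        hE (by omega) (by omega) (by omega) (by omega), hh' a m ha le_rfl] at t
      simpa [ham] using t
  have hvw₂ : ∀ a b, a ≤ m → b ≤ m → ⁅v a, w b⁆ = E a b - if a = b then h else 0 := by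
    intro a b ha hb
    rcases eq_or_ne b m with rfl | hbm
    · exact hvw₁ a ha
    · have t : ⁅E m b, ⁅v a, w m⁆⁆ = ⁅E m b, E a m - if a = m then h else 0⁆ := by rw [hvw₁ a ha]
      have z : ⁅E m b, if a = m then h else 0⁆ = 0 := by
        split_ifs
        · exact hh' m b le_rfl hb
        · simp
      rw [leibniz_lie, hv le_rfl hb ha, hw' le_rfl hb le_rfl, lie_sub, z,
        hE (by omega) (by omega) (by omega) (by omega)] at t
      rcases eq_or_ne a b with rfl | hab
      · simp only [↓reduceIte, lie_neg, sub_zero] at t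
        rw [hvw] at t
        simp only [↓reduceIte]
        have t' := congrArg Neg.neg t
        rw [neg_add, neg_neg, neg_sub, neg_sub] at t'
        rw [← sub_eq_zero] at t' ⊢
        rw [← t']
        abel
      · rw [if_neg (Ne.symm hab), if_pos rfl, if_pos rfl, if_neg (Ne.symm hab)] at t
        rw [if_neg hab]
        simp only [zero_lie, lie_neg, zero_add, zero_sub, sub_zero, neg_inj] at t ⊢
        exact t
  have hvv' : ∀ {a b}, a ≤ m → b ≤ m → ⁅v a, v b⁆ = 0 := fun ha hb => hv.commute hvv ha hb
  have hww' : ∀ {a b}, a ≤ m → b ≤ m → ⁅w a, w b⁆ = 0 := fun ha hb => hw.commute hww ha hb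
  intro a b c d ha hb hc hd
  have vE : ∀ {a b c}, a ≤ m → b ≤ m → c ≤ m → ⁅v c, E a b⁆ = if b = c then -v a else 0 := by
    intro a b c ha hb hc
    rw [← lie_skew, hv ha hb hc]
    split_ifs <;> simp
  have wE : ∀ {a b c}, a ≤ m → b ≤ m → c ≤ m → ⁅w c, E a b⁆ = if a = c then w b else 0 := by
    intro a b c ha hb hc
    rw [← lie_skew, hw' ha hb hc]
    split_ifs <;> simp
  have wv : ∀ {a b}, a ≤ m → b ≤ m → ⁅w b, v a⁆ = (if a = b then h else 0) - E a b := by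
    intro a b ha hb
    rw [← lie_skew, hvw₂ a b ha hb, neg_sub]
  have vh : ∀ {a}, a ≤ m → ⁅v a, h⁆ = v a := by
    intro a ha
    rw [← lie_skew, kv a ha, neg_neg]
  have wh : ∀ {a}, a ≤ m → ⁅w a, h⁆ = -w a := by
    intro a ha
    rw [← lie_skew, kw a ha]
  have cases : ∀ x, x < m + 2 → x ≤ m ∨ x = m + 1 := fun x hx => by omega
  have ne : ∀ x, x ≤ m → x ≠ m + 1 := fun x hx => by omega
  have ne' : ∀ x, x ≤ m → m + 1 ≠ x := fun x hx => by omega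
  have hEE : ∀ {a b c d}, a ≤ m → b ≤ m → c ≤ m → d ≤ m → ⁅E a b, E c d⁆ =
      (if b = c then E a d else 0) - (if a = d then E c b else 0) := fun ha hb hc hd =>
    hE (by omega) (by omega) (by omega) (by omega)
  -- Sixteen cases, according to which of the four indices equal the new index `m + 1`.
  rcases cases a ha with ha | rfl <;> rcases cases b hb with hb | rfl <;>
    rcases cases c hc with hc | rfl <;> rcases cases d hd with hd | rfl <;>
    simp only [borderGl, Nat.not_succ_le_self, if_true, if_false, ha, hb, hc, hd]
  all_goals
    first
    | (rw [hv ha hb hc]; split_ifs <;> first | omega | simp)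
    | (simp [*]; done)
    | (simp only [*]; split_ifs <;> first | contradiction | omega | rfl | (subst_vars; simp))

end MatrixUnits

/-! ### Interpolation over commutative rings -/

section Interpolation

open Polynomial

variable {K : Type*} [CommRing K] {ι κ : Type*}

/-- A polynomial with at least as many roots as its degree bound is zero, if the differences of the
roots are not zero divisors. -/
theorem Polynomial.eq_zero_of_degree_lt_of_eval_eq_zero {y : ι → K} {s : Finset ι}
    (hy : ∀ i ∈ s, ∀ j ∈ s, i ≠ j → ∀ x, (y i - y j) * x = 0 → x = 0) {p : K[X]}
    (hp : p.degree < s.card) (h0 : ∀ i ∈ s, p.eval (y i) = 0) : p = 0 := by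
  classical
  nontriviality K
  induction s using Finset.induction_on generalizing p with
  | empty => simpa using hp
  | insert i s hi ih =>
    -- After the factor `X - C (y i)` is split off, the quotient vanishes at the other points
    -- because `y j - y i` is not a zero divisor, and its degree bound drops by one.
    obtain ⟨q, rfl⟩ := dvd_iff_isRoot.2 (h0 i (Finset.mem_insert_self i s))
    have hq : q = 0 := by
      refine ih (fun i hi j hj => hy i (Finset.mem_insert_of_mem hi) j
        (Finset.mem_insert_of_mem hj)) ?_ fun j hj => ?_
      · by_contra hlt
        rw [not_lt] at hlt
        rw [(monic_X_sub_C (y i)).degree_mul_comm, (monic_X_sub_C (y i)).degree_mul, degree_X_sub_C,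
          Finset.card_insert_of_notMem hi] at hp
        have : ((s.card + 1 : ℕ) : WithBot ℕ) ≤ q.degree + 1 := by
          push_cast
          gcongr
        exact absurd hp (not_lt.2 this)
      · have h := h0 j (Finset.mem_insert_of_mem hj)
        rw [eval_mul, eval_sub, eval_X, eval_C] at h
        exact hy j (Finset.mem_insert_of_mem hj) i (Finset.mem_insert_self i s)
          (fun e => hi (e ▸ hj)) _ h
    rw [hq, mul_zero]

variable [Fintype ι] [Fintype κ] [DecidableEq ι]

/-- The sum of the residues at infinity and at the points `y i` of a quotient of monic polynomials
of the same degree. -/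
theorem sum_mul_prod_sub_eq {y b : ι → K} {p : κ → K} (hc : Fintype.card κ = Fintype.card ι)
    (hb : ∀ i, b i * ∏ j ∈ Finset.univ.erase i, (y i - y j) = 1) :
    ∑ i, b i * ∏ r, (y i - p r) = ∑ i, y i - ∑ r, p r := by
  nontriviality K
  rcases Nat.eq_zero_or_pos (Fintype.card ι) with h0 | hpos
  · have : IsEmpty ι := Fintype.card_eq_zero_iff.1 h0
    have : IsEmpty κ := Fintype.card_eq_zero_iff.1 (hc.trans h0)
    simp
  have hy : ∀ i j, i ≠ j → ∀ x, (y i - y j) * x = 0 → x = 0 := by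
    intro i j hij x hx
    have h := hb i
    rw [← Finset.mul_prod_erase _ _ (Finset.mem_erase.2 ⟨hij.symm, Finset.mem_univ j⟩)] at h
    linear_combination (b i * ∏ k ∈ (Finset.univ.erase i).erase j, (y i - y k)) * hx - x * h
  -- `l` is the Lagrange interpolation polynomial of `g` at the nodes `y i`. Both have degree less
  -- than the number of nodes, so they agree; the claim compares their coefficients in the largest
  -- degree allowed.
  set g : K[X] := ∏ r, (X - C (p r)) - ∏ i, (X - C (y i)) with hg
  set l : K[X] := ∑ i, C (b i * ∏ r, (y i - p r)) * ∏ j ∈ Finset.univ.erase i, (X - C (y j)) with hl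
  have dg : g.degree < Fintype.card ι := by
    have m₁ : (∏ r, (X - C (p r))).Monic := monic_prod_of_monic _ _ fun r _ => monic_X_sub_C _
    have m₂ : (∏ i, (X - C (y i))).Monic := monic_prod_of_monic _ _ fun r _ => monic_X_sub_C _
    have d₁ : (∏ r, (X - C (p r))).degree = (Fintype.card ι : WithBot ℕ) := by
      rw [degree_eq_natDegree m₁.ne_zero, natDegree_prod_of_monic _ _ fun r _ => monic_X_sub_C _]; simp [hc]
    have d₂ : (∏ i, (X - C (y i))).degree = (Fintype.card ι : WithBot ℕ) := by
      rw [degree_eq_natDegree m₂.ne_zero, natDegree_prod_of_monic _ _ fun r _ => monic_X_sub_C _]; simp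
    have := degree_sub_lt_left (d₁.trans d₂.symm) m₁.ne_zero (m₁.leadingCoeff.trans m₂.leadingCoeff.symm)
    rwa [d₁] at this
  have md : ∀ i, (∏ j ∈ Finset.univ.erase i, (X - C (y j))).Monic := fun i =>
    monic_prod_of_monic _ _ fun r _ => monic_X_sub_C _
  have nd : ∀ i, (∏ j ∈ Finset.univ.erase i, (X - C (y j))).natDegree = Fintype.card ι - 1 := by
    intro i
    rw [natDegree_prod_of_monic _ _ fun r _ => monic_X_sub_C _]; simp
  have dl : l.degree < Fintype.card ι := by
    refine lt_of_le_of_lt (degree_sum_le _ _) ((Finset.sup_lt_iff (WithBot.bot_lt_coe _)).2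
      fun i _ => ?_)
    refine lt_of_le_of_lt (degree_mul_le _ _ |>.trans (add_le_add_left degree_C_le _)) ?_
    rw [zero_add, degree_eq_natDegree (md i).ne_zero, nd]
    exact_mod_cast Nat.sub_lt hpos one_pos
  have key : g - l = 0 := by
    refine eq_zero_of_degree_lt_of_eval_eq_zero (y := y) (s := Finset.univ)
      (fun i _ j _ => hy i j) (lt_of_le_of_lt (degree_sub_le _ _) (max_lt dg dl)) fun i _ => ?_
    have e₁ : g.eval (y i) = ∏ r, (y i - p r) := by
      rw [hg, eval_sub, eval_prod, eval_prod,
        Finset.prod_eq_zero (f := fun j => eval (y i) (X - C (y j))) (Finset.mem_univ i) (by simp)]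
      simp
    have e₂ : l.eval (y i) = b i * (∏ r, (y i - p r)) * ∏ j ∈ Finset.univ.erase i, (y i - y j) := by
      rw [hl, eval_finsetSum, Finset.sum_eq_single i]
      · simp [eval_prod]
      · intro j _ hji
        rw [eval_mul, eval_prod, Finset.prod_eq_zero (i := i) (by simp [hji.symm]) (by simp),
          mul_zero]
      · simp
    rw [eval_sub, e₁, e₂]
    linear_combination (-∏ r, (y i - p r)) * hb i
  have hco := congrArg (fun q => q.coeff (Fintype.card ι - 1)) (sub_eq_zero.1 key)
  have c₁ : (∏ r, (X - C (p r))).coeff (Fintype.card ι - 1) = -∑ r, p r := by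
    have := prod_X_sub_C_coeff_card_pred Finset.univ p (by rw [Finset.card_univ, hc]; exact hpos)
    rwa [Finset.card_univ, hc] at this
  have c₂ : (∏ i, (X - C (y i))).coeff (Fintype.card ι - 1) = -∑ i, y i :=
    prod_X_sub_C_coeff_card_pred Finset.univ y hpos
  have c₃ : ∀ i, (∏ j ∈ Finset.univ.erase i, (X - C (y j))).coeff (Fintype.card ι - 1) = 1 := by
    intro i
    rw [← nd i]
    exact md i
  simp only [hg, hl, coeff_sub, finsetSum_coeff, coeff_C_mul, c₁, c₂, c₃, mul_one] at hco
  rw [← hco]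
  ring

end Interpolation

/-! ### Difference operators in one group of variables -/

section DifferenceOperators

variable {K : Type*} [CommRing K] [Algebra ℂ K]

/-- The operator `F ↦ c * s F`. -/
def shiftTerm (c : K) (s : K ≃ₐ[ℂ] K) : Module.End ℂ K := LinearMap.mulLeft ℂ c ∘ₗ s.toLinearMap

@[simp]
theorem shiftTerm_apply (c : K) (s : K ≃ₐ[ℂ] K) (F : K) : shiftTerm c s F = c * s F := rfl

theorem lie_end_apply (A B : Module.End ℂ K) (F : K) : ⁅A, B⁆ F = A (B F) - B (A F) := rfl

theorem lie_shiftTerm_eq_zero {c c' : K} {s s' : K ≃ₐ[ℂ] K} (h : s c' = c') (h' : s' c = c)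
    (hs : ∀ F, s (s' F) = s' (s F)) : ⁅shiftTerm c s, shiftTerm c' s'⁆ = 0 := by
  ext F
  simp only [lie_end_apply, shiftTerm_apply, map_mul, h, h', hs, LinearMap.zero_apply]
  ring

theorem lie_mulLeft_shiftTerm {g c d : K} {s : K ≃ₐ[ℂ] K} (h : s g = g + d) :
    ⁅LinearMap.mulLeft ℂ g, shiftTerm c s⁆ = LinearMap.mulLeft ℂ (-d) ∘ₗ shiftTerm c s := by
  ext F
  simp only [lie_end_apply, shiftTerm_apply, map_mul, h, LinearMap.mulLeft_apply,
    LinearMap.comp_apply]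
  ring

theorem lie_mulLeft_mulLeft (g g' : K) : ⁅LinearMap.mulLeft ℂ g, LinearMap.mulLeft ℂ g'⁆ = 0 := by
  ext F
  simp only [lie_end_apply, LinearMap.mulLeft_apply, LinearMap.zero_apply]
  ring

variable {ι : Type*} [Fintype ι] [DecidableEq ι]

/-- Commuting shifts `s i` of the variables `y i` by `d`, together with the inverses `a i` of the
products of the differences of the variables. -/
structure ShiftGroup (y a : ι → K) (s : ι → K ≃ₐ[ℂ] K) (d : K) : Prop where
  self : ∀ i, s i (y i) = y i + d
  ne : ∀ i j, i ≠ j → s i (y j) = y j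
  step : ∀ i, s i d = d
  comm : ∀ i j F, s i (s j F) = s j (s i F)
  inv : ∀ i, a i * ∏ j ∈ Finset.univ.erase i, (y i - y j) = 1

namespace ShiftGroup

variable {y a : ι → K} {s : ι → K ≃ₐ[ℂ] K} {d : K}

theorem symm (h : ShiftGroup y a s d) : ShiftGroup y a (fun i => (s i).symm) (-d) where
  self i := by
    rw [AlgEquiv.symm_apply_eq, map_add, map_neg, h.self, h.step]
    ring
  ne i j hij := by rw [AlgEquiv.symm_apply_eq, h.ne i j hij]
  step i := by rw [AlgEquiv.symm_apply_eq, map_neg, h.step]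
  comm i j F := by
    apply (s i).injective
    apply (s j).injective
    rw [h.comm j i ((s j).symm ((s i).symm F))]
    simp only [AlgEquiv.apply_symm_apply]
  inv := h.inv

theorem shift_inv (h : ShiftGroup y a s d) {i j : ι} (hij : i ≠ j) :
    s i (a j) * ((y j - y i - d) * ∏ k ∈ (Finset.univ.erase i).erase j, (y j - y k)) = 1 := by
  have e := congrArg (s i) (h.inv j)
  rw [← Finset.mul_prod_erase (Finset.univ.erase j) _ (Finset.mem_erase.2 ⟨hij, Finset.mem_univ i⟩),
    map_mul, map_mul, map_prod, map_sub, h.self, h.ne i j hij, map_one, Finset.erase_right_comm] at e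
  rw [← e]
  congr 2
  · ring
  · refine Finset.prod_congr rfl fun k hk => ?_
    rw [map_sub, h.ne i j hij, h.ne i k]
    intro hik
    simp [hik] at hk

theorem inv' (h : ShiftGroup y a s d) {i j : ι} (hij : i ≠ j) :
    a i * ((y i - y j) * ∏ k ∈ (Finset.univ.erase i).erase j, (y i - y k)) = 1 := by
  rw [Finset.mul_prod_erase (Finset.univ.erase i) (fun k => y i - y k)
    (Finset.mem_erase.2 ⟨hij.symm, Finset.mem_univ j⟩), h.inv]

/-- The factor `y j - y i - d` cancels the shifted difference in `s i (a j)`, so the first term is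
the inverse of `(y i - y j) * A * B`. Exchanging `i` and `j` exchanges `A` and `B` and changes the
sign. -/
theorem mul_shift_inv_antisymm (h : ShiftGroup y a s d) {i j : ι} (hij : i ≠ j) :
    a i * s i (a j) * (y j - y i - d) + a j * s j (a i) * (y i - y j - d) = 0 := by
  have e₁ := h.inv' hij
  have e₂ := h.shift_inv hij
  have e₃ := h.inv' hij.symm
  have e₄ := h.shift_inv hij.symm
  rw [Finset.erase_right_comm] at e₃ e₄
  set A := ∏ k ∈ (Finset.univ.erase i).erase j, (y i - y k)
  set B := ∏ k ∈ (Finset.univ.erase i).erase j, (y j - y k)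
  have u : (a i * s i (a j) * (y j - y i - d)) * ((y i - y j) * A * B) = 1 := by
    linear_combination (s i (a j) * ((y j - y i - d) * B)) * e₁ + e₂
  have v : (a j * s j (a i) * (y i - y j - d)) * ((y i - y j) * A * B) = -1 := by
    linear_combination -(s j (a i) * ((y i - y j - d) * A)) * e₃ - e₄
  linear_combination (a i * s i (a j) * (y j - y i - d)) * v
    - (a j * s j (a i) * (y i - y j - d)) * u

/-- Both sides are inverse to `(y i - y j) * (y j - y i - d) * A * B`. -/
theorem mul_shift_inv_mixed (h : ShiftGroup y a s d) {i j : ι} (hij : i ≠ j) :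
    a i * s i (a j) = a j * (s j).symm (a i) := by
  have e₁ := h.inv' hij
  have e₂ := h.shift_inv hij
  have e₃ := h.inv' hij.symm
  have e₄ := h.symm.shift_inv hij.symm
  rw [Finset.erase_right_comm] at e₃ e₄
  set A := ∏ k ∈ (Finset.univ.erase i).erase j, (y i - y k)
  set B := ∏ k ∈ (Finset.univ.erase i).erase j, (y j - y k)
  have u : a i * s i (a j) * ((y i - y j) * (y j - y i - d) * A * B) = 1 := by
    linear_combination (s i (a j) * ((y j - y i - d) * B)) * e₁ + e₂
  have v : a j * (s j).symm (a i) * ((y i - y j) * (y j - y i - d) * A * B) = 1 := by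
    linear_combination ((s j).symm (a i) * ((y i - y j - -d) * A)) * e₃ + e₄
  linear_combination -(a i * s i (a j)) * v + (a j * (s j).symm (a i)) * u

/-- Double sums with antisymmetric terms vanish. -/
theorem sum_mul_shift_inv_eq_zero (h : ShiftGroup y a s d) {B : ι → ι → K} (h0 : ∀ i, B i i = 0)
    (hB : ∀ i j, i ≠ j → ∃ c, B i j = (y j - y i - d) * c ∧ B j i = (y i - y j - d) * c) :
    ∑ i, ∑ j, a i * s i (a j) * B i j = 0 := by
  have e : ∑ i, ∑ j, a i * s i (a j) * B i j = -∑ i, ∑ j, a i * s i (a j) * B i j := by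
    conv_rhs => rw [Finset.sum_comm]
    rw [← Finset.sum_neg_distrib]
    refine Finset.sum_congr rfl fun i _ => ?_
    rw [← Finset.sum_neg_distrib]
    refine Finset.sum_congr rfl fun j _ => ?_
    rcases eq_or_ne i j with rfl | hij
    · simp [h0]
    · obtain ⟨c, h₁, h₂⟩ := hB i j hij
      rw [h₁, h₂]
      linear_combination c * h.mul_shift_inv_antisymm hij
  have t : (2 : ℂ) • ∑ i, ∑ j, a i * s i (a j) * B i j = 0 := by
    rw [two_smul]
    nth_rewrite 1 [e]
    simp
  exact (smul_eq_zero.1 t).resolve_left two_ne_zero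

theorem lie_lie_apply (A T : Module.End ℂ K) (F : K) :
    ⁅A, ⁅A, T⁆⁆ F = A (A (T F)) - 2 * A (T (A F)) + T (A (A F)) := by
  simp only [lie_end_apply, map_sub]
  ring

/-- The Serre relation for a term whose shift acts on the coefficients of the sum. -/
theorem serre_of_coeff_shift (h : ShiftGroup y a s d) {p q : ι → K} {α : K} {t : K ≃ₐ[ℂ] K}
    (ts : ∀ i F, t (s i F) = s i (t F)) (ta : ∀ i, t (a i) = a i) (sα : ∀ i, s i α = α)
    (hp : ∀ i j, p i - p j = y i - y j) (sp : ∀ i, s i (p i) = p i + d)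
    (sp' : ∀ i j, i ≠ j → s i (p j) = p j) (tp : ∀ i, t (p i) = p i - d)
    (sq : ∀ i j, i ≠ j → s i (q j) = q j) (tq : ∀ i, t (q i) = q i) :
    ⁅∑ i, shiftTerm (p i * q i * a i) (s i), ⁅∑ i, shiftTerm (p i * q i * a i) (s i),
      shiftTerm α t⁆⁆ = 0 := by
  ext F
  rw [lie_lie_apply, LinearMap.zero_apply]
  simp only [LinearMap.sum_apply, shiftTerm_apply, map_sum, map_mul, ts, ta, sα, tq, Finset.mul_sum,
    ← Finset.sum_sub_distrib, ← Finset.sum_add_distrib]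
  -- The double commutator is `SST - 2 STS + TSS`. For `i ≠ j` the bracket in `B` is `p i * p j - 2
  -- * p i * (p j - d) + (p i - d) * (p j - d)`, which equals `-d * (y j - y i - d)`; for `i = j` it
  -- is zero.
  rw [← h.sum_mul_shift_inv_eq_zero (B := fun i j => α * q i * s i (q j) * (p i * s i (p j) -
    2 * p i * s i (t (p j)) + t (p i) * s i (t (p j))) * s i (s j (t F)))]
  · rw [Finset.sum_comm]
    refine Finset.sum_congr rfl fun i _ => Finset.sum_congr rfl fun j _ => ?_
    ring
  · intro i
    simp only [tp, map_sub, sp, h.step]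
    ring
  · intro i j hij
    refine ⟨-d * α * q i * q j * s i (s j (t F)), ?_, ?_⟩
    · simp only [tp, map_sub, sp' i j hij, sq i j hij, h.step]
      linear_combination α * q i * q j * s i (s j (t F)) * d * hp i j
    · simp only [tp, map_sub, sp' j i hij.symm, sq j i hij.symm, h.step, h.comm j i]
      linear_combination α * q i * q j * s i (s j (t F)) * d * hp j i

/-- The Serre relation for a term whose coefficient is acted on by the shifts of the sum. -/
theorem serre_of_shift_coeff (h : ShiftGroup y a s d) {q : ι → K} {α u : K} {t : K ≃ₐ[ℂ] K}
    (ts : ∀ i F, t (s i F) = s i (t F)) (ta : ∀ i, t (a i) = a i) (sα : ∀ i, s i α = α)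
    (su : ∀ i, s i u = u)
    (sq : ∀ i j, i ≠ j → s i (q j) = q j) (tq : ∀ i, t (q i) = q i) :
    ⁅∑ i, shiftTerm (q i * a i) (s i), ⁅∑ i, shiftTerm (q i * a i) (s i),
      shiftTerm (α * ∏ i, (u - y i)) t⁆⁆ = 0 := by
  ext F
  rw [lie_lie_apply, LinearMap.zero_apply]
  set c := ∏ i, (u - y i) with hc
  have c₁ : ∀ i, c = (u - y i) * ∏ k ∈ Finset.univ.erase i, (u - y k) := fun i =>
    (Finset.mul_prod_erase _ _ (Finset.mem_univ i)).symm
  have c₂ : ∀ i j, i ≠ j → c = (u - y i) * (u - y j) *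
      ∏ k ∈ (Finset.univ.erase i).erase j, (u - y k) := fun i j hij => by
    rw [mul_assoc, Finset.mul_prod_erase (Finset.univ.erase i) (fun k => u - y k)
      (Finset.mem_erase.2 ⟨hij.symm, Finset.mem_univ j⟩)]
    exact c₁ i
  have s₁ : ∀ i, s i (∏ k ∈ Finset.univ.erase i, (u - y k)) =
      ∏ k ∈ Finset.univ.erase i, (u - y k) := fun i => by
    rw [map_prod]
    refine Finset.prod_congr rfl fun k hk => ?_
    rw [map_sub, su, h.ne i k (Finset.ne_of_mem_erase hk).symm]
  have s₂ : ∀ i j l, l = i ∨ l = j → s l (∏ k ∈ (Finset.univ.erase i).erase j, (u - y k)) =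
      ∏ k ∈ (Finset.univ.erase i).erase j, (u - y k) := fun i j l hl => by
    rw [map_prod]
    refine Finset.prod_congr rfl fun k hk => ?_
    rw [map_sub, su, h.ne l k]
    rintro rfl
    simp only [Finset.mem_erase, Finset.mem_univ, and_true] at hk
    tauto
  simp only [LinearMap.sum_apply, shiftTerm_apply, map_sum, map_mul, ts, ta, sα, tq, Finset.mul_sum,
    ← Finset.sum_sub_distrib, ← Finset.sum_add_distrib]
  -- For `i ≠ j` only the factors `u - y i` and `u - y j` of `c` are shifted, and the second
  -- difference is `-d * (y j - y i - d)` times the other factors. For `i = j` it is a second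
  -- difference of a function linear in `y i`, hence zero.
  rw [← h.sum_mul_shift_inv_eq_zero (B := fun i j => α * q i * s i (q j) * (s i (s j c) -
    2 * s i c + c) * s i (s j (t F)))]
  · rw [Finset.sum_comm]
    refine Finset.sum_congr rfl fun i _ => Finset.sum_congr rfl fun j _ => ?_
    ring
  · intro i
    simp only [c₁ i, map_mul, map_sub, s₁, su, h.self, map_add, h.step]
    ring
  · intro i j hij
    refine ⟨-d * α * q i * q j * s i (s j (t F)) * ∏ k ∈ (Finset.univ.erase i).erase j, (u - y k),
      ?_, ?_⟩
    · simp only [c₂ i j hij, map_mul, map_sub, s₂ i j i (Or.inl rfl), s₂ i j j (Or.inr rfl), su,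
        h.self, map_add, h.step, h.ne i j hij, h.ne j i hij.symm, sq i j hij]
      ring
    · simp only [c₂ i j hij, map_mul, map_sub, s₂ i j i (Or.inl rfl), s₂ i j j (Or.inr rfl), su,
        h.self, map_add, h.step, h.ne i j hij, h.ne j i hij.symm, sq j i hij.symm, h.comm j i]
      ring

/-- Terms with distinct indices cancel by `mul_shift_inv_mixed`. The diagonal terms are, up to the
factor `d`, the residues at the points `y i + x` and `y i - x` of the rational function with
numerator roots `u` and `q`. The hypothesis `hc` makes the degrees equal, so `sum_mul_prod_sub_eq`
evaluates the sum. -/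
theorem lie_lower_raise (h : ShiftGroup y a s d) {κ κ' : Type*} [Fintype κ] [Fintype κ']
    {u : κ → K} {q : κ' → K} {x w : K} (hx : d = x + x) (sx : ∀ i, s i x = x) (hw : d * w = 1)
    (hc : Fintype.card κ + Fintype.card κ' = Fintype.card ι + Fintype.card ι)
    (su : ∀ i r, s i (u r) = u r) (sq : ∀ i r, s i (q r) = q r) :
    ⁅∑ i, shiftTerm ((∏ r, (y i - q r + x)) * a i) (s i),
      ∑ i, shiftTerm ((∏ r, (y i - u r - x)) * a i) (s i).symm⁆ =
    LinearMap.mulLeft ℂ (d * (2 * ∑ i, y i - ∑ r, u r - ∑ r, q r)) := by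
  have iu : ∀ i r, (s i).symm (u r) = u r := fun i r => by rw [AlgEquiv.symm_apply_eq, su]
  have iq : ∀ i r, (s i).symm (q r) = q r := fun i r => by rw [AlgEquiv.symm_apply_eq, sq]
  have ix : ∀ i, (s i).symm x = x := fun i => by rw [AlgEquiv.symm_apply_eq, sx]
  have iy : ∀ i, (s i).symm (y i) = y i - d := fun i => by
    rw [AlgEquiv.symm_apply_eq, map_sub, h.self, h.step]; ring
  have ine : ∀ i j, i ≠ j → (s i).symm (y j) = y j := fun i j hij => by
    rw [AlgEquiv.symm_apply_eq, h.ne i j hij]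
  have icomm : ∀ i j F, s i ((s j).symm F) = (s j).symm (s i F) := fun i j F => by
    apply (s j).injective
    rw [h.comm j i]
    simp only [AlgEquiv.apply_symm_apply]
  -- At the node `y i + x`, the differences to the nodes `y k + x` are inverted by `a i`, those to
  -- `y k - x` with `k ≠ i` by `s i (a i)`, and the difference to its partner `y i - x` is `d`, with
  -- inverse `w`. The same holds at `y i - x`, with the inverse shift and `-d`.
  have key := sum_mul_prod_sub_eq (K := K) (ι := ι ⊕ ι) (κ := κ ⊕ κ')
    (y := Sum.elim (fun i => y i + x) (fun i => y i - x))
    (b := Sum.elim (fun i => w * (a i * s i (a i))) (fun i => -w * (a i * (s i).symm (a i))))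
    (p := Sum.elim u q) (by simpa using hc) ?_
  · ext F
    rw [lie_end_apply, LinearMap.mulLeft_apply]
    simp only [LinearMap.sum_apply, shiftTerm_apply, map_sum, map_mul, map_prod, map_sub, map_add,
      Finset.mul_sum]
    rw [Finset.sum_comm, ← Finset.sum_sub_distrib]
    simp only [← Finset.sum_sub_distrib]
    have e : ∀ i j, i ≠ j →
        (∏ r, (y j - q r + x)) * a j * ((∏ r, (s j (y i) - s j (u r) - s j x)) * s j (a i) *
          s j ((s i).symm F)) - (∏ r, (y i - u r - x)) * a i * ((∏ r, ((s i).symm (y j) -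
          (s i).symm (q r) + (s i).symm x)) * (s i).symm (a j) * (s i).symm (s j F)) = 0 := by
      intro i j hij
      simp only [su, sx, iq, ix, h.ne j i hij.symm, ine i j hij, icomm]
      linear_combination (∏ r, (y j - q r + x)) * (∏ r, (y i - u r - x)) * (s i).symm (s j F) *
        h.mul_shift_inv_mixed hij.symm
    have e₀ : ∀ i, ∑ j,
        ((∏ r, (y j - q r + x)) * a j * ((∏ r, (s j (y i) - s j (u r) - s j x)) * s j (a i) *
          s j ((s i).symm F)) - (∏ r, (y i - u r - x)) * a i * ((∏ r, ((s i).symm (y j) -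
          (s i).symm (q r) + (s i).symm x)) * (s i).symm (a j) * (s i).symm (s j F))) =
        d * (w * (a i * s i (a i)) * ((∏ r, (y i + x - u r)) * ∏ r, (y i + x - q r)) +
          -w * (a i * (s i).symm (a i)) * ((∏ r, (y i - x - u r)) * ∏ r, (y i - x - q r))) *
          F := by
      intro i
      rw [Finset.sum_eq_single i (fun j _ hji => e i j hji.symm) (by simp)]
      simp only [su, sx, iq, ix, iy, h.self, AlgEquiv.apply_symm_apply, AlgEquiv.symm_apply_apply]
      have f₁ : ∀ r, y i + d - u r - x = y i + x - u r := fun r => by rw [hx]; ring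
      have f₂ : ∀ r, y i - d - q r + x = y i - x - q r := fun r => by rw [hx]; ring
      have f₃ : ∀ r, y i - q r + x = y i + x - q r := fun r => by ring
      have f₄ : ∀ r, y i - u r - x = y i - x - u r := fun r => by ring
      simp only [f₁, f₂, f₃, f₄]
      linear_combination -hw * F * (a i * s i (a i) * ((∏ r, (y i + x - u r)) *
        ∏ r, (y i + x - q r)) - a i * (s i).symm (a i) * ((∏ r, (y i - x - u r)) *
        ∏ r, (y i - x - q r)))
    rw [Finset.sum_comm, ← Finset.mul_sum]
    simp only [e₀]
    rw [← Finset.sum_mul, ← Finset.mul_sum, Finset.sum_add_distrib]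
    simp only [Fintype.sum_sum_type, Fintype.prod_sum_type, Sum.elim_inl, Sum.elim_inr] at key
    rw [key, Finset.sum_add_distrib, Finset.sum_sub_distrib]
    ring
  · rintro (i | i)
    · have e : Finset.univ.erase (Sum.inl i : ι ⊕ ι) =
          (Finset.univ.erase i).disjSum Finset.univ := by
        ext (k | k) <;> simp
      rw [e, Finset.prod_disjSum, ← Finset.mul_prod_erase Finset.univ _ (Finset.mem_univ i)]
      have e₂ : ∏ k ∈ Finset.univ.erase i, (y i + d - y k) =
          s i (∏ k ∈ Finset.univ.erase i, (y i - y k)) := by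
        rw [map_prod]
        refine Finset.prod_congr rfl fun k hk => ?_
        rw [map_sub, h.self, h.ne i k (Finset.ne_of_mem_erase hk).symm]
      have e₃ := congrArg (s i) (h.inv i)
      rw [map_mul, map_one, ← e₂] at e₃
      have e₁ := h.inv i
      simp only [Sum.elim_inl, Sum.elim_inr]
      have f₁ : ∀ k, y i + x - (y k + x) = y i - y k := fun k => by ring
      have f₂ : ∀ k, y i + x - (y k - x) = y i + d - y k := fun k => by rw [hx]; ring
      simp only [f₁, f₂]
      linear_combination hw + d * w * (s i (a i) *
        ∏ k ∈ Finset.univ.erase i, (y i + d - y k)) * e₁ + d * w * e₃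
    · have e : Finset.univ.erase (Sum.inr i : ι ⊕ ι) =
          Finset.univ.disjSum (Finset.univ.erase i) := by
        ext (k | k) <;> simp
      rw [e, Finset.prod_disjSum, ← Finset.mul_prod_erase Finset.univ _ (Finset.mem_univ i)]
      have e₂ : ∏ k ∈ Finset.univ.erase i, (y i - d - y k) =
          (s i).symm (∏ k ∈ Finset.univ.erase i, (y i - y k)) := by
        rw [map_prod]
        refine Finset.prod_congr rfl fun k hk => ?_
        rw [map_sub, iy, ine i k (Finset.ne_of_mem_erase hk).symm]
      have e₃ := congrArg (s i).symm (h.inv i)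
      rw [map_mul, map_one, ← e₂] at e₃
      have e₁ := h.inv i
      simp only [Sum.elim_inl, Sum.elim_inr]
      have f₁ : ∀ k, y i - x - (y k - x) = y i - y k := fun k => by ring
      have f₂ : ∀ k, y i - x - (y k + x) = y i - d - y k := fun k => by rw [hx]; ring
      simp only [f₁, f₂]
      linear_combination hw + d * w * ((s i).symm (a i) *
        ∏ k ∈ Finset.univ.erase i, (y i - d - y k)) * e₁ + d * w * e₃

/-- A raising term at one level commutes with a lowering term at the next level. -/
theorem lie_raise_lower_eq_zero {κ : Type*} [Fintype κ] [DecidableEq κ] {y : ι → K} {z : κ → K}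
    {α β x : K} {s t : K ≃ₐ[ℂ] K} (i : ι) (j : κ) (st : ∀ F, s (t F) = t (s F))
    (sx : s x = x) (tx : t x = x) (sy : s (y i) = y i - (x + x)) (sy' : ∀ k, i ≠ k → s (y k) = y k)
    (sz : ∀ k, s (z k) = z k) (tz : t (z j) = z j + (x + x)) (tz' : ∀ k, j ≠ k → t (z k) = z k)
    (ty : ∀ k, t (y k) = y k) (sβ : s β = β) (tα : t α = α) :
    ⁅shiftTerm ((∏ r, (y i - z r - x)) * α) s, shiftTerm ((∏ r, (z j - y r + x)) * β) t⁆ = 0 := by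
  have sB : s (∏ r ∈ Finset.univ.erase i, (z j - y r + x)) =
      ∏ r ∈ Finset.univ.erase i, (z j - y r + x) := by
    rw [map_prod]
    refine Finset.prod_congr rfl fun k hk => ?_
    rw [map_add, map_sub, sz, sx, sy' k (Finset.ne_of_mem_erase hk).symm]
  have tA : t (∏ r ∈ Finset.univ.erase j, (y i - z r - x)) =
      ∏ r ∈ Finset.univ.erase j, (y i - z r - x) := by
    rw [map_prod]
    refine Finset.prod_congr rfl fun k hk => ?_
    rw [map_sub, map_sub, ty, tx, tz' k (Finset.ne_of_mem_erase hk).symm]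
  -- Only the factors `y i - z j - x` and `z j - y i + x` are moved by the other shift. They are
  -- negatives of each other, so both orders give the same product.
  rw [← Finset.mul_prod_erase Finset.univ _ (Finset.mem_univ j),
    ← Finset.mul_prod_erase Finset.univ (fun r => z j - y r + x) (Finset.mem_univ i)]
  ext F
  simp only [lie_end_apply, shiftTerm_apply, map_mul, map_sub, map_add, sB, tA, sβ, tα, sx, tx, sy,
    tz, sz, ty, st, LinearMap.zero_apply]
  ring

end ShiftGroup

end DifferenceOperators

/-! ### The Gelfand-Zetlin operators over a commutative ring with shifts -/

/-- A triangular array `γ n j`, `j < n`, in a commutative algebra, with commuting automorphisms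
`σ n j` shifting the entries by `eps` for `n < L`, and with inverses of the products of the
differences of the entries for `n < N`. -/
structure ShiftArray (K : Type*) [CommRing K] [Algebra ℂ K] (eps : ℂ) (L N : ℕ) where
  γ : ∀ n : ℕ, Fin n → K
  σ : ∀ n : ℕ, Fin n → K ≃ₐ[ℂ] K
  a : ∀ n : ℕ, Fin n → K
  -- `L = N` for the array of meromorphic functions. `L = N + 1` is used when the last level
  -- consists of variables, which can be shifted but whose differences are not inverted.
  le : N ≤ L
  ne_zero : eps ≠ 0
  self : ∀ n (j : Fin n), n < L → σ n j (γ n j) = γ n j + algebraMap ℂ K eps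
  same : ∀ n j k, n < L → j ≠ k → σ n j (γ n k) = γ n k
  other : ∀ n j m k, n < L → n ≠ m → σ n j (γ m k) = γ m k
  comm : ∀ n j m k F, σ n j (σ m k F) = σ m k (σ n j F)
  inv : ∀ n j, n < N → a n j * ∏ k ∈ Finset.univ.erase j, (γ n j - γ n k) = 1

namespace ShiftArray

variable {K : Type*} [CommRing K] [Algebra ℂ K] {eps : ℂ} {L N : ℕ} (D : ShiftArray K eps L N)

/-- Half of the step of the shifts. -/
noncomputable abbrev half (_ : ShiftArray K eps L N) : K := algebraMap ℂ K (eps / 2)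

theorem algebraMap_eq_half_add : algebraMap ℂ K eps = D.half + D.half := by
  rw [← map_add, add_halves]

theorem shiftGroup {n : ℕ} (hn : n < N) :
    ShiftGroup (D.γ n) (D.a n) (D.σ n) (algebraMap ℂ K eps) where
  self i := D.self n i (hn.trans_le D.le)
  ne i j hij := D.same n i j (hn.trans_le D.le) hij
  step _ := AlgEquiv.commutes _ _
  comm _ _ _ := D.comm _ _ _ _ _
  inv i := D.inv n i hn

/-- The shift fixes the differences of level `m`, and inverses are unique. -/
theorem inv_fixed {n m : ℕ} {i : Fin n} {j : Fin m} (hn : n < L) (hm : m < N) (hnm : n ≠ m) :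
    D.σ n i (D.a m j) = D.a m j := by
  have h := D.inv m j hm
  have h' := congrArg (D.σ n i) h
  rw [map_mul, map_prod, map_one] at h'
  simp only [map_sub, D.other n i m _ hn hnm] at h'
  linear_combination (-(D.σ n i (D.a m j))) * h + D.a m j * h'

theorem symm_fixed {n : ℕ} {i : Fin n} {x : K} (h : D.σ n i x = x) : (D.σ n i).symm x = x := by
  rw [AlgEquiv.symm_apply_eq, h]

theorem comm_symm {n m : ℕ} (i : Fin n) (j : Fin m) (F : K) :
    D.σ n i ((D.σ m j).symm F) = (D.σ m j).symm (D.σ n i F) := by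
  apply (D.σ m j).injective
  rw [D.comm m j n i]
  simp only [AlgEquiv.apply_symm_apply]

theorem symm_comm_symm {n m : ℕ} (i : Fin n) (j : Fin m) (F : K) :
    (D.σ n i).symm ((D.σ m j).symm F) = (D.σ m j).symm ((D.σ n i).symm F) := by
  apply (D.σ n i).injective
  rw [D.comm_symm i j ((D.σ n i).symm F), AlgEquiv.apply_symm_apply, AlgEquiv.apply_symm_apply]

/-- The coefficients of the raising operators, without the scalar factor. -/
noncomputable def upCoeff (m : ℕ) (j : Fin (m + 1)) : K :=
  (∏ r : Fin (m + 2), (D.γ (m + 1) j - D.γ (m + 2) r - D.half)) * D.a (m + 1) j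

/-- The coefficients of the lowering operators, without the scalar factor. -/
noncomputable def downCoeff (m : ℕ) (j : Fin (m + 1)) : K :=
  (∏ r : Fin m, (D.γ (m + 1) j - D.γ m r + D.half)) * D.a (m + 1) j

/-- The eigenvalues of the Cartan generators, without the scalar factor. -/
def diagCoeff (m : ℕ) : K := ∑ j, D.γ (m + 1) j - ∑ j, D.γ m j

/-- The operator of the matrix unit with indices `m`, `m + 1`. -/
noncomputable def up (m : ℕ) : Module.End ℂ K :=
  (-(1 / eps)) • ∑ j, shiftTerm (D.upCoeff m j) (D.σ (m + 1) j).symm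

/-- The operator of the matrix unit with indices `m + 1`, `m`. -/
noncomputable def down (m : ℕ) : Module.End ℂ K :=
  (1 / eps) • ∑ j, shiftTerm (D.downCoeff m j) (D.σ (m + 1) j)

/-- The operator of the matrix unit with indices `m`, `m`. -/
noncomputable def diag (m : ℕ) : Module.End ℂ K := (1 / eps) • LinearMap.mulLeft ℂ (D.diagCoeff m)

theorem upCoeff_fixed {n m : ℕ} {i : Fin n} {j : Fin (m + 1)} (hn : n < L) (hm : m + 1 < N)
    (h₁ : n ≠ m + 1) (h₂ : n ≠ m + 2) : D.σ n i (D.upCoeff m j) = D.upCoeff m j := by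
  simp only [upCoeff, map_mul, map_prod, map_sub, D.other n i _ _ hn h₁, D.other n i _ _ hn h₂,
    AlgEquiv.commutes, D.inv_fixed hn hm h₁]

theorem downCoeff_fixed {n m : ℕ} {i : Fin n} {j : Fin (m + 1)} (hn : n < L) (hm : m + 1 < N)
    (h₁ : n ≠ m + 1) (h₂ : n ≠ m) : D.σ n i (D.downCoeff m j) = D.downCoeff m j := by
  simp only [downCoeff, map_mul, map_prod, map_sub, map_add, D.other n i _ _ hn h₁,
    D.other n i _ _ hn h₂, AlgEquiv.commutes, D.inv_fixed hn hm h₁]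

theorem diagCoeff_fixed {n m : ℕ} {i : Fin n} (hn : n < L) (h₁ : n ≠ m + 1) (h₂ : n ≠ m) :
    D.σ n i (D.diagCoeff m) = D.diagCoeff m := by
  simp only [diagCoeff, map_sub, map_sum, D.other n i _ _ hn h₁, D.other n i _ _ hn h₂]

theorem sum_shift {n : ℕ} (i : Fin n) (hn : n < L) :
    D.σ n i (∑ j, D.γ n j) = ∑ j, D.γ n j + algebraMap ℂ K eps := by
  rw [map_sum, ← Finset.add_sum_erase _ _ (Finset.mem_univ i), ← Finset.add_sum_erase _ (D.γ n)
    (Finset.mem_univ i), D.self n i hn, Finset.sum_congr rfl fun j hj =>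
    D.same n i j hn (Finset.ne_of_mem_erase hj).symm]
  ring

theorem diagCoeff_shift {m : ℕ} (i : Fin (m + 1)) (hm : m + 1 < L) :
    D.σ (m + 1) i (D.diagCoeff m) = D.diagCoeff m + algebraMap ℂ K eps := by
  rw [diagCoeff, map_sub, D.sum_shift i hm, map_sum]
  simp only [D.other (m + 1) i m _ hm (Nat.succ_ne_self m)]
  ring

theorem diagCoeff_succ_shift {m : ℕ} (i : Fin (m + 1)) (hm : m + 1 < L) :
    D.σ (m + 1) i (D.diagCoeff (m + 1)) = D.diagCoeff (m + 1) + -algebraMap ℂ K eps := by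
  rw [diagCoeff, map_sub, D.sum_shift i hm, map_sum]
  simp only [D.other (m + 1) i (m + 2) _ hm (Nat.succ_ne_self _).symm]
  ring

/-! #### Commutators with multiplication operators and shifts -/

theorem lie_mulLeft_up {g d : K} {m : ℕ} (h : ∀ i, (D.σ (m + 1) i).symm g = g + d) :
    ⁅LinearMap.mulLeft ℂ g, D.up m⁆ = LinearMap.mulLeft ℂ (-d) ∘ₗ D.up m := by
  simp only [up, lie_smul, lie_sum, lie_mulLeft_shiftTerm (h _), LinearMap.comp_smul]
  ext F
  simp

theorem lie_mulLeft_down {g d : K} {m : ℕ} (h : ∀ i, D.σ (m + 1) i g = g + d) :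
    ⁅LinearMap.mulLeft ℂ g, D.down m⁆ = LinearMap.mulLeft ℂ (-d) ∘ₗ D.down m := by
  simp only [down, lie_smul, lie_sum, lie_mulLeft_shiftTerm (h _), LinearMap.comp_smul]
  ext F
  simp

theorem lie_mulLeft_up_eq_zero {g : K} {m : ℕ} (h : ∀ i, D.σ (m + 1) i g = g) :
    ⁅LinearMap.mulLeft ℂ g, D.up m⁆ = 0 := by
  rw [D.lie_mulLeft_up (d := 0) fun i => by rw [D.symm_fixed (h i), add_zero]]
  ext; simp

theorem lie_mulLeft_down_eq_zero {g : K} {m : ℕ} (h : ∀ i, D.σ (m + 1) i g = g) :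
    ⁅LinearMap.mulLeft ℂ g, D.down m⁆ = 0 := by
  rw [D.lie_mulLeft_down (d := 0) fun i => by rw [h i, add_zero]]
  ext; simp

theorem lie_diag_mulLeft (k : ℕ) (g : K) : ⁅D.diag k, LinearMap.mulLeft ℂ g⁆ = 0 := by
  rw [diag, smul_lie, lie_mulLeft_mulLeft, smul_zero]

theorem lie_diag_diag (k m : ℕ) : ⁅D.diag k, D.diag m⁆ = 0 := by
  rw [diag, diag, lie_smul, smul_lie, lie_mulLeft_mulLeft, smul_zero, smul_zero]

theorem lie_diag_up_eq_zero {k m : ℕ} (hm : m + 1 < L) (h₁ : m ≠ k) (h₂ : m + 1 ≠ k) :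
    ⁅D.diag k, D.up m⁆ = 0 := by
  rw [diag, smul_lie, D.lie_mulLeft_up_eq_zero fun i => D.diagCoeff_fixed hm (by omega) h₂,
    smul_zero]

theorem lie_diag_down_eq_zero {k m : ℕ} (hm : m + 1 < L) (h₁ : m ≠ k) (h₂ : m + 1 ≠ k) :
    ⁅D.diag k, D.down m⁆ = 0 := by
  rw [diag, smul_lie, D.lie_mulLeft_down_eq_zero fun i => D.diagCoeff_fixed hm (by omega) h₂,
    smul_zero]

theorem symm_shift {n : ℕ} {i : Fin n} {g : K} {c : ℂ} (h : D.σ n i g = g + algebraMap ℂ K c) :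
    (D.σ n i).symm g = g + -algebraMap ℂ K c := by
  rw [AlgEquiv.symm_apply_eq, map_add, map_neg, AlgEquiv.commutes, h]
  ring

theorem smul_mulLeft_comp (heps : eps ≠ 0) (c : ℂ) (A : Module.End ℂ K) (hc : c = eps) :
    (1 / eps) • (LinearMap.mulLeft ℂ (algebraMap ℂ K c) ∘ₗ A) = A := by
  ext F
  simp only [LinearMap.smul_apply, LinearMap.comp_apply, LinearMap.mulLeft_apply,
    ← Algebra.smul_def, smul_smul, hc]
  rw [one_div, inv_mul_cancel₀ heps, one_smul]

theorem smul_mulLeft_neg_comp (heps : eps ≠ 0) (A : Module.End ℂ K) :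
    (1 / eps) • (LinearMap.mulLeft ℂ (-algebraMap ℂ K eps) ∘ₗ A) = -A := by
  conv_rhs => rw [← smul_mulLeft_comp heps eps A rfl]
  rw [← smul_neg]
  congr 1
  ext F
  simp

theorem lie_diag_up {m : ℕ} (hm : m + 1 < L) : ⁅D.diag m, D.up m⁆ = D.up m := by
  rw [diag, smul_lie, D.lie_mulLeft_up fun i => D.symm_shift (D.diagCoeff_shift i hm), neg_neg,
    smul_mulLeft_comp D.ne_zero eps _ rfl]

theorem lie_diag_down {m : ℕ} (hm : m + 1 < L) : ⁅D.diag m, D.down m⁆ = -D.down m := by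
  rw [diag, smul_lie, D.lie_mulLeft_down fun i => D.diagCoeff_shift i hm,
    smul_mulLeft_neg_comp D.ne_zero]

theorem lie_diag_succ_up {m : ℕ} (hm : m + 1 < L) : ⁅D.diag (m + 1), D.up m⁆ = -D.up m := by
  rw [diag, smul_lie, D.lie_mulLeft_up (d := algebraMap ℂ K eps) fun i => by
    rw [D.symm_shift (c := -eps) (by rw [D.diagCoeff_succ_shift i hm, map_neg]), map_neg, neg_neg],
    smul_mulLeft_neg_comp D.ne_zero]

theorem lie_diag_succ_down {m : ℕ} (hm : m + 1 < L) : ⁅D.diag (m + 1), D.down m⁆ = D.down m := by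
  rw [diag, smul_lie, D.lie_mulLeft_down fun i => D.diagCoeff_succ_shift i hm, neg_neg,
    smul_mulLeft_comp D.ne_zero eps _ rfl]

/-! ### Commuting root operators of different levels. -/

theorem lie_up_up_eq_zero {k m : ℕ} (hm : m + 1 < N) (h : k + 1 < m) :
    ⁅D.up k, D.up m⁆ = 0 := by
  have := D.le
  simp only [up, lie_smul, smul_lie, lie_sum, sum_lie]
  have z : ∀ (i : Fin (k + 1)) (j : Fin (m + 1)), ⁅shiftTerm (D.upCoeff k i) (D.σ (k + 1) i).symm,
      shiftTerm (D.upCoeff m j) (D.σ (m + 1) j).symm⁆ = 0 := fun i j =>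
    lie_shiftTerm_eq_zero
      (D.symm_fixed (D.upCoeff_fixed (by omega) (show m + 1 < N by omega) (by omega) (by omega)))
      (D.symm_fixed (D.upCoeff_fixed (by omega) (show k + 1 < N by omega) (by omega) (by omega)))
      (D.symm_comm_symm i j)
  simp only [z, Finset.sum_const_zero, smul_zero]

theorem lie_down_down_eq_zero {k m : ℕ} (hm : m + 1 < N) (h : k + 1 < m) :
    ⁅D.down k, D.down m⁆ = 0 := by
  have := D.le
  simp only [down, lie_smul, smul_lie, lie_sum, sum_lie]
  have z : ∀ (i : Fin (k + 1)) (j : Fin (m + 1)), ⁅shiftTerm (D.downCoeff k i) (D.σ (k + 1) i),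
      shiftTerm (D.downCoeff m j) (D.σ (m + 1) j)⁆ = 0 := fun i j =>
    lie_shiftTerm_eq_zero
      (D.downCoeff_fixed (by omega) (show m + 1 < N by omega) (by omega) (by omega))
      (D.downCoeff_fixed (by omega) (show k + 1 < N by omega) (by omega) (by omega))
      (D.comm _ i _ j)
  simp only [z, Finset.sum_const_zero, smul_zero]

/-- No gap between the levels is needed: the coefficients of `down k` involve levels `k` and `k +
1`, those of `up m` levels `m + 1` and `m + 2`, so neither shift touches the other coefficient. -/
theorem lie_down_up_eq_zero {k m : ℕ} (hm : m + 1 < N) (h : k < m) :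
    ⁅D.down k, D.up m⁆ = 0 := by
  have := D.le
  simp only [up, down, lie_smul, smul_lie, lie_sum, sum_lie]
  have z : ∀ (i : Fin (k + 1)) (j : Fin (m + 1)), ⁅shiftTerm (D.downCoeff k i) (D.σ (k + 1) i),
      shiftTerm (D.upCoeff m j) (D.σ (m + 1) j).symm⁆ = 0 := fun i j =>
    lie_shiftTerm_eq_zero
      (D.upCoeff_fixed (by omega) (show m + 1 < N by omega) (by omega) (by omega))
      (D.symm_fixed (D.downCoeff_fixed (by omega) (show k + 1 < N by omega) (by omega) (by omega)))
      (D.comm_symm i j)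
  simp only [z, Finset.sum_const_zero, smul_zero]

theorem lie_up_down_eq_zero {k m : ℕ} (hm : m + 1 < N) (h : k < m) :
    ⁅D.up k, D.down m⁆ = 0 := by
  have := D.le
  simp only [up, down, lie_smul, smul_lie, lie_sum, sum_lie]
  rcases Nat.lt_or_ge (k + 1) m with h' | h'
  · have z : ∀ (i : Fin (k + 1)) (j : Fin (m + 1)), ⁅shiftTerm (D.upCoeff k i) (D.σ (k + 1) i).symm,
      shiftTerm (D.downCoeff m j) (D.σ (m + 1) j)⁆ = 0 := fun i j =>
      lie_shiftTerm_eq_zero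
      (D.symm_fixed (D.downCoeff_fixed (by omega) (show m + 1 < N by omega) (by omega) (by omega)))
      (D.upCoeff_fixed (by omega) (show k + 1 < N by omega) (by omega) (by omega))
      fun F => (D.comm_symm j i F).symm
    simp only [z, Finset.sum_const_zero, smul_zero]
  -- For adjacent levels each coefficient contains a variable shifted by the other operator, and the
  -- two effects have to cancel.
  · obtain rfl : m = k + 1 := by omega
    have z : ∀ (i : Fin (k + 1)) (j : Fin (k + 2)), ⁅shiftTerm (D.upCoeff k i) (D.σ (k + 1) i).symm,
        shiftTerm (D.downCoeff (k + 1) j) (D.σ (k + 2) j)⁆ = 0 := by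
      intro i j
      refine ShiftGroup.lie_raise_lower_eq_zero i j (fun F => (D.comm_symm _ _ F).symm)
        (AlgEquiv.commutes _ _) (AlgEquiv.commutes _ _) ?_ ?_ ?_ ?_ ?_ ?_ ?_ ?_
      · rw [D.symm_shift (D.self _ i (by omega)), ← D.algebraMap_eq_half_add, sub_eq_add_neg]
      · exact fun l hl => D.symm_fixed (D.same _ _ _ (by omega) hl)
      · exact fun l => D.symm_fixed (D.other _ _ _ _ (by omega) (by omega))
      · rw [D.self _ j (by omega), ← D.algebraMap_eq_half_add]
      · exact fun l hl => D.same _ _ _ (by omega) hl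
      · exact fun l => D.other _ _ _ _ (by omega) (by omega)
      · exact D.symm_fixed (D.inv_fixed (by omega) (by omega) (by omega))
      · exact D.inv_fixed (by omega) (by omega) (by omega)
    simp only [z, Finset.sum_const_zero, smul_zero]

end ShiftArray

/-! ### The representation of `𝔤𝔩(n)` -/

namespace ShiftArray

variable {K : Type*} [CommRing K] [Algebra ℂ K] {eps : ℂ} {L N : ℕ} (D : ShiftArray K eps L N)

theorem lie_up_down {m : ℕ} (hm : m + 1 < N) : ⁅D.up m, D.down m⁆ = D.diag m - D.diag (m + 1) := by
  have hL := D.le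
  have key := (D.shiftGroup hm).lie_lower_raise (u := D.γ (m + 2)) (q := D.γ m) (x := D.half)
    (w := algebraMap ℂ K (1 / eps)) D.algebraMap_eq_half_add (fun i => AlgEquiv.commutes _ _)
    (by rw [← map_mul, mul_one_div_cancel D.ne_zero, map_one])
    (by simp; ring)
    (fun i r => D.other _ _ _ _ (by omega) (by omega))
    (fun i r => D.other _ _ _ _ (by omega) (by omega))
  rw [← lie_skew, down, up, lie_smul, smul_lie]
  change -(-(1 / eps) • (1 / eps) • ⁅∑ i, shiftTerm ((∏ r, (D.γ (m + 1) i - D.γ m r + D.half)) *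
    D.a (m + 1) i) (D.σ (m + 1) i), ∑ i, shiftTerm ((∏ r, (D.γ (m + 1) i - D.γ (m + 2) r - D.half)) *
    D.a (m + 1) i) (D.σ (m + 1) i).symm⁆) = _
  rw [key]
  ext F
  simp only [diag, diagCoeff, LinearMap.smul_apply, LinearMap.sub_apply, LinearMap.mulLeft_apply,
    neg_smul, neg_neg, ← Algebra.smul_def eps]
  rw [smul_mul_assoc, smul_smul (1 / eps) eps, one_div_mul_cancel D.ne_zero, one_smul, ← smul_sub]
  congr 1
  ring

/-- The shift of `γ (k + 2) j` moves exactly one factor of each coefficient of `up k`, the one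
called `p` below, so `serre_of_coeff_shift` applies with step `-eps`. A general `α` serves both the
Serre relation, where it is a coefficient of `up (k + 1)`, and the bare shift with `α = 1`. Level `k
+ 2` has to be shiftable only. -/
theorem lie_up_up_shift {k : ℕ} (hk : k + 1 < N) (hk' : k + 2 < L) (j : Fin (k + 2)) {α : K}
    (hα : ∀ i, D.σ (k + 1) i α = α) :
    ⁅D.up k, ⁅D.up k, shiftTerm α (D.σ (k + 2) j).symm⁆⁆ = 0 := by
  have key := (D.shiftGroup hk).symm.serre_of_coeff_shift (t := (D.σ (k + 2) j).symm)
    (p := fun i => D.γ (k + 1) i - D.γ (k + 2) j - D.half)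
    (q := fun i => ∏ r ∈ Finset.univ.erase j, (D.γ (k + 1) i - D.γ (k + 2) r - D.half))
    (fun i F => D.symm_comm_symm _ _ _)
    (fun i => D.symm_fixed (D.inv_fixed hk' hk (by omega)))
    (fun i => D.symm_fixed (hα i)) (fun i j => by ring)
    (fun i => by
      rw [map_sub, map_sub, AlgEquiv.commutes, D.symm_shift (D.self _ i (by omega)),
        D.symm_fixed (D.other _ i _ _ (by omega) (by omega))]
      ring)
    (fun i j hij => by
      rw [map_sub, map_sub, AlgEquiv.commutes, D.symm_fixed (D.same _ i _ (by omega) hij),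
        D.symm_fixed (D.other _ i _ _ (by omega) (by omega))])
    (fun i => by
      rw [map_sub, map_sub, AlgEquiv.commutes, D.symm_shift (D.self _ j (by omega)),
        D.symm_fixed (D.other _ j _ _ (by omega) (by omega))]
      ring)
    (fun i j hij => by
      rw [map_prod]
      refine Finset.prod_congr rfl fun r _ => ?_
      rw [map_sub, map_sub, AlgEquiv.commutes, D.symm_fixed (D.same _ i _ (by omega) hij),
        D.symm_fixed (D.other _ i _ _ (by omega) (by omega))])
    (fun i => by
      rw [map_prod]
      refine Finset.prod_congr rfl fun r hr => ?_
      rw [map_sub, map_sub, AlgEquiv.commutes, D.symm_fixed (D.same _ j _ (by omega)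
        (Finset.ne_of_mem_erase hr).symm), D.symm_fixed (D.other _ j _ _ (by omega) (by omega))])
  have e : ∀ i : Fin (k + 1), D.upCoeff k i = (D.γ (k + 1) i - D.γ (k + 2) j - D.half) *
      (∏ r ∈ Finset.univ.erase j, (D.γ (k + 1) i - D.γ (k + 2) r - D.half)) *
        D.a (k + 1) i := fun i => by
    rw [Finset.mul_prod_erase Finset.univ (fun r => D.γ (k + 1) i - D.γ (k + 2) r - D.half)
      (Finset.mem_univ j), upCoeff]
  simp only [up, smul_lie, lie_smul, e, key, smul_zero]

theorem lie_up_up_up {k : ℕ} (hk : k + 2 < N) : ⁅D.up k, ⁅D.up k, D.up (k + 1)⁆⁆ = 0 := by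
  have := D.le
  conv in (D.up (k + 1)) => rw [up]
  simp only [lie_smul, lie_sum]
  simp only [D.lie_up_up_shift (by omega) (show k + 2 < L by omega) _
    fun i => D.upCoeff_fixed (n := k + 1) (m := k + 1) (by omega) hk (by omega) (by omega)]
  simp

/-- Here the roles are reversed: the shifts in `down k` act on the product over level `k + 1` in the
coefficients of `down (k + 1)`, while the shifts of level `k + 2` fix the coefficients of `down k`.
This is the situation of `serre_of_shift_coeff`. -/
theorem lie_down_down_down {k : ℕ} (hk : k + 2 < N) :
    ⁅D.down k, ⁅D.down k, D.down (k + 1)⁆⁆ = 0 := by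
  have hL := D.le
  have key := fun j : Fin (k + 2) =>
    (D.shiftGroup (show k + 1 < N by omega)).serre_of_shift_coeff (t := D.σ (k + 2) j)
    (α := D.a (k + 2) j) (u := D.γ (k + 2) j + D.half)
    (q := fun i => ∏ r : Fin k, (D.γ (k + 1) i - D.γ k r + D.half))
    (fun i F => D.comm _ _ _ _ _)
    (fun i => D.inv_fixed (by omega) (by omega) (by omega))
    (fun i => D.inv_fixed (by omega) (by omega) (by omega))
    (fun i => by rw [map_add, AlgEquiv.commutes, D.other _ _ _ _ (by omega) (by omega)])
    (fun i l hil => by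
      simp only [map_prod, map_add, map_sub, AlgEquiv.commutes, D.same _ i l (by omega) hil,
        D.other (k + 1) i k _ (by omega) (by omega)])
    (fun i => by
      simp only [map_prod, map_add, map_sub, AlgEquiv.commutes,
        D.other (k + 2) j (k + 1) _ (by omega) (by omega),
        D.other (k + 2) j k _ (by omega) (by omega)])
  have e : ∀ j : Fin (k + 2), D.downCoeff (k + 1) j =
      D.a (k + 2) j * ∏ i, (D.γ (k + 2) j + D.half - D.γ (k + 1) i) := fun j => by
    rw [downCoeff, mul_comm]
    congr 1
    exact Finset.prod_congr rfl fun r _ => by ring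
  conv in (D.down (k + 1)) => rw [down]
  simp only [lie_smul, lie_sum, e]
  simp only [down, smul_lie, lie_smul, downCoeff, key, smul_zero, Finset.sum_const_zero]

theorem lie_up_succ_up_succ_up {k : ℕ} (hk : k + 2 < N) :
    ⁅D.up (k + 1), ⁅D.up (k + 1), D.up k⁆⁆ = 0 := by
  have hL := D.le
  have key := fun j : Fin (k + 1) =>
    (D.shiftGroup hk).symm.serre_of_shift_coeff (t := (D.σ (k + 1) j).symm)
    (α := D.a (k + 1) j) (u := D.γ (k + 1) j - D.half)
    (q := fun i => ∏ r : Fin (k + 3), (D.γ (k + 2) i - D.γ (k + 3) r - D.half))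
    (fun i F => D.symm_comm_symm _ _ _)
    (fun i => D.symm_fixed (D.inv_fixed (by omega) (by omega) (by omega)))
    (fun i => D.symm_fixed (D.inv_fixed (by omega) (by omega) (by omega)))
    (fun i => by
      rw [map_sub, AlgEquiv.commutes, D.symm_fixed (D.other _ _ _ _ (by omega) (by omega))])
    (fun i l hil => by
      simp only [map_prod, map_sub, AlgEquiv.commutes,
        D.symm_fixed (D.same (k + 2) i l (by omega) hil),
        D.symm_fixed (D.other (k + 2) i (k + 3) _ (by omega) (by omega))])
    (fun i => by
      simp only [map_prod, map_sub, AlgEquiv.commutes,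
        D.symm_fixed (D.other (k + 1) j (k + 2) _ (by omega) (by omega)),
        D.symm_fixed (D.other (k + 1) j (k + 3) _ (by omega) (by omega))])
  have e : ∀ j : Fin (k + 1), D.upCoeff k j =
      D.a (k + 1) j * ∏ i, (D.γ (k + 1) j - D.half - D.γ (k + 2) i) := fun j => by
    rw [upCoeff, mul_comm]
    congr 1
    exact Finset.prod_congr rfl fun r _ => by ring
  conv in (D.up k) => rw [up]
  simp only [lie_smul, lie_sum, e]
  simp only [up, smul_lie, lie_smul, upCoeff, key, smul_zero, Finset.sum_const_zero]

theorem lie_down_succ_down_succ_down {k : ℕ} (hk : k + 2 < N) :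
    ⁅D.down (k + 1), ⁅D.down (k + 1), D.down k⁆⁆ = 0 := by
  have hL := D.le
  have key := fun j : Fin (k + 1) =>
    (D.shiftGroup hk).serre_of_coeff_shift (t := D.σ (k + 1) j) (α := D.downCoeff k j)
    (p := fun i => D.γ (k + 2) i - D.γ (k + 1) j + D.half)
    (q := fun i => ∏ r ∈ Finset.univ.erase j, (D.γ (k + 2) i - D.γ (k + 1) r + D.half))
    (fun i F => D.comm _ _ _ _ _)
    (fun i => D.inv_fixed (by omega) hk (by omega))
    (fun i => D.downCoeff_fixed (by omega) (by omega) (by omega) (by omega)) (fun i j => by ring)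
    (fun i => by
      rw [map_add, map_sub, AlgEquiv.commutes, D.self _ i (by omega),
        D.other _ i _ _ (by omega) (by omega)]
      ring)
    (fun i j hij => by
      rw [map_add, map_sub, AlgEquiv.commutes, D.same _ i _ (by omega) hij,
        D.other _ i _ _ (by omega) (by omega)])
    (fun i => by
      rw [map_add, map_sub, AlgEquiv.commutes, D.self _ j (by omega),
        D.other _ j _ _ (by omega) (by omega)]
      ring)
    (fun i j hij => by
      rw [map_prod]
      refine Finset.prod_congr rfl fun r _ => ?_
      rw [map_add, map_sub, AlgEquiv.commutes, D.same _ i _ (by omega) hij,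
        D.other _ i _ _ (by omega) (by omega)])
    (fun i => by
      rw [map_prod]
      refine Finset.prod_congr rfl fun r hr => ?_
      rw [map_add, map_sub, AlgEquiv.commutes, D.same _ j _ (by omega)
        (Finset.ne_of_mem_erase hr).symm, D.other _ j _ _ (by omega) (by omega)])
  have e : ∀ (j : Fin (k + 1)) (i : Fin (k + 2)), D.downCoeff (k + 1) i =
      (D.γ (k + 2) i - D.γ (k + 1) j + D.half) *
        (∏ r ∈ Finset.univ.erase j, (D.γ (k + 2) i - D.γ (k + 1) r + D.half)) *
        D.a (k + 2) i := fun j i => by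
    rw [Finset.mul_prod_erase Finset.univ (fun r => D.γ (k + 2) i - D.γ (k + 1) r + D.half)
      (Finset.mem_univ j), downCoeff]
  -- The factorisation `e` of the coefficients of `down (k + 1)` depends on `j`, so the summands of
  -- `down k` are treated one at a time.
  have key' : ∀ j : Fin (k + 1), ⁅D.down (k + 1), ⁅D.down (k + 1),
      shiftTerm (D.downCoeff k j) (D.σ (k + 1) j)⁆⁆ = 0 := fun j => by
    simp only [down, smul_lie, lie_smul, e j, key j, smul_zero]
  conv in (D.down k) => rw [down]
  simp only [lie_smul, lie_sum, key', smul_zero, Finset.sum_const_zero]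

/-- The Cartan and simple root generators of the family `E` are the Gelfand-Zetlin operators. -/
structure IsGen (n : ℕ) (E : ℕ → ℕ → Module.End ℂ K) : Prop where
  diag : ∀ k, k < n → E k k = D.diag k
  up : ∀ k, k + 1 < n → E k (k + 1) = D.up k
  down : ∀ k, k + 1 < n → E (k + 1) k = D.down k

theorem IsGen.mono {D : ShiftArray K eps L N} {n m : ℕ} {E : ℕ → ℕ → Module.End ℂ K}
    (h : D.IsGen n E) (hm : m ≤ n) : D.IsGen m E :=
  ⟨fun k hk => h.diag k (by omega), fun k hk => h.up k (by omega), fun k hk => h.down k (by omega)⟩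

/-- The Gelfand-Zetlin operators generate a representation of `𝔤𝔩(n)`. -/
theorem exists_isGl {n : ℕ} (hn : n ≤ N) :
    ∃ E : ℕ → ℕ → Module.End ℂ K, IsGl n E ∧ D.IsGen n E := by
  have hL := D.le
  match n with
  | 0 => exact ⟨fun _ _ => 0, fun a b c d ha => by omega,
      ⟨fun k hk => by omega, fun k hk => by omega, fun k hk => by omega⟩⟩
  | n + 1 =>
    induction n with
    | zero =>
      refine ⟨fun _ _ => D.diag 0, fun a b c d ha hb hc hd => ?_,
        ⟨fun k hk => by rw [Nat.lt_one_iff.1 hk], fun k hk => by omega, fun k hk => by omega⟩⟩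
      rw [Nat.lt_one_iff.1 ha, Nat.lt_one_iff.1 hb, Nat.lt_one_iff.1 hc, Nat.lt_one_iff.1 hd]
      simp
    | succ m ih =>
      obtain ⟨E, hE, hG⟩ := ih (by omega)
      -- The new column, generated by its lowest entry `D.up m`; the last condition is a Serre
      -- relation.
      obtain ⟨v, hvm, hv⟩ := hE.exists_isVec (φ₀ := D.up m)
        (fun k hk => by
          rw [hG.diag k (by omega)]; exact D.lie_diag_up_eq_zero (by omega) (by omega) (by omega))
        (fun k hk => by
          rw [hG.up k (by omega)]; exact D.lie_up_up_eq_zero (by omega) (by omega))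
        (fun k hk => by
          rw [hG.down k (by omega)]; exact D.lie_down_up_eq_zero (by omega) (by omega))
        (by rw [hG.diag m (by omega)]; exact D.lie_diag_up (by omega))
        (by
          rintro k rfl
          rw [hG.up k (by omega)]; exact D.lie_up_up_up (by omega))
      -- The new row, a vector operator for the dual family, in which raising and lowering operators
      -- change places.
      obtain ⟨w, hwm, hw⟩ := hE.dual.exists_isVec (φ₀ := D.down m)
        (fun k hk => by
          rw [hG.diag k (by omega), neg_lie,
            D.lie_diag_down_eq_zero (by omega) (by omega) (by omega), neg_zero])
        (fun k hk => by
          rw [hG.down k (by omega), neg_lie, D.lie_down_down_eq_zero (by omega) (by omega),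
            neg_zero])
        (fun k hk => by
          rw [hG.up k (by omega), neg_lie, D.lie_up_down_eq_zero (by omega) (by omega), neg_zero])
        (by rw [hG.diag m (by omega), neg_lie, D.lie_diag_down (by omega), neg_neg])
        (by
          rintro k rfl
          rw [hG.down k (by omega)]
          simp only [neg_lie, lie_neg, neg_neg]
          exact D.lie_down_down_down (by omega))
      refine ⟨borderGl m E v w (D.diag (m + 1)), hE.border hv hw ?_ ?_ ?_ ?_ ?_ ?_ ?_ ?_, ?_, ?_, ?_⟩
      · intro k hk
        rw [hG.diag k (by omega)]; exact D.lie_diag_diag _ _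
      · intro k hk
        rw [hG.up k (by omega)]; exact D.lie_diag_up_eq_zero (by omega) (by omega) (by omega)
      · intro k hk
        rw [hG.down k (by omega)]; exact D.lie_diag_down_eq_zero (by omega) (by omega) (by omega)
      · rw [hvm]; exact D.lie_diag_succ_up (by omega)
      · rw [hwm]; exact D.lie_diag_succ_down (by omega)
      -- The last two entries of the column are `⁅up k, up (k + 1)⁆` and `up (k + 1)`, so their
      -- commutation is the other Serre relation.
      · rintro k rfl
        have e := hv (show k ≤ k + 1 by omega) le_rfl le_rfl
        rw [if_pos rfl, hvm, hG.up k (by omega)] at e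
        rw [hvm, ← e, ← lie_skew, ← lie_skew (D.up k), lie_neg, neg_neg]
        exact D.lie_up_succ_up_succ_up (by omega)
      · rintro k rfl
        have e := hw (show k ≤ k + 1 by omega) le_rfl le_rfl
        beta_reduce at e
        rw [if_pos rfl, hwm, hG.down k (by omega)] at e
        rw [hwm, ← e, neg_lie, ← lie_skew, ← lie_skew (D.down k), neg_neg,
          D.lie_down_succ_down_succ_down (by omega), neg_zero]
      · rw [hvm, hwm, hG.diag m (by omega)]; exact D.lie_up_down (by omega)
      · intro k hk
        rcases Nat.lt_succ_iff_lt_or_eq.1 hk with h | rfl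
        · rw [borderGl, if_pos (by omega), if_pos (by omega), hG.diag k (by omega)]
        · rw [borderGl, if_neg (by omega), if_neg (by omega)]
      · intro k hk
        rcases Nat.lt_succ_iff_lt_or_eq.1 hk with h | h
        · rw [borderGl, if_pos (by omega), if_pos (by omega), hG.up k (by omega)]
        · obtain rfl : k = m := by omega
          rw [borderGl, if_pos (by omega), if_neg (by omega), hvm]
      · intro k hk
        rcases Nat.lt_succ_iff_lt_or_eq.1 hk with h | h
        · rw [borderGl, if_pos (by omega), if_pos (by omega), hG.down k (by omega)]
        · obtain rfl : k = m := by omega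
          rw [borderGl, if_neg (by omega), if_pos (by omega), hwm]

end ShiftArray

/-! ### The characteristic identity -/

section VectorIdentity

variable {A : Type*} [Ring A] {E : ℕ → ℕ → A} {φ : ℕ → A} {m : ℕ}

theorem lie_mul_assoc (x y z : A) : ⁅x, y * z⁆ = ⁅x, y⁆ * z + y * ⁅x, z⁆ := by
  simp only [LieRing.of_associative_ring_bracket]
  noncomm_ring

/-- `∑ k, E a k * φ k` is a multiple of `φ a` for all `a` if it is for the last index. -/
theorem IsVec.sum_mul_eq (hφ : IsVec m E φ) (hE : IsGl (m + 1) E) {X : A}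
    (hX : ∀ a, a < m → ⁅E a m, X⁆ = 0)
    (h : ∑ k ∈ Finset.range (m + 1), E m k * φ k = X * φ m) {a : ℕ} (ha : a ≤ m) :
    ∑ k ∈ Finset.range (m + 1), E a k * φ k = X * φ a := by
  rcases ha.eq_or_lt with rfl | ham
  · exact h
  -- `E a m` commutes with `X` and sends `φ m` to `φ a`. On the left, the two extra terms, from `k =
  -- m` and `k = a`, are both `E m m * φ a` with opposite signs.
  have e := congrArg (fun x => ⁅E a m, x⁆) h
  simp only [lie_sum, lie_mul_assoc, hX a ham, zero_mul, zero_add] at e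
  rw [hφ ha le_rfl le_rfl, if_pos rfl] at e
  rw [← e]
  have e' : ∀ k ∈ Finset.range (m + 1), ⁅E a m, E m k⁆ * φ k + E m k * ⁅E a m, φ k⁆ =
      E a k * φ k + ((if k = m then E m m * φ a else 0) - if k = a then E m m * φ a else 0) := by
    intro k hk
    rw [Finset.mem_range] at hk
    rw [hE (by omega) (by omega) (by omega) hk, hφ ha le_rfl (by omega), if_pos rfl]
    rcases eq_or_ne k a with rfl | hka
    · rw [if_pos rfl, if_neg ham.ne', if_neg ham.ne, if_pos rfl]
      noncomm_ring
    · rcases eq_or_ne k m with rfl | hkm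
      · simp [hka, Ne.symm hka]
      · simp [hka, Ne.symm hka, hkm, Ne.symm hkm]
  rw [Finset.sum_congr rfl e', Finset.sum_add_distrib, Finset.sum_sub_distrib,
    Finset.sum_ite_eq', Finset.sum_ite_eq', if_pos (Finset.mem_range.2 (by omega)),
    if_pos (Finset.mem_range.2 (by omega)), sub_self, add_zero]

/-- Bracketing with `E (m + 1) m` moves the row index `m` to `m + 1`; the diagonal term accounts for
its action on `φ m`. This expresses the sum of one level by that of the level below, as needed for
induction. -/
theorem IsVec.sum_mul_succ (hφ : IsVec (m + 1) E φ) (hE : IsGl (m + 2) E) :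
    ∑ k ∈ Finset.range (m + 2), E (m + 1) k * φ k =
      (E (m + 1) (m + 1) - E m m) * φ (m + 1) +
        ⁅E (m + 1) m, ∑ k ∈ Finset.range (m + 1), E m k * φ k⁆ := by
  simp only [lie_sum, lie_mul_assoc]
  have e : ∀ k ∈ Finset.range (m + 1), ⁅E (m + 1) m, E m k⁆ * φ k + E m k * ⁅E (m + 1) m, φ k⁆ =
      E (m + 1) k * φ k + if k = m then E m m * φ (m + 1) else 0 := by
    intro k hk
    rw [Finset.mem_range] at hk
    rw [hE (by omega) (by omega) (by omega) (by omega), hφ le_rfl (by omega) (by omega),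
      if_pos rfl, if_neg (by omega)]
    rcases eq_or_ne k m with rfl | hkm
    · simp
    · simp [hkm, Ne.symm hkm]
  rw [Finset.sum_congr rfl e, Finset.sum_add_distrib, Finset.sum_ite_eq',
    if_pos (Finset.mem_range.2 (by omega)), Finset.sum_range_succ]
  noncomm_ring

end VectorIdentity

namespace ShiftArray

variable {K : Type*} [CommRing K] [Algebra ℂ K] {eps : ℂ} {L N : ℕ} (D : ShiftArray K eps L N)

/-- The inverse shift of the variable `γ (m + 1) j` as an operator. -/
noncomputable def backShift (m : ℕ) (j : Fin (m + 1)) : Module.End ℂ K := shiftTerm 1 (D.σ (m + 1) j).symm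

variable {D} {m : ℕ} {E : ℕ → ℕ → Module.End ℂ K}

theorem IsGen.lie_eq_zero {n : ℕ} (hG : D.IsGen n E) (hE : IsGl n E) {X : Module.End ℂ K}
    (hd : ∀ k, k < n → ⁅D.diag k, X⁆ = 0) (hu : ∀ k, k + 1 < n → ⁅D.up k, X⁆ = 0)
    (hl : ∀ k, k + 1 < n → ⁅D.down k, X⁆ = 0) {a b : ℕ} (ha : a < n) (hb : b < n) :
    ⁅E a b, X⁆ = 0 :=
  hE.induction (P := fun x => ⁅x, X⁆ = 0) (fun x y hx hy => by rw [lie_lie, hx, hy]; simp)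
    (fun k hk => by rw [hG.diag k hk]; exact hd k hk)
    (fun k hk => by rw [hG.up k hk]; exact hu k hk)
    (fun k hk => by rw [hG.down k hk]; exact hl k hk) ha hb

theorem IsGen.lie_mulLeft_eq_zero {n : ℕ} (hG : D.IsGen n E) (hE : IsGl n E) {g : K}
    (hg : ∀ k, k + 1 < n → ∀ i, D.σ (k + 1) i g = g) {a b : ℕ} (ha : a < n) (hb : b < n) :
    ⁅E a b, LinearMap.mulLeft ℂ g⁆ = 0 :=
  hG.lie_eq_zero hE (fun k _ => D.lie_diag_mulLeft k g)
    (fun k hk => by rw [← lie_skew, D.lie_mulLeft_up_eq_zero (hg k hk), neg_zero])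
    (fun k hk => by rw [← lie_skew, D.lie_mulLeft_down_eq_zero (hg k hk), neg_zero]) ha hb

theorem lie_diag_backShift_eq_zero {k : ℕ} (j : Fin (m + 1)) (hm : m + 1 < L) (hk : k < m) :
    ⁅D.diag k, D.backShift m j⁆ = 0 := by
  rw [diag, backShift, smul_lie, lie_mulLeft_shiftTerm (d := 0), neg_zero]
  · ext; simp
  · rw [add_zero]
    exact D.symm_fixed (D.diagCoeff_fixed hm (by omega) (by omega))

theorem lie_diag_backShift (j : Fin (m + 1)) (hm : m + 1 < L) :
    ⁅D.diag m, D.backShift m j⁆ = D.backShift m j := by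
  rw [diag, backShift, smul_lie, lie_mulLeft_shiftTerm (D.symm_shift (D.diagCoeff_shift j hm)),
    neg_neg, smul_mulLeft_comp D.ne_zero eps _ rfl]

theorem lie_up_backShift_eq_zero {k : ℕ} (j : Fin (m + 1)) (hm : m + 1 < L) (hN : m ≤ N)
    (hk : k + 1 < m) : ⁅D.up k, D.backShift m j⁆ = 0 := by
  have z : ∀ i, ⁅shiftTerm (D.upCoeff k i) (D.σ (k + 1) i).symm, D.backShift m j⁆ = 0 := fun i =>
    lie_shiftTerm_eq_zero (map_one _)
      (D.symm_fixed (D.upCoeff_fixed hm (by omega) (by omega) (by omega))) (D.symm_comm_symm _ _)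
  simp only [up, smul_lie, sum_lie, z, Finset.sum_const_zero, smul_zero]

theorem lie_down_backShift_eq_zero {k : ℕ} (j : Fin (m + 1)) (hm : m + 1 < L) (hN : m < N)
    (hk : k < m) : ⁅D.down k, D.backShift m j⁆ = 0 := by
  have z : ∀ i, ⁅shiftTerm (D.downCoeff k i) (D.σ (k + 1) i), D.backShift m j⁆ = 0 := fun i =>
    lie_shiftTerm_eq_zero (map_one _)
      (D.symm_fixed (D.downCoeff_fixed hm (by omega) (by omega) (by omega))) (D.comm_symm _ _)
  simp only [down, smul_lie, sum_lie, z, Finset.sum_const_zero, smul_zero]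

theorem IsGen.lie_backShift_eq_zero (hG : D.IsGen m E) (hE : IsGl m E) (j : Fin (m + 1))
    (hm : m + 1 < L) (hN : m < N) {a b : ℕ} (ha : a < m) (hb : b < m) :
    ⁅E a b, D.backShift m j⁆ = 0 :=
  hG.lie_eq_zero hE (fun _ hk => lie_diag_backShift_eq_zero j hm hk)
    (fun _ hk => lie_up_backShift_eq_zero j hm hN.le hk)
    (fun _ hk => lie_down_backShift_eq_zero j hm hN (by omega)) ha hb

/-- A bare shift satisfies the same lowest weight conditions as the raising operator, whose
coefficients play no role in them. Unlike the raising operator, it singles out one entry of the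
level and is invertible. -/
theorem IsGen.exists_isVec (hG : D.IsGen (m + 1) E) (hE : IsGl (m + 1) E) (j : Fin (m + 1))
    (hm : m + 1 < L) (hN : m < N) : ∃ φ, φ m = D.backShift m j ∧ IsVec m E φ := by
  refine hE.exists_isVec (fun k hk => ?_) (fun k hk => ?_) (fun k hk => ?_) ?_ ?_
  · rw [hG.diag k (by omega), lie_diag_backShift_eq_zero j hm hk]
  · rw [hG.up k (by omega), lie_up_backShift_eq_zero j hm hN.le hk]
  · rw [hG.down k (by omega), lie_down_backShift_eq_zero j hm hN (by omega)]
  · rw [hG.diag m (by omega), lie_diag_backShift j hm]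
  · rintro k rfl
    rw [hG.up k (by omega)]
    exact D.lie_up_up_shift hN hm j fun i => map_one _

/-- The coefficients of the commutator of a raising operator and a shift of the next level. -/
noncomputable def nextCoeff (D : ShiftArray K eps L N) (j : Fin (m + 2)) (l : Fin (m + 1)) : K :=
  (∏ r ∈ Finset.univ.erase j, (D.γ (m + 1) l - D.γ (m + 2) r - D.half)) * D.a (m + 1) l

/-- The inverse shift of `γ (m + 2) j` raises a single factor of `D.upCoeff m l` by `eps`. The
commutator therefore loses that factor, and `eps` cancels the scalar in `up`. -/
theorem lie_up_backShift (j : Fin (m + 2)) (hm : m + 2 < L) (hN : m + 1 < N) :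
    ⁅D.up m, D.backShift (m + 1) j⁆ = ∑ l, LinearMap.mulLeft ℂ (D.nextCoeff j l) *
      D.backShift m l * D.backShift (m + 1) j := by
  have z : ∀ l, ⁅shiftTerm (D.upCoeff m l) (D.σ (m + 1) l).symm, D.backShift (m + 1) j⁆ =
      -(eps • (LinearMap.mulLeft ℂ (D.nextCoeff j l) *
        D.backShift m l * D.backShift (m + 1) j)) := by
    intro l
    have e : D.upCoeff m l = (D.γ (m + 1) l - D.γ (m + 2) j - D.half) * D.nextCoeff j l := by
      rw [upCoeff, ← Finset.mul_prod_erase _ _ (Finset.mem_univ j), nextCoeff, mul_assoc]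
    have e' : (D.σ (m + 2) j).symm (D.nextCoeff j l) = D.nextCoeff j l := by
      rw [nextCoeff, map_mul, D.symm_fixed (D.inv_fixed hm hN (by omega)), map_prod]
      congr 1
      refine Finset.prod_congr rfl fun r hr => ?_
      rw [map_sub, map_sub, AlgEquiv.commutes, D.symm_fixed (D.other _ _ _ _ hm (by omega)),
        D.symm_fixed (D.same _ _ _ hm (Finset.ne_of_mem_erase hr).symm)]
    ext F
    simp only [backShift, lie_end_apply, shiftTerm_apply, Module.End.mul_apply, one_mul,
      LinearMap.mulLeft_apply, LinearMap.neg_apply, LinearMap.smul_apply, map_mul,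
      e, map_sub, AlgEquiv.commutes, D.symm_shift (D.self _ j hm), e',
      D.symm_fixed (D.other (m + 2) j (m + 1) l hm (by omega)),
      D.symm_comm_symm j l]
    rw [Algebra.smul_def]
    ring
  rw [up, smul_lie, sum_lie]
  simp only [z]
  rw [Finset.sum_neg_distrib, ← Finset.smul_sum, neg_smul, smul_neg, neg_neg, smul_smul,
    one_div_mul_cancel D.ne_zero, one_smul]

theorem nextCoeff_fixed {n : ℕ} {i : Fin n} (j : Fin (m + 2)) (l : Fin (m + 1)) (hm : m + 1 < L)
    (hN : m + 1 < N) (hn : n < m + 1) : D.σ n i (D.nextCoeff j l) = D.nextCoeff j l := by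
  simp only [nextCoeff, map_mul, map_prod, map_sub, AlgEquiv.commutes,
    D.inv_fixed (show n < L by omega) hN hn.ne, D.other n i (m + 1) _ (by omega) (by omega),
    D.other n i (m + 2) _ (by omega) (by omega)]

/-- The characteristic identity for the vector operator generated by a shift. -/
theorem IsGen.sum_mul_eq (hG : D.IsGen (m + 1) E) (hE : IsGl (m + 1) E) (j : Fin (m + 1))
    (hm : m + 1 < L) (hN : m < N) {φ : ℕ → Module.End ℂ K} (hφ : IsVec m E φ)
    (hφm : φ m = D.backShift m j) {a : ℕ} (ha : a ≤ m) :
    ∑ k ∈ Finset.range (m + 1), E a k * φ k =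
      ((1 / eps) • LinearMap.mulLeft ℂ (D.γ (m + 1) j + algebraMap ℂ K (eps * m / 2))) * φ a := by
  refine hφ.sum_mul_eq hE (fun a ha => ?_) ?_ ha
  · rw [lie_smul, hG.lie_mulLeft_eq_zero hE _ (by omega) (by omega), smul_zero]
    intro k hk i
    rw [map_add, AlgEquiv.commutes, D.other _ _ _ _ (by omega) (by omega)]
  clear ha a
  induction m generalizing φ with
  | zero =>
    have e : D.γ 1 j = ∑ j : Fin 1, D.γ 1 j := by
      rw [Fin.sum_univ_one, Fin.fin_one_eq_zero j]
    ext F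
    simp only [hG.diag 0 (by omega), ShiftArray.diag, diagCoeff, zero_add, Finset.range_one,
      Finset.sum_singleton, e]
    simp
  | succ m ih =>
    have hG' : D.IsGen (m + 1) E := hG.mono (by omega)
    have hE' : IsGl (m + 1) E := hE.mono (by omega)
    choose χ hχ hχv using fun l : Fin (m + 1) => hG'.exists_isVec hE' l (by omega) (by omega)
    have hch := fun l => ih hG' hE' l (by omega) (by omega) (hχv l) (hχ l)
    have hφ₀ : φ m = ∑ l, LinearMap.mulLeft ℂ (D.nextCoeff j l) * D.backShift m l *
        D.backShift (m + 1) j := by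
      have e := hφ (show m ≤ m + 1 by omega) le_rfl le_rfl
      rw [if_pos rfl, hφm, hG.up m (by omega)] at e
      rw [← e]
      exact lie_up_backShift j hm hN
    -- The matrix units of the smaller algebra commute with `D.nextCoeff j l` and, for these
    -- indices, with the shift of level `m + 2`. They act only on the middle factor, which runs
    -- through the vector operator `χ l`.
    have hφk : ∀ k, k ≤ m → φ k = ∑ l, LinearMap.mulLeft ℂ (D.nextCoeff j l) * χ l k *
        D.backShift (m + 1) j := by
      intro k hk
      have e := hφ (show k ≤ m + 1 by omega) (show m ≤ m + 1 by omega) (show m ≤ m + 1 by omega)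
      rw [if_pos rfl] at e
      rw [← e, hφ₀, lie_sum]
      refine Finset.sum_congr rfl fun l _ => ?_
      rw [lie_mul_assoc, lie_mul_assoc, hG'.lie_mulLeft_eq_zero hE'
        (fun k hk i => nextCoeff_fixed j l (by omega) hN (by omega)) (by omega) (by omega),
        (hG.mono (by omega)).lie_backShift_eq_zero hE' j hm hN (by omega) (by omega), ← hχ l,
        hχv l hk le_rfl le_rfl, if_pos rfl]
      simp
    have hW : ∑ k ∈ Finset.range (m + 1), E m k * φ k = (1 / eps) • ((∑ l, shiftTerm
        (D.nextCoeff j l * (D.γ (m + 1) l + algebraMap ℂ K (eps * m / 2))) (D.σ (m + 1) l).symm) *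
        D.backShift (m + 1) j) := by
      rw [Finset.sum_congr rfl fun k hk => by rw [hφk k (by simpa [Nat.lt_succ_iff] using hk)]]
      simp only [Finset.mul_sum]
      rw [Finset.sum_comm, Finset.sum_mul, Finset.smul_sum]
      refine Finset.sum_congr rfl fun l _ => ?_
      have c : ∀ k, k ≤ m → E m k * (LinearMap.mulLeft ℂ (D.nextCoeff j l) * χ l k *
          D.backShift (m + 1) j) = LinearMap.mulLeft ℂ (D.nextCoeff j l) * (E m k * χ l k) *
          D.backShift (m + 1) j := by
        intro k hk
        have z := hG'.lie_mulLeft_eq_zero hE' (g := D.nextCoeff j l)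
          (fun k hk i => nextCoeff_fixed j l (by omega) hN (by omega)) (show m < m + 1 by omega)
          (show k < m + 1 by omega)
        rw [LieRing.of_associative_ring_bracket, sub_eq_zero] at z
        rw [← mul_assoc, ← mul_assoc, z]
        noncomm_ring
      rw [Finset.sum_congr rfl fun k hk => c k (by simpa [Nat.lt_succ_iff] using hk),
        ← Finset.sum_mul, ← Finset.mul_sum, hch l, hχ l]
      ext F
      simp [backShift, mul_assoc]
    rw [hφ.sum_mul_succ hE, hW, hφm, hG.diag m (by omega), hG.diag (m + 1) (by omega),
      hG.down m (by omega), lie_smul, lie_mul_assoc,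
      lie_down_backShift_eq_zero (D := D) (k := m) j hm hN (by omega), mul_zero, add_zero]
    -- By the induction hypothesis the sum in `hW` is, up to a scalar and the outer shift, a raising
    -- operator whose factor with `γ (m + 2) j` is replaced by `γ (m + 1) l + eps * m / 2`. That is
    -- the factor with `γ (m + 2) j` set to `-eps * (m + 1) / 2`, because half a step is subtracted
    -- in it. So `lie_lower_raise` gives the bracket with the lowering operator.
    have key := (D.shiftGroup (show m + 1 < N by omega)).lie_lower_raise
      (u := Function.update (D.γ (m + 2)) j (-algebraMap ℂ K (eps * (m + 1) / 2))) (q := D.γ m)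
      (x := D.half) (w := algebraMap ℂ K (1 / eps)) D.algebraMap_eq_half_add
      (fun i => AlgEquiv.commutes _ _)
      (by rw [← map_mul, mul_one_div_cancel D.ne_zero, map_one])
      (by simp; ring)
      (fun i r => by
        rcases eq_or_ne r j with rfl | hr
        · simp
        · rw [Function.update_of_ne hr]
          exact D.other _ _ _ _ (by omega) (by omega))
      (fun i r => D.other _ _ _ _ (by omega) (by omega))
    have hu : ∀ l, (∏ r, (D.γ (m + 1) l - Function.update (D.γ (m + 2)) j
        (-algebraMap ℂ K (eps * (m + 1) / 2)) r - D.half)) * D.a (m + 1) l =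
        D.nextCoeff j l * (D.γ (m + 1) l + algebraMap ℂ K (eps * m / 2)) := by
      intro l
      have h : algebraMap ℂ K (eps * (m + 1) / 2) = algebraMap ℂ K (eps * m / 2) + D.half := by
        rw [← map_add]
        congr 1
        ring
      rw [← Finset.mul_prod_erase _ _ (Finset.mem_univ j), Function.update_self, nextCoeff,
        Finset.prod_congr rfl fun r hr => by
          rw [Function.update_of_ne (Finset.ne_of_mem_erase hr)], h]
      ring
    have hs : ∑ r, Function.update (D.γ (m + 2)) j (-algebraMap ℂ K (eps * (m + 1) / 2)) r =
        ∑ r, D.γ (m + 2) r - D.γ (m + 2) j - algebraMap ℂ K (eps * (m + 1) / 2) := by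
      rw [← Finset.add_sum_erase _ _ (Finset.mem_univ j), Function.update_self,
        ← Finset.add_sum_erase _ (D.γ (m + 2)) (Finset.mem_univ j),
        Finset.sum_congr rfl fun r hr => by
          rw [Function.update_of_ne (Finset.ne_of_mem_erase hr)]]
      ring
    simp only [hu, hs] at key
    have hd : ⁅D.down m, ∑ l, shiftTerm (D.nextCoeff j l * (D.γ (m + 1) l +
        algebraMap ℂ K (eps * m / 2))) (D.σ (m + 1) l).symm⁆ = LinearMap.mulLeft ℂ
        (2 * ∑ i, D.γ (m + 1) i - (∑ r, D.γ (m + 2) r - D.γ (m + 2) j -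
          algebraMap ℂ K (eps * (m + 1) / 2)) - ∑ r, D.γ m r) := by
      rw [ShiftArray.down, smul_lie]
      refine (congrArg ((1 / eps) • ·) key).trans ?_
      ext F
      simp only [LinearMap.smul_apply, LinearMap.mulLeft_apply, ← Algebra.smul_def eps]
      rw [smul_mul_assoc, smul_smul, one_div_mul_cancel D.ne_zero, one_smul]
    rw [hd]
    ext F
    simp only [ShiftArray.diag, diagCoeff, LinearMap.add_apply, LinearMap.sub_apply, LinearMap.smul_apply,
      Module.End.mul_apply, LinearMap.mulLeft_apply]
    rw [← smul_sub, ← smul_add]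
    push_cast
    congr 1
    ring

end ShiftArray

/-! ### Column determinants with entries in `𝔤𝔩(n)` -/

section ColumnDeterminant

theorem prod_ofFn_four_term {A : Type*} [Ring A] {n k : ℕ} (hk : k + 1 < n) {f₁ f₂ f₃ f₄ : Fin n → A}
    (h₂ : ∀ i : Fin n, i.1 ≠ k → i.1 ≠ k + 1 → f₂ i = f₁ i)
    (h₃ : ∀ i : Fin n, i.1 ≠ k → i.1 ≠ k + 1 → f₃ i = f₁ i)
    (h₄ : ∀ i : Fin n, i.1 ≠ k → i.1 ≠ k + 1 → f₄ i = f₁ i)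
    (h : f₁ ⟨k, by omega⟩ * f₁ ⟨k + 1, hk⟩ + f₂ ⟨k, by omega⟩ * f₂ ⟨k + 1, hk⟩ =
      f₃ ⟨k, by omega⟩ * f₃ ⟨k + 1, hk⟩ + f₄ ⟨k, by omega⟩ * f₄ ⟨k + 1, hk⟩) :
    (List.ofFn f₁).prod + (List.ofFn f₂).prod = (List.ofFn f₃).prod + (List.ofFn f₄).prod := by
  induction k generalizing n with
  | zero =>
    obtain ⟨n, rfl⟩ : ∃ m, n = m + 2 := ⟨n - 2, by omega⟩
    simp only [List.ofFn_succ, List.prod_cons, ← mul_assoc]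
    have e : ∀ {f : Fin (n + 2) → A}, (∀ i : Fin (n + 2), i.1 ≠ 0 → i.1 ≠ 0 + 1 → f i = f₁ i) →
        (fun i : Fin n => f i.succ.succ) = fun i => f₁ i.succ.succ := fun hf =>
      funext fun i => hf _ (by simp) (by simp)
    rw [e h₂, e h₃, e h₄, ← add_mul, ← add_mul]
    exact congrArg (· * _) h
  | succ k ih =>
    obtain ⟨n, rfl⟩ : ∃ m, n = m + 1 := ⟨n - 1, by omega⟩
    simp only [List.ofFn_succ, List.prod_cons]
    rw [h₂ 0 (by simp) (by simp), h₃ 0 (by simp) (by simp), h₄ 0 (by simp) (by simp), ← mul_add,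
      ← mul_add, ih (n := n) (by omega) (f₁ := fun i => f₁ i.succ)]
    · exact fun i hi hi' => h₂ _ (by simpa using hi) (by simpa using hi')
    · exact fun i hi hi' => h₃ _ (by simpa using hi) (by simpa using hi')
    · exact fun i hi hi' => h₄ _ (by simpa using hi) (by simpa using hi')
    · exact h

variable {A : Type*} [Ring A] [Algebra ℂ A]

/-- The terms linear in `eps` coming from `u + eps` in the second factor compensate the commutators
of the matrix units. -/
theorem adjacent_columns_aux {u P Q R S : A} {eps d₁ d₂ d₃ d₄ : ℂ} (uP : u * P = P * u)
    (uQ : u * Q = Q * u) (uR : u * R = R * u) (uS : u * S = S * u)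
    (hPQ : P * Q - Q * P = d₃ • S - d₄ • R) (hSR : S * R - R * S = d₂ • P - d₁ • Q) :
    (d₁ • u - eps • P) * (d₂ • (u + algebraMap ℂ A eps) - eps • Q) +
      (d₄ • u - eps • S) * (d₃ • (u + algebraMap ℂ A eps) - eps • R) =
    (d₃ • u - eps • R) * (d₄ • (u + algebraMap ℂ A eps) - eps • S) +
      (d₂ • u - eps • Q) * (d₁ • (u + algebraMap ℂ A eps) - eps • P) := by
  rw [sub_eq_iff_eq_add] at hPQ hSR
  simp only [Algebra.algebraMap_eq_smul_one, mul_sub, sub_mul, mul_add, smul_mul_assoc,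
    mul_smul_comm, smul_sub, smul_add, mul_one, uP, uQ, uR, uS, hPQ, hSR]
  module

/-- The entry in row `i` and column `j` of the factor number `k` of a column determinant. -/
noncomputable def colEntry (eps : ℂ) (E : ℕ → ℕ → A) {n : ℕ} (x : A) (k i j : Fin n) : A :=
  (if i = j then x - algebraMap ℂ A (eps * (((n : ℂ) - 2 * ((k : ℕ) + 1 : ℂ) + 1) / 2)) else 0) -
    eps • E i j

/-- The column determinant with the columns `c`. -/
noncomputable def colDet (eps : ℂ) (E : ℕ → ℕ → A) {n : ℕ} (x : A) (c : Fin n → Fin n) : A :=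
  ∑ p : Equiv.Perm (Fin n), (Equiv.Perm.sign p : ℤ) •
    (List.ofFn fun k => colEntry eps E x k (p k) (c k)).prod

variable {eps : ℂ} {E : ℕ → ℕ → A} {x : A}

/-- Consecutive factors differ by `eps` because `ρ_k - ρ_{k+1} = 1`. With exactly this step, the
product of two neighbouring factors, symmetrised in the columns, is symmetric in the rows. -/
theorem colEntry_adjacent {n : ℕ} (hE : IsGl n E)
    (hx : ∀ a b, a < n → b < n → x * E a b = E a b * x) {k : ℕ} (hk : k + 1 < n)
    (i j a b : Fin n) :
    colEntry eps E x ⟨k, by omega⟩ i a * colEntry eps E x ⟨k + 1, hk⟩ j b +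
      colEntry eps E x ⟨k, by omega⟩ i b * colEntry eps E x ⟨k + 1, hk⟩ j a =
    colEntry eps E x ⟨k, by omega⟩ j a * colEntry eps E x ⟨k + 1, hk⟩ i b +
      colEntry eps E x ⟨k, by omega⟩ j b * colEntry eps E x ⟨k + 1, hk⟩ i a := by
  set u : A := x - algebraMap ℂ A (eps * (((n : ℂ) - 2 * ((k : ℕ) + 1 : ℂ) + 1) / 2)) with hu
  have e₁ : ∀ i j : Fin n, colEntry eps E x ⟨k, by omega⟩ i j =
      (if (i : ℕ) = j then 1 else 0 : ℂ) • u - eps • E i j := by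
    intro i j
    simp only [colEntry, hu, Fin.ext_iff]
    split_ifs <;> simp
  have e₂ : ∀ i j : Fin n, colEntry eps E x ⟨k + 1, hk⟩ i j =
      (if (i : ℕ) = j then 1 else 0 : ℂ) • (u + algebraMap ℂ A eps) - eps • E i j := by
    intro i j
    simp only [colEntry, Fin.ext_iff]
    have h : x - algebraMap ℂ A (eps * (((n : ℂ) - 2 * (((k + 1 : ℕ) : ℂ) + 1) + 1) / 2)) =
        u + algebraMap ℂ A eps := by
      have h : (eps * (((n : ℂ) - 2 * ((k : ℕ) + 1 : ℂ) + 1) / 2)) =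
          eps * (((n : ℂ) - 2 * (((k + 1 : ℕ) : ℂ) + 1) + 1) / 2) + eps := by
        push_cast
        ring
      rw [hu, h, map_add]
      abel
    rw [h]
    split_ifs <;> simp
  have ux : ∀ a b : Fin n, u * E a b = E a b * u := fun a b => by
    rw [hu, sub_mul, mul_sub, hx a b a.2 b.2, Algebra.commutes]
  have br : ∀ a b c d : Fin n, E a b * E c d - E c d * E a b =
      (if (b : ℕ) = c then 1 else 0 : ℂ) • E a d - (if (a : ℕ) = d then 1 else 0 : ℂ) • E c b := by
    intro a b c d
    have h := hE a.2 b.2 c.2 d.2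
    rw [LieRing.of_associative_ring_bracket] at h
    rw [h]
    split_ifs <;> simp
  simp only [e₁, e₂]
  refine adjacent_columns_aux (ux _ _) (ux _ _) (ux _ _) (ux _ _) ?_ ?_
  · rw [br]
    simp only [eq_comm]
  · rw [br]
    simp only [eq_comm]

/-- Composing the summation permutation with the transposition changes its sign and exchanges two
neighbouring rows. By `colEntry_adjacent` the sum of the two determinants is invariant under that
exchange, so it equals its own negative. -/
theorem colDet_swap {n : ℕ} (hE : IsGl n E) (hx : ∀ a b, a < n → b < n → x * E a b = E a b * x)
    {k : ℕ} (hk : k + 1 < n) (c : Fin n → Fin n) :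
    colDet eps E x (c ∘ Equiv.swap ⟨k, by omega⟩ ⟨k + 1, hk⟩) = -colDet eps E x c := by
  set s : Equiv.Perm (Fin n) := Equiv.swap ⟨k, by omega⟩ ⟨k + 1, hk⟩ with hs
  have sne : (⟨k, by omega⟩ : Fin n) ≠ ⟨k + 1, hk⟩ := by simp
  have r : ∀ c : Fin n → Fin n, colDet eps E x c = -∑ p : Equiv.Perm (Fin n),
      (Equiv.Perm.sign p : ℤ) • (List.ofFn fun k => colEntry eps E x k ((p * s) k) (c k)).prod := by
    intro c
    rw [colDet, ← Equiv.sum_comp (Equiv.mulRight s), ← Finset.sum_neg_distrib]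
    refine Finset.sum_congr rfl fun p _ => ?_
    rw [Equiv.coe_mulRight, Equiv.Perm.sign_mul, hs, Equiv.Perm.sign_swap sne]
    simp
  have sf : ∀ i : Fin n, i.1 ≠ k → i.1 ≠ k + 1 → s i = i := fun i h₁ h₂ =>
    Equiv.swap_apply_of_ne_of_ne (fun e => h₁ (congrArg Fin.val e)) fun e => h₂ (congrArg Fin.val e)
  have s₁ : s ⟨k, by omega⟩ = ⟨k + 1, hk⟩ := Equiv.swap_apply_left _ _
  have s₂ : s ⟨k + 1, hk⟩ = ⟨k, by omega⟩ := Equiv.swap_apply_right _ _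
  have key : colDet eps E x c + colDet eps E x (c ∘ s) =
      -(colDet eps E x c + colDet eps E x (c ∘ s)) := by
    conv_rhs => rw [r c, r (c ∘ s), ← neg_add, neg_neg]
    rw [colDet, colDet, ← Finset.sum_add_distrib, ← Finset.sum_add_distrib]
    refine Finset.sum_congr rfl fun p _ => ?_
    rw [← smul_add, ← smul_add]
    congr 1
    refine prod_ofFn_four_term hk (fun i h₁ h₂ => ?_) (fun i h₁ h₂ => ?_) (fun i h₁ h₂ => ?_) ?_
    · simp only [Function.comp_apply, sf i h₁ h₂]
    · simp only [Equiv.Perm.mul_apply, sf i h₁ h₂]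
    · simp only [Function.comp_apply, Equiv.Perm.mul_apply, sf i h₁ h₂]
    · simp only [Function.comp_apply, Equiv.Perm.mul_apply, s₁, s₂]
      exact colEntry_adjacent hE hx hk _ _ _ _
  have t : (2 : ℂ) • (colDet eps E x c + colDet eps E x (c ∘ s)) = 0 := by
    rw [two_smul]
    nth_rewrite 1 [key]
    exact neg_add_cancel _
  exact eq_neg_of_add_eq_zero_right ((smul_eq_zero.1 t).resolve_left two_ne_zero)

theorem colDet_comp_perm {n : ℕ} (hE : IsGl n E)
    (hx : ∀ a b, a < n → b < n → x * E a b = E a b * x) (π : Equiv.Perm (Fin n))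
    (c : Fin n → Fin n) : colDet eps E x (c ∘ π) = (Equiv.Perm.sign π : ℤ) • colDet eps E x c := by
  match n with
  | 0 => rw [Subsingleton.elim π 1]; simp
  | n + 1 =>
    have hπ : π ∈ Submonoid.closure (Set.range fun i : Fin n => Equiv.swap i.castSucc i.succ) := by
      rw [Equiv.Perm.mclosure_swap_castSucc_succ]; trivial
    induction hπ using Submonoid.closure_induction generalizing c with
    | mem y hy =>
      obtain ⟨i, rfl⟩ := hy
      dsimp only
      rw [Equiv.Perm.sign_swap (Fin.castSucc_lt_succ).ne]
      rw [Units.val_neg, Units.val_one, neg_one_smul]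
      exact colDet_swap hE hx (k := i) (by omega) c
    | one => simp
    | mul y z _ _ hy hz =>
      rw [Equiv.Perm.coe_mul, ← Function.comp_assoc, hz, hy, smul_smul, Equiv.Perm.sign_mul]
      push_cast
      rw [mul_comm]

theorem colDet_eq_zero {n : ℕ} (hE : IsGl n E)
    (hx : ∀ a b, a < n → b < n → x * E a b = E a b * x) {c : Fin n → Fin n} {i j : Fin n}
    (hij : i ≠ j) (hc : c i = c j) : colDet eps E x c = 0 := by
  have h := colDet_comp_perm (eps := eps) hE hx (Equiv.swap i j) c
  have e : c ∘ Equiv.swap i j = c := by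
    funext l
    rcases eq_or_ne l i with rfl | hi
    · simp [hc]
    rcases eq_or_ne l j with rfl | hj
    · simp [hc]
    · simp [Equiv.swap_apply_of_ne_of_ne hi hj]
  rw [e, Equiv.Perm.sign_swap hij] at h
  have t : (2 : ℂ) • colDet eps E x c = 0 := by
    rw [two_smul]
    nth_rewrite 1 [h]
    simp
  exact (smul_eq_zero.1 t).resolve_left two_ne_zero

/-- A column determinant annihilates the last component of a vector annihilated by the last
factor. -/
theorem colDet_mul_eq_zero {n : ℕ} (hE : IsGl (n + 1) E)
    (hx : ∀ a b, a < n + 1 → b < n + 1 → x * E a b = E a b * x) {φ : ℕ → A}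
    (h : ∀ i, i ≤ n → eps • ∑ k ∈ Finset.range (n + 1), E i k * φ k =
      (x + algebraMap ℂ A (eps * n / 2)) * φ i) :
    colDet eps E x (id : Fin (n + 1) → Fin (n + 1)) * φ n = 0 := by
  have h' : ∀ i : Fin (n + 1), ∑ k : Fin (n + 1), colEntry eps E x (Fin.last n) i k * φ k = 0 := by
    intro i
    have e := h i (by omega)
    rw [Finset.sum_range] at e
    simp only [colEntry, sub_mul, Finset.sum_sub_distrib, ite_mul, zero_mul, smul_mul_assoc]
    rw [← Finset.smul_sum, e, Finset.sum_ite_eq, if_pos (Finset.mem_univ _), ← sub_mul]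
    -- The last of `n + 1` factors has `ρ = -n / 2`; hence the constant `eps * n / 2` in the
    -- hypothesis.
    have z : x - algebraMap ℂ A (eps * ((((n + 1 : ℕ) : ℂ) - 2 * (((Fin.last n : Fin (n + 1)) : ℕ) + 1)
        + 1) / 2)) - (x + algebraMap ℂ A (eps * n / 2)) = 0 := by
      have h : eps * ((((n + 1 : ℕ) : ℂ) - 2 * (((Fin.last n : Fin (n + 1)) : ℕ) + 1) + 1) / 2) =
          -(eps * n / 2) := by
        rw [Fin.val_last]
        push_cast
        ring
      rw [h, map_neg]
      abel
    rw [← sub_mul, z, zero_mul]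
  have e : ∀ k : Fin (n + 1), colDet eps E x (Function.update id (Fin.last n) k) * φ k =
      ∑ p : Equiv.Perm (Fin (n + 1)), (Equiv.Perm.sign p : ℤ) •
        ((List.ofFn fun l : Fin n => colEntry eps E x l.castSucc (p l.castSucc) l.castSucc).prod *
          (colEntry eps E x (Fin.last n) (p (Fin.last n)) k * φ k)) := by
    intro k
    rw [colDet, Finset.sum_mul]
    refine Finset.sum_congr rfl fun p _ => ?_
    rw [smul_mul_assoc, List.ofFn_succ', List.concat_eq_append, List.prod_append, List.prod_singleton,
      Function.update_self, mul_assoc]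
    congr 4
    funext l
    rw [Function.update_of_ne (Fin.castSucc_lt_last l).ne, id]
  -- The last column is replaced by column `k` and the results are summed against `φ k`. The sum
  -- vanishes by `h'`; all terms but the one with the original last column vanish because a column
  -- is repeated.
  have s : ∑ k : Fin (n + 1), colDet eps E x (Function.update id (Fin.last n) k) * φ k = 0 := by
    simp only [e]
    rw [Finset.sum_comm]
    refine Finset.sum_eq_zero fun p _ => ?_
    rw [← Finset.smul_sum, ← Finset.mul_sum, h', mul_zero, smul_zero]
  rw [Finset.sum_eq_single (Fin.last n)] at s
  · rwa [show Function.update id (Fin.last n) (Fin.last n) = (id : Fin (n + 1) → Fin (n + 1)) from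
      Function.update_eq_self _ _, Fin.val_last] at s
  · intro k _ hk
    rw [colDet_eq_zero hE hx hk, zero_mul]
    rw [Function.update_of_ne hk, Function.update_self, id]
  · simp

end ColumnDeterminant

/-! ### The column determinant in the Gelfand-Zetlin representation -/

section ColumnDeterminantPolynomial

open Polynomial

theorem Polynomial.commute_coeff {A : Type*} [Ring A] {x : A} {p : A[X]} (h : Commute (C x) p) (k : ℕ) :
    Commute x (p.coeff k) := by
  have := congrArg (fun q => q.coeff k) h.eq
  simp only [coeff_C_mul, coeff_mul_C] at this
  exact this

variable {A : Type*} [Ring A] [Algebra ℂ A] {eps : ℂ} {E : ℕ → ℕ → A} {n : ℕ}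

/-- The entries of the column determinant as polynomials in the parameter. -/
noncomputable abbrev polyEntry (eps : ℂ) (E : ℕ → ℕ → A) (k i j : Fin n) : A[X] :=
  colEntry eps (fun a b => C (E a b)) X k i j

/-- The column determinant as a polynomial in the parameter. -/
noncomputable abbrev polyDet (eps : ℂ) (E : ℕ → ℕ → A) (n : ℕ) : A[X] :=
  colDet eps (fun a b => C (E a b)) X (id : Fin n → Fin n)

theorem commute_polyEntry {x : A} (hx : ∀ a b, a < n → b < n → x * E a b = E a b * x)
    (k i j : Fin n) : Commute (C x) (polyEntry eps E k i j) := by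
  refine Commute.sub_right ?_ (Commute.smul_right ?_ _)
  · split_ifs
    · exact ((commute_X (C x)).symm).sub_right (Algebra.commutes _ _).symm
    · exact Commute.zero_right _
  · rw [Commute, SemiconjBy, ← C_mul, ← C_mul, hx _ _ i.2 j.2]

theorem commute_polyDet {x : A} (hx : ∀ a b, a < n → b < n → x * E a b = E a b * x) :
    Commute (C x) (polyDet eps E n) := by
  refine Commute.sum_right _ _ _ fun p _ => Commute.smul_right ?_ _
  refine Commute.list_prod_right _ _ fun q hq => ?_
  obtain ⟨k, rfl⟩ := List.mem_ofFn.1 hq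
  exact commute_polyEntry hx _ _ _

/-- Evaluation of polynomials with noncommuting coefficients respects these products because `x`
commutes with the coefficients of all factors. -/
theorem eval_polyDet {x : A} (hx : ∀ a b, a < n → b < n → x * E a b = E a b * x) :
    (polyDet eps E n).eval x = colDet eps E x (id : Fin n → Fin n) := by
  rw [polyDet, colDet, colDet, eval_finsetSum]
  refine Finset.sum_congr rfl fun p _ => ?_
  rw [eval_smul]
  congr 1
  rw [eval, eval₂_list_prod_noncomm]
  · rw [List.map_ofFn]
    congr 2
    funext k
    simp only [Function.comp_apply, colEntry]
    change eval x _ = _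
    rw [eval_sub, eval_smul, eval_C]
    split_ifs
    · rw [eval_sub, eval_X, Polynomial.algebraMap_apply, eval_C]
    · rw [eval_zero]
  · intro q hq k
    obtain ⟨l, rfl⟩ := List.mem_ofFn.1 hq
    exact (Polynomial.commute_coeff (commute_polyEntry hx _ _ _) k).symm

theorem natDegree_polyEntry_le (k i j : Fin n) : (polyEntry eps E k i j).natDegree ≤ 1 := by
  refine (natDegree_sub_le _ _).trans (max_le ?_ ((natDegree_smul_le _ _).trans (by simp)))
  split_ifs
  · rw [Polynomial.algebraMap_apply]
    exact natDegree_X_sub_C_le _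
  · simp

theorem coeff_one_polyEntry (k i j : Fin n) :
    (polyEntry eps E k i j).coeff 1 = if i = j then 1 else 0 := by
  simp only [polyEntry, colEntry, coeff_sub, coeff_smul, coeff_C_succ, smul_zero, sub_zero]
  split_ifs
  · rw [Polynomial.algebraMap_apply, coeff_sub, coeff_X_one, coeff_C_succ, sub_zero]
  · rw [coeff_zero]

theorem natDegree_polyDet_le : (polyDet eps E n).natDegree ≤ n := by
  refine natDegree_sum_le_of_forall_le _ _ fun p _ => (natDegree_smul_le _ _).trans ?_
  refine (natDegree_list_prod_le _).trans ?_
  refine (List.sum_le_card_nsmul _ 1 fun d hd => ?_).trans (by simp)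
  obtain ⟨q, hq, rfl⟩ := List.mem_map.1 hd
  obtain ⟨l, rfl⟩ := List.mem_ofFn.1 hq
  exact natDegree_polyEntry_le _ _ _

/-- The parameter occurs only in diagonal entries, so only the identity permutation reaches the top
degree. -/
theorem coeff_polyDet : (polyDet eps E n).coeff n = 1 := by
  have h : ∀ p : Equiv.Perm (Fin n), (List.ofFn fun k => polyEntry eps E k (p k) k).prod.coeff n =
      if p = 1 then 1 else 0 := by
    intro p
    have e := coeff_list_prod_of_natDegree_le (List.ofFn fun k => polyEntry eps E k (p k) k) 1
      fun q hq => by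
        obtain ⟨l, rfl⟩ := List.mem_ofFn.1 hq
        exact natDegree_polyEntry_le _ _ _
    rw [List.length_ofFn, mul_one, List.map_ofFn] at e
    rw [e]
    have e' : ((fun q : A[X] => q.coeff 1) ∘ fun k => polyEntry eps E k (p k) k) =
        fun k => if p k = k then 1 else 0 := funext fun k => coeff_one_polyEntry _ _ _
    rw [e']
    split_ifs with hp
    · subst hp
      simp
    · obtain ⟨k, hk⟩ : ∃ k, p k ≠ k := by
        by_contra! hk
        exact hp (Equiv.ext hk)
      exact List.prod_eq_zero (List.mem_ofFn.2 ⟨k, if_neg hk⟩)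
  rw [polyDet, colDet, finsetSum_coeff, Finset.sum_eq_single 1]
  · rw [coeff_smul]
    have := h 1
    simp only [polyEntry, if_true] at this
    simp only [id, this]
    simp
  · intro p _ hp
    have := h p
    rw [if_neg hp] at this
    rw [coeff_smul]
    simp only [polyEntry] at this
    simp only [id, this, smul_zero]
  · simp

end ColumnDeterminantPolynomial

namespace ShiftArray

open Polynomial

variable {K : Type*} [CommRing K] [Algebra ℂ K] {eps : ℂ} {L N : ℕ} {D : ShiftArray K eps L N}
  {m : ℕ} {E : ℕ → ℕ → Module.End ℂ K}

theorem IsGen.mul_comm_mulLeft (hG : D.IsGen (m + 1) E) (hE : IsGl (m + 1) E) (hm : m + 1 < L)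
    (j : Fin (m + 1)) : ∀ a b, a < m + 1 → b < m + 1 →
      LinearMap.mulLeft ℂ (D.γ (m + 1) j) * E a b = E a b * LinearMap.mulLeft ℂ (D.γ (m + 1) j) := by
  intro a b ha hb
  have z := hG.lie_mulLeft_eq_zero hE (g := D.γ (m + 1) j)
    (fun k hk i => D.other _ _ _ _ (by omega) (by omega)) ha hb
  rw [LieRing.of_associative_ring_bracket, sub_eq_zero] at z
  exact z.symm

theorem IsGen.colDet_root (hG : D.IsGen (m + 1) E) (hE : IsGl (m + 1) E) (hm : m + 1 < L)
    (hN : m < N) (j : Fin (m + 1)) : colDet eps E (LinearMap.mulLeft ℂ (D.γ (m + 1) j))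
      (id : Fin (m + 1) → Fin (m + 1)) = 0 := by
  obtain ⟨φ, hφm, hφ⟩ := hG.exists_isVec hE j hm hN
  have h := colDet_mul_eq_zero (eps := eps) hE (hG.mul_comm_mulLeft hE hm j) (φ := φ)
    fun i hi => by
      rw [hG.sum_mul_eq hE j hm hN hφ hφm hi, smul_mul_assoc, smul_smul,
        mul_one_div_cancel D.ne_zero, one_smul]
      congr 1
      ext F
      simp [Algebra.smul_def, add_mul]
  rw [hφm] at h
  ext F
  -- Evaluating at the shifted `F` cancels the inverse shift.
  have e := LinearMap.congr_fun h (D.σ (m + 1) j F)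
  rw [Module.End.mul_apply, backShift, shiftTerm_apply, AlgEquiv.symm_apply_apply, one_mul] at e
  exact e

/-- The column determinant of level `m + 1` acts as multiplication by `∏ j, (t - γ (m + 1) j)`. -/
theorem IsGen.colDet_apply (hG : D.IsGen (m + 1) E) (hE : IsGl (m + 1) E) (hm : m + 1 < L)
    (hN : m < N)
    (hreg : ∀ i j : Fin (m + 1), i ≠ j → ∀ x, (D.γ (m + 1) i - D.γ (m + 1) j) * x = 0 → x = 0)
    (t : ℂ) (F : K) :
    colDet eps E (algebraMap ℂ (Module.End ℂ K) t) (id : Fin (m + 1) → Fin (m + 1)) F =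
      (∏ j, (algebraMap ℂ K t - D.γ (m + 1) j)) * F := by
  nontriviality K
  set P := polyDet eps E (m + 1) with hP
  -- Applying the operator coefficients of the determinant to `F` gives a polynomial over the
  -- commutative ring `K`, to which root counting applies. By `ev`, its values at elements commuting
  -- with the matrix units are those of the determinant on `F`.
  set p : K[X] := ∑ k ∈ Finset.range (m + 2), C (P.coeff k F) * X ^ k with hp
  have ev : ∀ y : K, (∀ a b, a < m + 1 → b < m + 1 → LinearMap.mulLeft ℂ y * E a b =
      E a b * LinearMap.mulLeft ℂ y) → p.eval y = colDet eps E (LinearMap.mulLeft ℂ y)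
        (id : Fin (m + 1) → Fin (m + 1)) F := by
    intro y hy
    rw [← eval_polyDet hy, ← hP, eval_eq_sum_range' (n := m + 2)
      (Nat.lt_succ_of_le natDegree_polyDet_le), hp, eval_finsetSum, LinearMap.sum_apply]
    refine Finset.sum_congr rfl fun k _ => ?_
    have c := (Polynomial.commute_coeff (commute_polyDet (eps := eps) hy) k).pow_left k
    rw [← hP] at c
    rw [← c.eq, Module.End.mul_apply, LinearMap.pow_mulLeft, LinearMap.mulLeft_apply, eval_mul,
      eval_C, eval_pow, eval_X, mul_comm]
  have key : p - C F * ∏ j, (X - C (D.γ (m + 1) j)) = 0 := by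
    refine eq_zero_of_degree_lt_of_eval_eq_zero (y := D.γ (m + 1)) (s := Finset.univ)
      (fun i _ j _ => hreg i j) ?_ fun i _ => ?_
    · rw [Finset.card_univ, Fintype.card_fin, degree_lt_iff_coeff_zero]
      intro k hk
      have mo : (∏ j, (X - C (D.γ (m + 1) j))).Monic :=
        monic_prod_of_monic _ _ fun r _ => monic_X_sub_C _
      have nd : (∏ j, (X - C (D.γ (m + 1) j))).natDegree = m + 1 := by
        rw [natDegree_prod_of_monic _ _ fun r _ => monic_X_sub_C _]; simp
      rw [coeff_sub, coeff_C_mul, hp, finsetSum_coeff]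
      simp only [coeff_C_mul_X_pow]
      rw [Finset.sum_ite_eq, sub_eq_zero]
      rcases hk.eq_or_lt with rfl | hk
      · rw [if_pos (by simp), hP, coeff_polyDet]
        have mc : (∏ j, (X - C (D.γ (m + 1) j))).coeff (m + 1) = 1 := by
          have := mo.coeff_natDegree
          rwa [nd] at this
        rw [mc, mul_one, Module.End.one_apply]
      · rw [if_neg (by simp; omega), coeff_eq_zero_of_natDegree_lt (by omega), mul_zero]
    · rw [eval_sub, ev _ (hG.mul_comm_mulLeft hE hm i), hG.colDet_root hE hm hN i, eval_mul,
        eval_prod, Finset.prod_eq_zero (Finset.mem_univ i) (by simp)]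
      simp
  have e : algebraMap ℂ (Module.End ℂ K) t = LinearMap.mulLeft ℂ (algebraMap ℂ K t) := by
    ext F
    simp [Algebra.smul_def]
  rw [e, ← ev _ fun a b _ _ => by rw [← e, Algebra.commutes], sub_eq_zero.1 key, eval_mul, eval_C,
    eval_prod, mul_comm]
  simp

end ShiftArray

/-! ### The last level: adjoining generic entries -/

section Translation

variable {R : Type*} [CommRing R] {ι : Type*} [DecidableEq ι]

/-- The substitution `X i ↦ X i + c`. -/
noncomputable def MvPolynomial.addVar (i : ι) (c : MvPolynomial ι R) :
    MvPolynomial ι R →ₐ[R] MvPolynomial ι R :=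
  aeval (Function.update X i (X i + c))

namespace MvPolynomial

theorem addVar_X_self (i : ι) (c : MvPolynomial ι R) : addVar i c (X i) = X i + c := by
  rw [addVar, aeval_X, Function.update_self]

theorem addVar_X_of_ne {i j : ι} (h : j ≠ i) (c : MvPolynomial ι R) : addVar i c (X j) = X j := by
  rw [addVar, aeval_X, Function.update_of_ne h]

theorem addVar_C (i : ι) (c : MvPolynomial ι R) (r : R) : addVar i c (C r) = C r := by
  rw [addVar, aeval_C, algebraMap_eq]

theorem addVar_comp {i : ι} {c d : MvPolynomial ι R} (h : addVar i c d = d) (hcd : c + d = 0) :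
    (addVar i c).comp (addVar i d) = AlgHom.id R _ := by
  refine algHom_ext fun j => ?_
  rw [AlgHom.comp_apply, AlgHom.id_apply]
  rcases eq_or_ne j i with rfl | hj
  · rw [addVar_X_self, map_add, addVar_X_self, h, add_assoc, hcd, add_zero]
  · rw [addVar_X_of_ne hj, addVar_X_of_ne hj]

/-- Differences of distinct variables are regular. -/
theorem eq_zero_of_X_sub_X_mul {i j : ι} (h : i ≠ j) {p : MvPolynomial ι R}
    (hp : (X i - X j) * p = 0) : p = 0 := by
  -- The substitution `X i ↦ X i + X j` is invertible and turns the difference into the variable `X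
  -- i`, which is not a zero divisor.
  have e := congrArg (addVar i (X j)) hp
  rw [map_mul, map_sub, addVar_X_self, addVar_X_of_ne h.symm, add_sub_cancel_right, map_zero] at e
  have e' : addVar i (X j) p = 0 := by
    rw [← X_mul_cancel_left_iff (i := i), e, mul_zero]
  have c := addVar_comp (R := R) (i := i) (c := -X j) (d := X j) (addVar_X_of_ne h.symm _)
    (neg_add_cancel _)
  have := AlgHom.congr_fun c p
  rw [AlgHom.comp_apply, e', map_zero, AlgHom.id_apply] at this
  exact this.symm

end MvPolynomial

end Translation

/-- Pairs of families of matrix units. -/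
theorem IsGl.prod {L L' : Type*} [LieRing L] [LieRing L'] {n : ℕ} {E : ℕ → ℕ → L}
    {E' : ℕ → ℕ → L'} (h : IsGl n E) (h' : IsGl n E') : IsGl n fun a b => (E a b, E' a b) := by
  intro a b c d ha hb hc hd
  ext1
  · exact (h ha hb hc hd).trans (by split_ifs <;> rfl)
  · exact (h' ha hb hc hd).trans (by split_ifs <;> rfl)

namespace ShiftArray

open MvPolynomial

variable {K : Type*} [CommRing K] [Algebra ℂ K] {eps : ℂ} {N : ℕ}

/-- The shift `X j ↦ X j + eps` as an automorphism. -/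
noncomputable def varShift (K : Type*) [CommRing K] [Algebra ℂ K] (eps : ℂ) (j : Fin N) :
    MvPolynomial (Fin N) K ≃ₐ[ℂ] MvPolynomial (Fin N) K :=
  (AlgEquiv.ofAlgHom (addVar j (C (algebraMap ℂ K eps))) (addVar j (C (algebraMap ℂ K (-eps))))
    (addVar_comp (addVar_C _ _ _) (by simp))
    (addVar_comp (addVar_C _ _ _) (by simp))).restrictScalars ℂ

theorem varShift_apply (j : Fin N) (F : MvPolynomial (Fin N) K) :
    varShift K eps j F = addVar j (C (algebraMap ℂ K eps)) F := rfl

theorem varShift_comm (j k : Fin N) (F : MvPolynomial (Fin N) K) :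
    varShift K eps j (varShift K eps k F) = varShift K eps k (varShift K eps j F) := by
  simp only [varShift_apply, ← AlgHom.comp_apply]
  refine AlgHom.congr_fun (algHom_ext fun i => ?_) F
  rcases eq_or_ne j k with rfl | hjk
  · rfl
  simp only [AlgHom.comp_apply]
  rcases eq_or_ne i j with rfl | hij
  · rw [addVar_X_self, addVar_X_of_ne hjk, addVar_X_self, map_add, addVar_C, addVar_X_of_ne hjk]
  · rcases eq_or_ne i k with rfl | hik
    · rw [addVar_X_self, addVar_X_of_ne hij, addVar_X_self, map_add, addVar_C, addVar_X_of_ne hij]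
    · simp only [addVar_X_of_ne hij, addVar_X_of_ne hik]

theorem varShift_mapAlgEquiv (j : Fin N) (s : K ≃ₐ[ℂ] K) (F : MvPolynomial (Fin N) K) :
    varShift K eps j (mapAlgEquiv (Fin N) s F) = mapAlgEquiv (Fin N) s (varShift K eps j F) := by
  simp only [varShift_apply, mapAlgEquiv_apply]
  induction F using MvPolynomial.induction_on with
  | C a => simp only [map_C, addVar_C]
  | add p q hp hq => simp only [map_add, hp, hq]
  | mul_X p i hp =>
    simp only [map_mul, hp, map_X]
    congr 1
    rcases eq_or_ne i j with rfl | hij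
    · rw [addVar_X_self, map_add, map_X, map_C, RingHom.coe_coe, AlgEquiv.commutes]
    · rw [addVar_X_of_ne hij, map_X]

variable (D : ShiftArray K eps N N)

/-- The array in which the entries of the last level are replaced by variables. -/
noncomputable def generic : ShiftArray (MvPolynomial (Fin N) K) eps (N + 1) N where
  γ n j := if h : n = N then X (Fin.cast h j) else C (D.γ n j)
  σ n j := if h : n = N then varShift K eps (Fin.cast h j) else mapAlgEquiv (Fin N) (D.σ n j)
  a n j := C (D.a n j)
  le := N.le_succ
  ne_zero := D.ne_zero
  self n j hn := by
    split_ifs with h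
    · rw [varShift_apply, addVar_X_self]; rfl
    · rw [mapAlgEquiv_apply, map_C, RingHom.coe_coe, D.self n j (by omega), C_add]; rfl
  same n j k hn hjk := by
    split_ifs with h
    · exact addVar_X_of_ne (fun e => hjk (Fin.cast_injective h e.symm)) _
    · rw [mapAlgEquiv_apply, map_C, RingHom.coe_coe, D.same n j k (by omega) hjk]
  other n j m k hn hnm := by
    split_ifs with h₁ h₂ h₂
    · omega
    · rw [varShift_apply, addVar_C]
    · rw [mapAlgEquiv_apply, map_X]
    · rw [mapAlgEquiv_apply, map_C, RingHom.coe_coe, D.other n j m k (by omega) hnm]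
  comm n j m k F := by
    split_ifs with h₁ h₂ h₂
    · exact varShift_comm _ _ _
    · exact varShift_mapAlgEquiv _ _ _
    · exact (varShift_mapAlgEquiv _ _ _).symm
    · simp only [mapAlgEquiv_apply]
      induction F using MvPolynomial.induction_on with
      | C x => simp only [map_C, RingHom.coe_coe, D.comm n j m k x]
      | add p q hp hq => simp only [map_add, hp, hq]
      | mul_X p i hp => simp only [map_mul, hp, map_X]
  inv n j hn := by
    simp only [dif_neg hn.ne, ← C_sub, ← map_prod, ← C_mul, D.inv n j hn, C_1]

/-- Evaluation of the variables at the entries of the last level. -/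
noncomputable def evalLast : MvPolynomial (Fin N) K →ₐ[K] K := aeval (D.γ N)

theorem evalLast_C (x : K) : D.evalLast (C x) = x := by
  rw [evalLast, aeval_C]; rfl

theorem evalLast_algebraMap (t : ℂ) : D.evalLast (algebraMap ℂ _ t) = algebraMap ℂ K t :=
  D.evalLast_C _

theorem evalLast_γ (n : ℕ) (j : Fin n) : D.evalLast (D.generic.γ n j) = D.γ n j := by
  simp only [generic]
  split_ifs with h
  · subst h; rw [evalLast, aeval_X]; rfl
  · exact D.evalLast_C _

theorem evalLast_a (n : ℕ) (j : Fin n) : D.evalLast (D.generic.a n j) = D.a n j := D.evalLast_C _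

/-- Below the last level the shifts fix the values substituted for the variables, so they commute
with the substitution. -/
theorem evalLast_σ {n : ℕ} (hn : n < N) (j : Fin n) (F : MvPolynomial (Fin N) K) :
    D.evalLast (D.generic.σ n j F) = D.σ n j (D.evalLast F) := by
  simp only [generic, dif_neg hn.ne, mapAlgEquiv_apply]
  induction F using MvPolynomial.induction_on with
  | C a => rw [map_C, evalLast_C, evalLast_C]; rfl
  | add p q hp hq => simp only [map_add, hp, hq]
  | mul_X p i hp =>
    simp only [map_mul, hp, map_X]
    rw [evalLast, aeval_X, D.other n j N i hn hn.ne]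

theorem evalLast_σ_symm {n : ℕ} (hn : n < N) (j : Fin n) (F : MvPolynomial (Fin N) K) :
    D.evalLast ((D.generic.σ n j).symm F) = (D.σ n j).symm (D.evalLast F) := by
  rw [AlgEquiv.eq_symm_apply, ← D.evalLast_σ hn, AlgEquiv.apply_symm_apply]

theorem evalLast_smul (t : ℂ) (F : MvPolynomial (Fin N) K) :
    D.evalLast (t • F) = t • D.evalLast F := by
  rw [Algebra.smul_def, map_mul, evalLast_algebraMap, ← Algebra.smul_def]

theorem evalLast_diag (m : ℕ) (F : MvPolynomial (Fin N) K) :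
    D.evalLast (D.generic.diag m F) = D.diag m (D.evalLast F) := by
  simp only [diag, LinearMap.smul_apply, evalLast_smul, LinearMap.mulLeft_apply, map_mul, diagCoeff,
    map_sub, map_sum, evalLast_γ]

theorem evalLast_up {m : ℕ} (hm : m + 1 < N) (F : MvPolynomial (Fin N) K) :
    D.evalLast (D.generic.up m F) = D.up m (D.evalLast F) := by
  simp only [up, LinearMap.smul_apply, evalLast_smul, LinearMap.sum_apply, map_sum, shiftTerm_apply,
    map_mul, upCoeff, map_prod, map_sub, evalLast_γ, evalLast_a, evalLast_algebraMap,
    D.evalLast_σ_symm hm]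

theorem evalLast_down {m : ℕ} (hm : m + 1 < N) (F : MvPolynomial (Fin N) K) :
    D.evalLast (D.generic.down m F) = D.down m (D.evalLast F) := by
  simp only [down, LinearMap.smul_apply, evalLast_smul, LinearMap.sum_apply, map_sum,
    shiftTerm_apply, map_mul, downCoeff, map_prod, map_sub, map_add, evalLast_γ, evalLast_a,
    evalLast_algebraMap, D.evalLast_σ hm]

variable {D}

theorem IsGen.evalLast {E : ℕ → ℕ → Module.End ℂ K}
    {E' : ℕ → ℕ → Module.End ℂ (MvPolynomial (Fin N) K)} (hG : D.IsGen N E) (hE : IsGl N E)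
    (hG' : D.generic.IsGen N E') (hE' : IsGl N E') {a b : ℕ} (ha : a < N) (hb : b < N)
    (F : MvPolynomial (Fin N) K) : D.evalLast (E' a b F) = E a b (D.evalLast F) := by
  -- Being intertwined by `evalLast` is a property of pairs of operators that is stable under
  -- brackets, so it is checked on generators.
  refine (hE'.prod hE).induction (P := fun x => ∀ F, D.evalLast (x.1 F) = x.2 (D.evalLast F)) ?_ ?_ ?_ ?_ ha hb F
  · intro x y hx hy F
    change D.evalLast (⁅x.1, y.1⁆ F) = ⁅x.2, y.2⁆ _
    rw [lie_end_apply, lie_end_apply, map_sub, hx, hy, hy, hx]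
  · intro a ha F
    simp only [hG'.diag a ha, hG.diag a ha, evalLast_diag]
  · intro a ha F
    simp only [hG'.up a ha, hG.up a ha, evalLast_up _ ha]
  · intro a ha F
    simp only [hG'.down a ha, hG.down a ha, evalLast_down _ ha]

theorem list_prod_evalLast {l : ℕ} {f' : Fin l → Module.End ℂ (MvPolynomial (Fin N) K)}
    {f : Fin l → Module.End ℂ K} (h : ∀ i F, D.evalLast (f' i F) = f i (D.evalLast F))
    (F : MvPolynomial (Fin N) K) :
    D.evalLast ((List.ofFn f').prod F) = (List.ofFn f).prod (D.evalLast F) := by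
  induction l generalizing F with
  | zero => simp
  | succ l ih =>
    rw [List.ofFn_succ, List.ofFn_succ, List.prod_cons, List.prod_cons, Module.End.mul_apply,
      Module.End.mul_apply, h, ih fun i => h i.succ]

theorem IsGen.evalLast_colDet {E : ℕ → ℕ → Module.End ℂ K}
    {E' : ℕ → ℕ → Module.End ℂ (MvPolynomial (Fin N) K)} (hG : D.IsGen N E) (hE : IsGl N E)
    (hG' : D.generic.IsGen N E') (hE' : IsGl N E') (t : ℂ) (F : MvPolynomial (Fin N) K) :
    D.evalLast (colDet eps E' (algebraMap ℂ _ t) (id : Fin N → Fin N) F) =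
      colDet eps E (algebraMap ℂ _ t) (id : Fin N → Fin N) (D.evalLast F) := by
  simp only [colDet, LinearMap.sum_apply, map_sum, LinearMap.smul_apply, map_zsmul]
  refine Finset.sum_congr rfl fun p _ => congrArg _ (list_prod_evalLast (fun k F => ?_) F)
  simp only [colEntry, LinearMap.sub_apply, LinearMap.smul_apply, map_sub, evalLast_smul,
    hG.evalLast hE hG' hE' (p k).2 (id k).2]
  congr 1
  split_ifs
  · simp only [LinearMap.sub_apply, Module.algebraMap_end_apply, map_sub, evalLast_smul]
  · simp

/-- The column determinant of the last level acts as multiplication by `∏ j, (t - γ N j)`. -/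
theorem IsGen.colDet_apply_last {E : ℕ → ℕ → Module.End ℂ K} (hG : D.IsGen N E) (hE : IsGl N E)
    (hN : N ≠ 0) (t : ℂ) (F : K) :
    colDet eps E (algebraMap ℂ _ t) (id : Fin N → Fin N) F =
      (∏ j, (algebraMap ℂ K t - D.γ N j)) * F := by
  obtain ⟨E', hE', hG'⟩ := D.generic.exists_isGl le_rfl
  obtain ⟨m, rfl⟩ := Nat.exists_eq_succ_of_ne_zero hN
  -- The generic result is applied to the constant polynomial `C F` and then specialised.
  have h := congrArg D.evalLast (hG'.colDet_apply hE' (by omega) (by omega) (fun i j hij x hx =>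
    eq_zero_of_X_sub_X_mul hij (by simpa [generic] using hx)) t (C F))
  rw [hG.evalLast_colDet hE hG' hE', map_mul, evalLast_C, map_prod] at h
  simpa only [map_sub, evalLast_algebraMap, evalLast_γ] using h

/-- The column determinant of level `n < N` acts as multiplication by `∏ j, (t - γ n j)`. -/
theorem IsGen.colDet_apply_of_lt {E : ℕ → ℕ → Module.End ℂ K} (hG : D.IsGen N E) (hE : IsGl N E)
    {n : ℕ} (h0 : n ≠ 0) (hn : n < N) (t : ℂ) (F : K) :
    colDet eps E (algebraMap ℂ _ t) (id : Fin n → Fin n) F =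
      (∏ j, (algebraMap ℂ K t - D.γ n j)) * F := by
  obtain ⟨m, rfl⟩ := Nat.exists_eq_succ_of_ne_zero h0
  refine (hG.mono hn.le).colDet_apply (hE.mono hn.le) hn (by omega) (fun i j hij x hx => ?_) t F
  have h := D.inv (m + 1) i hn
  rw [← Finset.mul_prod_erase _ _ (Finset.mem_erase.2 ⟨hij.symm, Finset.mem_univ j⟩)] at h
  rw [← one_mul x, ← h]
  linear_combination (D.a (m + 1) i * ∏ k ∈ (Finset.univ.erase i).erase j,
    (D.γ (m + 1) i - D.γ (m + 1) k)) * hx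

end ShiftArray

/-! ### The array of meromorphic functions -/

section Meromorphic

variable {X : Type*} [NormedAddCommGroup X] [NormedSpace ℂ X]

theorem toMero_eq_iff {f g : X → ℂ} (hf : ∀ p, IsMeroAt f p) (hg : ∀ p, IsMeroAt g p) :
    toMero f hf = toMero g hg ↔ Dense (interior {z | f z - g z = 0}) :=
  Ideal.Quotient.eq

theorem toMero_prod {ι : Type*} (s : Finset ι) {f : ι → X → ℂ} (hf : ∀ i p, IsMeroAt (f i) p)
    {g : X → ℂ} (hg : ∀ p, IsMeroAt g p) (h : ∀ z, g z = ∏ i ∈ s, f i z) :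
    ∏ i ∈ s, toMero (f i) (hf i) = toMero g hg := by
  simp only [toMero, ← map_prod]
  congr 1
  refine Subtype.ext (funext fun z => ?_)
  have e := map_prod (meroRep X).val (fun i => (⟨f i, hf i⟩ : meroRep X)) s
  exact (congrFun e z).trans ((Finset.prod_apply _ _ _).trans (h z).symm)

/-- The product is `1` where `f` does not vanish, and this set is open and dense. -/
theorem toMero_inv_mul {f : X → ℂ} (hf : ∀ p, AnalyticAt ℂ f p) (hn : ∀ p, ∃ᶠ z in 𝓝 p, f z ≠ 0) :
    toMero (fun z => (f z)⁻¹) (fun p => (hf p).isMeroAt_inv (hn p)) *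
      toMero f (fun p => (hf p).isMeroAt) = 1 := by
  change toMero (fun z => (f z)⁻¹ * f z) (fun p => ((hf p).isMeroAt_inv (hn p)).mul
    (hf p).isMeroAt) = toMero (fun _ => 1) fun p => analyticAt_const.isMeroAt
  rw [toMero_eq_iff]
  have o : IsOpen {z | f z ≠ 0} :=
    isOpen_ne_fun (continuous_iff_continuousAt.2 fun p => (hf p).continuousAt) continuous_const
  refine Dense.mono (interior_maximal (fun z hz => ?_) o) fun p =>
    mem_closure_iff_frequently.2 (hn p)
  change (f z)⁻¹ * f z - 1 = 0
  rw [inv_mul_cancel₀ hz, sub_self]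

theorem meroShift_meroShift (v w : X) (F : MeroFun X) :
    meroShift v (meroShift w F) = meroShift (v + w) F := by
  obtain ⟨⟨f, hf⟩, rfl⟩ := Ideal.Quotient.mk_surjective F
  change toMero (fun z => f (z + v + w)) _ = toMero (fun z => f (z + (v + w))) _
  simp only [add_assoc]

theorem meroShift_zero (F : MeroFun X) : meroShift 0 F = F := by
  obtain ⟨⟨f, hf⟩, rfl⟩ := Ideal.Quotient.mk_surjective F
  change toMero (fun z => f (z + 0)) _ = toMero f _
  simp only [add_zero]

/-- Translation of meromorphic functions as an automorphism. -/
noncomputable def meroShiftEquiv (v : X) : MeroFun X ≃ₐ[ℂ] MeroFun X :=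
  AlgEquiv.ofAlgHom (meroShift v) (meroShift (-v))
    (AlgHom.ext fun F => by
      rw [AlgHom.comp_apply, meroShift_meroShift, add_neg_cancel, meroShift_zero]; rfl)
    (AlgHom.ext fun F => by
      rw [AlgHom.comp_apply, meroShift_meroShift, neg_add_cancel, meroShift_zero]; rfl)

theorem meroShiftEquiv_apply (v : X) (F : MeroFun X) : meroShiftEquiv v F = meroShift v F := rfl

theorem meroShiftEquiv_symm_apply (v : X) (F : MeroFun X) :
    (meroShiftEquiv v).symm F = meroShift (-v) F := rfl

end Meromorphic

namespace GelfandZetlin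

variable {N : ℕ} (label : Fin N → ℂ)

theorem meroShift_gamM (v : Var N → ℂ) {n : ℕ} (hn : n ≤ N) (j : Fin n) :
    meroShift v (gamM label hn j) = gamM label hn j +
      algebraMap ℂ (M N) (if h : n < N then v ⟨⟨n, h⟩, j⟩ else 0) := by
  have e : ∀ c : ℂ, (∀ z, gam label hn j (z + v) = gam label hn j z + c) →
      meroShift v (gamM label hn j) = gamM label hn j + algebraMap ℂ (M N) c := by
    intro c hc
    rw [gamM, meroShift_toMero]
    change _ = toMero (fun z => gam label hn j z + c) fun p =>
      (analyticAt_gam label hn j p).isMeroAt.add analyticAt_const.isMeroAt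
    simp only [hc]
  split_ifs with h <;> exact e _ fun z => by simp [gam, h]

/-- The inverse of `∏_{s ≠ j} (γ_{n,j} - γ_{n,s})`. -/
noncomputable def invDen {n : ℕ} (hn : n < N) (j : Fin n) : M N :=
  toMero (fun z => 1 / den label hn.le j z)
    (isMeroAt_div_den label hn j (g := fun _ => 1) fun _ => analyticAt_const)

theorem analyticAt_den {n : ℕ} (hn : n ≤ N) (j : Fin n) (p : Var N → ℂ) :
    AnalyticAt ℂ (den label hn j) p :=
  Finset.analyticAt_fun_prod _ fun r _ =>
    (analyticAt_gam label hn j p).sub (analyticAt_gam label hn r p)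

theorem frequently_den_ne_zero {n : ℕ} (hn : n < N) (j : Fin n) (p : Var N → ℂ) :
    ∃ᶠ z in 𝓝 p, den label hn.le j z ≠ 0 := by
  have key : ∀ s : Finset (Fin n), j ∉ s →
      ∃ᶠ z in 𝓝 p, ∏ r ∈ s, (gam label hn.le j z - gam label hn.le r z) ≠ 0 := by
    intro s
    induction s using Finset.induction_on with
    | empty => exact fun _ => Frequently.of_forall fun z => by simp
    | insert r s hr ih =>
      intro h
      simp only [Finset.prod_insert hr]
      have hjr : r ≠ j := fun e => h (e ▸ Finset.mem_insert_self _ _)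
      exact frequently_mul_ne_zero ((analyticAt_gam label hn.le j p).sub
        (analyticAt_gam label hn.le r p)) (Finset.analyticAt_fun_prod _ fun r _ =>
        (analyticAt_gam label hn.le j p).sub (analyticAt_gam label hn.le r p))
        (frequently_gam_sub_ne_zero label hn hjr p)
        (ih fun e => h (Finset.mem_insert_of_mem e))
  exact key _ (Finset.notMem_erase _ _)

theorem invDen_mul {n : ℕ} (hn : n < N) (j : Fin n) :
    invDen label hn j * ∏ k ∈ Finset.univ.erase j, (gamM label hn.le j - gamM label hn.le k) = 1 := by
  rw [← toMero_inv_mul (analyticAt_den label hn.le j) (frequently_den_ne_zero label hn j), invDen]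
  congr 1
  · simp only [one_div]
  · exact toMero_prod _ (fun k p => ((analyticAt_gam label hn.le j p).sub
      (analyticAt_gam label hn.le k p)).isMeroAt) _ fun z => rfl

theorem prod_mul_invDen {n : ℕ} (hn : n < N) (j : Fin n) {ι : Type*} [Fintype ι]
    {f : ι → (Var N → ℂ) → ℂ} (hf : ∀ i p, AnalyticAt ℂ (f i) p) {g : (Var N → ℂ) → ℂ}
    (hg : ∀ p, IsMeroAt g p) (h : ∀ z, g z = (∏ i, f i z) / den label hn.le j z) :
    (∏ i, toMero (f i) fun p => (hf i p).isMeroAt) * invDen label hn j = toMero g hg := by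
  have hP : ∀ p, AnalyticAt ℂ (fun z => ∏ i, f i z) p := fun p =>
    Finset.analyticAt_fun_prod _ fun i _ => hf i p
  rw [toMero_prod Finset.univ (fun i p => (hf i p).isMeroAt) (fun p => (hP p).isMeroAt) fun _ => rfl]
  change toMero (fun z => (∏ i, f i z) * (1 / den label hn.le j z)) (fun p => (hP p).isMeroAt.mul
    (isMeroAt_div_den label hn j (g := fun _ => 1) (fun _ => analyticAt_const) p)) = _
  simp only [mul_one_div, ← h]

variable {hbar : ℂ}

/-- The variables `γ_{n,j}` and their shifts by `i ħ` in the space `M`. -/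
noncomputable def array (hbar_ne : hbar ≠ 0) : ShiftArray (M N) (Complex.I * hbar) N N where
  γ n j := if h : n ≤ N then gamM label h j else 0
  -- The entries of level `N` are constants, so the default there is the identity. The values of all
  -- fields beyond level `N` are irrelevant.
  σ n j := if h : n < N then meroShiftEquiv (Pi.single (⟨⟨n, h⟩, j⟩ : Var N) (Complex.I * hbar))
    else AlgEquiv.refl
  a n j := if h : n < N then invDen label h j else 0
  le := le_rfl
  ne_zero := mul_ne_zero Complex.I_ne_zero hbar_ne
  self n j hn := by
    rw [dif_pos hn, dif_pos hn.le, meroShiftEquiv_apply, meroShift_gamM, dif_pos hn,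
      Pi.single_eq_same]
  same n j k hn hjk := by
    rw [dif_pos hn, dif_pos hn.le, meroShiftEquiv_apply, meroShift_gamM, dif_pos hn,
      Pi.single_eq_of_ne, map_zero, add_zero]
    intro h
    simp only [Sigma.mk.injEq, heq_eq_eq, true_and] at h
    exact hjk h.symm
  other n j m k hn hnm := by
    rw [dif_pos hn]
    split_ifs with hm
    · rw [meroShiftEquiv_apply, meroShift_gamM]
      split_ifs with hm'
      · rw [Pi.single_eq_of_ne, map_zero, add_zero]
        intro h
        exact hnm (by simpa using (congrArg (fun x : Var N => x.1.1) h).symm)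
      · rw [map_zero, add_zero]
    · exact map_zero _
  comm n j m k F := by
    split_ifs
    · simp only [meroShiftEquiv_apply, meroShift_meroShift, add_comm]
    · rfl
    · rfl
    · rfl
  inv n j hn := by
    rw [dif_pos hn, ← invDen_mul label hn j]
    simp only [dif_pos hn.le]

variable (hbar_ne : hbar ≠ 0)

theorem array_γ {n : ℕ} (hn : n ≤ N) (j : Fin n) :
    (array label hbar_ne).γ n j = gamM label hn j := dif_pos hn

theorem array_diag {m : ℕ} (hm : m + 1 ≤ N) :
    (array label hbar_ne).diag m = opDiag label hbar hm := by
  rw [ShiftArray.diag, ShiftArray.diagCoeff, opDiag, mulOp]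
  simp only [array_γ label hbar_ne hm, array_γ label hbar_ne (Nat.le_of_succ_le hm)]
  rfl

theorem array_up {m : ℕ} (hm : m + 1 < N) :
    (array label hbar_ne).up m = opUp label hbar hm := by
  rw [ShiftArray.up, opUp]
  congr 1
  refine Finset.sum_congr rfl fun j _ => LinearMap.ext fun F => ?_
  rw [shiftTerm_apply, LinearMap.comp_apply, mulOp, LinearMap.mulLeft_apply]
  congr 1
  · rw [ShiftArray.upCoeff]
    simp only [array_γ label hbar_ne hm.le, array_γ label hbar_ne (show m + 2 ≤ N from hm)]
    rw [show (array label hbar_ne).a (m + 1) j = invDen label hm j from dif_pos hm]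
    exact prod_mul_invDen label hm j (f := fun (r : Fin (m + 2)) z => gam label hm.le j z -
      gam label (Nat.succ_le_of_lt hm) r z - Complex.I * hbar / 2) (fun r p =>
      ((analyticAt_gam label _ j p).sub (analyticAt_gam label _ r p)).sub analyticAt_const)
      (isMeroAt_upCoeff label hbar hm j) fun z => rfl
  · simp only [array, dif_pos hm]
    rw [meroShiftEquiv_symm_apply, shift, Pi.single_neg]
    rfl

theorem array_down {m : ℕ} (hm : m + 1 < N) :
    (array label hbar_ne).down m = opDown label hbar hm := by
  rw [ShiftArray.down, opDown]
  congr 1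
  refine Finset.sum_congr rfl fun j _ => LinearMap.ext fun F => ?_
  rw [shiftTerm_apply, LinearMap.comp_apply, mulOp, LinearMap.mulLeft_apply]
  congr 1
  · rw [ShiftArray.downCoeff]
    simp only [array_γ label hbar_ne hm.le, array_γ label hbar_ne (show m ≤ N by omega)]
    rw [show (array label hbar_ne).a (m + 1) j = invDen label hm j from dif_pos hm]
    exact prod_mul_invDen label hm j (f := fun (r : Fin m) z => gam label hm.le j z -
      gam label (Nat.le_of_succ_le hm.le) r z + Complex.I * hbar / 2) (fun r p =>
      ((analyticAt_gam label _ j p).sub (analyticAt_gam label _ r p)).add analyticAt_const)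
      (isMeroAt_downCoeff label hbar hm j) fun z => rfl
  · simp only [array, dif_pos hm]
    rw [meroShiftEquiv_apply, shift]
    rfl

end GelfandZetlin

/-! ### Families of matrix units and representations -/

section Representations

variable {N : ℕ} {L : Type*} [LieRing L] [LieAlgebra ℂ L]

theorem Matrix.single_one_lie (i j k l : Fin N) :
    ⁅Matrix.single i j (1 : ℂ), Matrix.single k l (1 : ℂ)⁆ =
      (if j = k then Matrix.single i l 1 else 0) - (if i = l then Matrix.single k j 1 else 0) := by
  rw [LieRing.of_associative_ring_bracket]
  congr 1
  · split_ifs with h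
    · subst h; rw [Matrix.single_mul_single_same, one_mul]
    · rw [Matrix.single_mul_single_of_ne _ _ _ _ h]
  · split_ifs with h
    · subst h; rw [Matrix.single_mul_single_same, one_mul]
    · rw [Matrix.single_mul_single_of_ne _ _ _ _ (Ne.symm h)]

/-- The images of the matrix units under a homomorphism from `𝔤𝔩(N)`. -/
noncomputable def unitImage (ρ : Matrix (Fin N) (Fin N) ℂ →ₗ⁅ℂ⁆ L) (a b : ℕ) : L :=
  if h : a < N ∧ b < N then ρ (Matrix.single ⟨a, h.1⟩ ⟨b, h.2⟩ 1) else 0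

theorem unitImage_coe (ρ : Matrix (Fin N) (Fin N) ℂ →ₗ⁅ℂ⁆ L) (i j : Fin N) :
    unitImage ρ i j = ρ (Matrix.single i j 1) := dif_pos ⟨i.2, j.2⟩

theorem isGl_unitImage (ρ : Matrix (Fin N) (Fin N) ℂ →ₗ⁅ℂ⁆ L) : IsGl N (unitImage ρ) := by
  intro a b c d ha hb hc hd
  have h := congrArg ρ (Matrix.single_one_lie ⟨a, ha⟩ ⟨b, hb⟩ ⟨c, hc⟩ ⟨d, hd⟩)
  rw [LieHom.map_lie, map_sub] at h
  simp only [unitImage, ha, hb, hc, hd, and_self, dif_pos, h]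
  simp only [Fin.mk.injEq]
  congr 1 <;> split_ifs <;> simp

theorem lieHom_ext {ρ ρ' : Matrix (Fin N) (Fin N) ℂ →ₗ⁅ℂ⁆ L}
    (h : ∀ i j, ρ (Matrix.single i j 1) = ρ' (Matrix.single i j 1)) : ρ = ρ' := by
  refine LieHom.ext fun X => ?_
  induction X using Matrix.induction_on' with
  | h_zero => rw [map_zero, map_zero]
  | h_add p q hp hq => rw [map_add, map_add, hp, hq]
  | h_std_basis i j x =>
    rw [← mul_one x, ← smul_eq_mul, ← Matrix.smul_single, map_smul, map_smul, h]

/-- A family satisfying the relations of the matrix units comes from a homomorphism. -/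
theorem IsGl.exists_lieHom {E : ℕ → ℕ → L} (hE : IsGl N E) :
    ∃ ρ : Matrix (Fin N) (Fin N) ℂ →ₗ⁅ℂ⁆ L, ∀ i j : Fin N, ρ (Matrix.single i j 1) = E i j := by
  let f : Matrix (Fin N) (Fin N) ℂ →ₗ[ℂ] L :=
    ∑ i, ∑ j, (Matrix.entryLinearMap ℂ ℂ i j).smulRight (E i j)
  have fs : ∀ (i j : Fin N) (x : ℂ), f (Matrix.single i j x) = x • E i j := by
    intro i j x
    simp only [f, LinearMap.sum_apply, LinearMap.smulRight_apply, Matrix.entryLinearMap_apply,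
      Matrix.single_apply]
    rw [Finset.sum_eq_single i, Finset.sum_eq_single j]
    · simp
    · intro k _ hk; simp [hk.symm]
    · simp
    · intro k _ hk; simp [hk.symm]
    · simp
  have hf : ∀ X Y, f ⁅X, Y⁆ = ⁅f X, f Y⁆ := by
    intro X Y
    induction X using Matrix.induction_on' with
    | h_zero => simp
    | h_add p q hp hq => simp only [add_lie, map_add, hp, hq]
    | h_std_basis i j x =>
      induction Y using Matrix.induction_on' with
      | h_zero => simp
      | h_add p q hp hq => simp only [lie_add, map_add, hp, hq]
      | h_std_basis k l y =>
        have e : ∀ (i j : Fin N) (x : ℂ), Matrix.single i j x = x • Matrix.single i j (1 : ℂ) := by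
          intro i j x; rw [Matrix.smul_single, smul_eq_mul, mul_one]
        rw [e i j x, e k l y, smul_lie, lie_smul, map_smul, map_smul, map_smul, map_smul, smul_lie,
          lie_smul, Matrix.single_one_lie, fs, fs, one_smul, one_smul, hE i.2 j.2 k.2 l.2, map_sub]
        simp only [Fin.val_inj]
        congr 3 <;> split_ifs <;> simp [fs]
  exact ⟨{ f with map_lie' := hf _ _ }, fun i j => (fs i j 1).trans (one_smul _ _)⟩

end Representations

/-! ### The Gelfand-Zetlin representation -/

namespace GelfandZetlin

variable {N : ℕ} {label : Fin N → ℂ} {hbar : ℂ}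

theorem isGZRep_iff (hbar_ne : hbar ≠ 0) (ρ : gl N →ₗ⁅ℂ⁆ Module.End ℂ (M N)) :
    IsGZRep label hbar ρ ↔ (array label hbar_ne).IsGen N (unitImage ρ) := by
  constructor
  · intro h
    refine ⟨fun k hk => ?_, fun k hk => ?_, fun k hk => ?_⟩
    · rw [array_diag label hbar_ne hk, ← h.diag k hk, ← unitImage_coe]
    · rw [array_up label hbar_ne hk, ← h.up k hk, ← unitImage_coe]
    · rw [array_down label hbar_ne hk, ← h.down k hk, ← unitImage_coe]
  · intro h
    refine ⟨fun k hk => ?_, fun k hk => ?_, fun k hk => ?_⟩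
    · rw [← array_diag label hbar_ne hk, ← h.diag k hk, ← unitImage_coe]
    · rw [← array_up label hbar_ne hk, ← h.up k hk, ← unitImage_coe]
    · rw [← array_down label hbar_ne hk, ← h.down k hk, ← unitImage_coe]

theorem existsUnique_isGZRep (label : Fin N → ℂ) (hbar_ne : hbar ≠ 0) :
    ∃! ρ : gl N →ₗ⁅ℂ⁆ Module.End ℂ (M N), IsGZRep label hbar ρ := by
  obtain ⟨F, hF, hG⟩ := (array label hbar_ne).exists_isGl le_rfl
  obtain ⟨ρ, hρ⟩ := hF.exists_lieHom
  have e : ∀ a b (ha : a < N) (hb : b < N), unitImage ρ a b = F a b := fun a b ha hb =>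
    (unitImage_coe ρ ⟨a, ha⟩ ⟨b, hb⟩).trans (hρ _ _)
  have h : IsGZRep label hbar ρ := by
    rw [isGZRep_iff hbar_ne]
    refine ⟨fun k hk => ?_, fun k hk => ?_, fun k hk => ?_⟩
    · rw [e _ _ hk hk, hG.diag k hk]
    · rw [e _ _ (Nat.lt_of_succ_lt hk) hk, hG.up k hk]
    · rw [e _ _ hk (Nat.lt_of_succ_lt hk), hG.down k hk]
  refine ⟨ρ, h, fun ρ' h' => lieHom_ext fun i j => ?_⟩
  rw [isGZRep_iff hbar_ne] at h h'
  rw [← unitImage_coe, ← unitImage_coe]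
  -- Uniqueness: equality of the two components of a pair is stable under brackets, so it spreads
  -- from the generators to all matrix units.
  refine ((isGl_unitImage ρ').prod (isGl_unitImage ρ)).induction (P := fun x => x.1 = x.2)
    (fun x y hx hy => ?_) (fun a ha => ?_) (fun a ha => ?_) (fun a ha => ?_) i.2 j.2
  · change ⁅x.1, y.1⁆ = ⁅x.2, y.2⁆
    rw [hx, hy]
  · exact (h'.diag a ha).trans (h.diag a ha).symm
  · exact (h'.up a ha).trans (h.up a ha).symm
  · exact (h'.down a ha).trans (h.down a ha).symm

theorem lift_casimirGen {A : Type*} [Ring A] [Algebra ℂ A] (ρ : gl N →ₗ⁅ℂ⁆ A) {n : ℕ} (hn : n ≤ N) (t : ℂ) :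
    UniversalEnvelopingAlgebra.lift ℂ ρ (casimirGen hbar hn t) =
      colDet (Complex.I * hbar) (unitImage ρ) (algebraMap ℂ _ t) (id : Fin n → Fin n) := by
  rw [casimirGen, colDet, map_sum]
  refine Finset.sum_congr rfl fun p _ => ?_
  rw [map_zsmul, map_list_prod, List.map_ofFn]
  congr 3
  funext k
  rw [Function.comp_apply, map_sub, LinearMapClass.map_smul, AlgHom.commutes, UniversalEnvelopingAlgebra.lift_ι_apply,
    colEntry, ← unitImage_coe]
  congr 1
  simp only [id]
  split_ifs
  · exact map_sub _ _ _
  · exact map_zero _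

end GelfandZetlin

/-- The Gelfand-Zetlin operators extend to a unique representation of `𝔤𝔩(N)` in `M`, and in it
`𝒜_n(t)` acts as multiplication by `∏_j (t - γ_{n,j})`, for `n = 1, …, N`. -/
theorem proposition2p4 (N : ℕ) (hbar : ℂ) (hbar_ne : hbar ≠ 0) (label : Fin N → ℂ) :
    (∃! ρ : GelfandZetlin.gl N →ₗ⁅ℂ⁆ Module.End ℂ (GelfandZetlin.M N),
      GelfandZetlin.IsGZRep label hbar ρ) ∧
    ∀ ρ : GelfandZetlin.gl N →ₗ⁅ℂ⁆ Module.End ℂ (GelfandZetlin.M N),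
      GelfandZetlin.IsGZRep label hbar ρ →
      ∀ (n : ℕ) (_ : 1 ≤ n) (hn : n ≤ N) (t : ℂ) (F : GelfandZetlin.M N),
        UniversalEnvelopingAlgebra.lift ℂ ρ (GelfandZetlin.casimirGen hbar hn t) F =
          (∏ j : Fin n,
            (algebraMap ℂ (GelfandZetlin.M N) t - GelfandZetlin.gamM label hn j)) * F := by
  refine ⟨GelfandZetlin.existsUnique_isGZRep label hbar_ne, fun ρ hρ n h1 hn t F => ?_⟩
  rw [GelfandZetlin.isGZRep_iff hbar_ne] at hρ
  rw [GelfandZetlin.lift_casimirGen]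
  simp only [← GelfandZetlin.array_γ label hbar_ne hn]
  -- Below level `N` the differences of the entries are invertible; level `N` needs the
  -- specialisation from generic entries.
  rcases hn.lt_or_eq with hlt | rfl
  · exact hρ.colDet_apply_of_lt (isGl_unitImage ρ) (by omega) hlt t F
  · exact hρ.colDet_apply_last (isGl_unitImage ρ) (by omega) t F
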